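/- A closed surface is a connected compact Hausdorff space that is locally homeomorphic to $\mathbb R^2$. Let $S$ be a closed surface and $\phi\colon S\to\mathbb R^3$ a general position immersion, that is, a continuous, locally injective map with finitely many triple points such that every $p\in\phi(S)$ has an open neighbourhood $U$ in $\mathbb R^3$ and a homeomorphism $h$ from $U$ onto an open subset of $\mathbb R^3$ with $h(p)=0$ for which $\phi^{-1}(U)$ is a union of $k\le 3$ pairwise disjoint open sets $V_1,\dots,V_k$, where $h\circ\phi$ maps $V_i$ injectively onto $\{x\in h(U): x_i=0\}$ for each $i$. (Thus the image is locally flat, and sheets cross like two or three coordinate planes, up to homeomorphism.) Let $D_\phi=\{p\in\mathbb R^3 : |\phi^{-1}(p)|>1\}$ be the double set, let $\phi^{-1}(D_\phi)\subseteq S$ be the singular set, and call $p$ a triple point if $|\phi^{-1}(p)|=3$. Let $C\subseteq S$ be a simple closed curve (an embedded circle) that is orientation-reversing, i.e., every neighbourhood of $C$ in $S$ contains an embedded Möbius strip. Then $\phi(C)\cap D_\phi\neq\emptyset$. If, moreover, $C\cap\phi^{-1}(D_\phi)$ is finite, $C$ and $\phi^{-1}(D_\phi)$ intersect transversally at each of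 these points (i.e., in suitable topological coordinates of $S$ around the point they are the two coordinate axes), and $\phi(C)$ contains no triple point, then the number $|C\cap\phi^{-1}(D_\phi)|$ is odd. -/

import Mathlib

namespace ImmersedSurface

open Topology

/-- Euclidean `3`-space. -/
abbrev E3 : Type := EuclideanSpace ℝ (Fin 3)

/-- The Euclidean plane. -/
abbrev E2 : Type := EuclideanSpace ℝ (Fin 2)

/-- A closed surface: a connected compact Hausdorff space that is locally homeomorphic to the
plane. -/
structure IsClosedSurface (S : Type*) [TopologicalSpace S] : Prop where
  compact : CompactSpace S
  hausdorff : T2Space S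
  connected : ConnectedSpace S
  locally_plane : ∀ x : S, ∃ e : OpenPartialHomeomorph S E2, x ∈ e.source

section Maps

variable {S : Type*} [TopologicalSpace S]

/-- The double set: all points of space with more than one preimage. -/
def doubleSet (φ : S → E3) : Set E3 := {p | (φ ⁻¹' {p}).Nontrivial}

/-- The singular set: the preimage of the double set. -/
def singularSet (φ : S → E3) : Set S := φ ⁻¹' doubleSet φ

/-- The points with precisely three preimages. -/
def triplePoints (φ : S → E3) : Set E3 := {p | (φ ⁻¹' {p}).encard = 3}

/-- The local picture at a point `p` of the image: in a suitable topological coordinate system `h`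
of space around `p`, centred at `p`, the part of the surface that is mapped into the coordinate
neighbourhood splits into `k ≤ 3` pairwise disjoint open sheets, and the `i`-th sheet is mapped
injectively onto the coordinate plane `x i = 0` (within the coordinate neighbourhood), for `i < k`.
For `k = 1` this is local flatness of the image, for `k = 2` a transversal intersection of two
sheets, for `k = 3` an intersection of three sheets in the way coordinate planes intersect. -/
def IsCoordinatePlanesAt (φ : S → E3) (p : E3) : Prop :=
  ∃ (k : ℕ) (hk : k ≤ 3) (h : OpenPartialHomeomorph E3 E3) (V : Fin k → Set S),
    p ∈ h.source ∧ h p = 0 ∧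
    (∀ i, IsOpen (V i)) ∧
    (∀ i j, i ≠ j → Disjoint (V i) (V j)) ∧
    φ ⁻¹' h.source = ⋃ i, V i ∧
    ∀ i, Set.InjOn φ (V i) ∧
      h '' (φ '' V i) = {x | x ∈ h.target ∧ x (Fin.castLE hk i) = 0}

/-- A general position immersion into space: a continuous, locally injective map whose image looks
near each of its points like one, two or three coordinate planes, with finitely many triple
points. -/
structure IsGeneralPositionImmersion (φ : S → E3) : Prop where
  continuous : Continuous φ
  locally_injective : ∀ s : S, ∃ V ∈ 𝓝 s, Set.InjOn φ V
  coordinate_planes : ∀ p ∈ Set.range φ, IsCoordinatePlanesAt φ p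
  finite_triplePoints : (triplePoints φ).Finite

/-- A simple closed curve: an embedded copy of the circle. -/
def IsSimpleClosedCurve (C : Set S) : Prop :=
  ∃ γ : Circle → S, IsEmbedding γ ∧ Set.range γ = C

/-- The sets `A` and `B` intersect transversally at the point `s` of a surface: in suitable
topological coordinates around `s` they are the two coordinate axes. -/
def IsTransversalAt (A B : Set S) (s : S) : Prop :=
  ∃ e : OpenPartialHomeomorph S E2, s ∈ e.source ∧ e s = 0 ∧
    (∀ x ∈ e.source, x ∈ A ↔ e x 0 = 0) ∧
    (∀ x ∈ e.source, x ∈ B ↔ e x 1 = 0)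

end Maps

/-- The identifications `(x, t) ∼ (x + n, (-1) ^ n * t)`, `n` an integer, on the infinite strip
`ℝ × [-1, 1]`. -/
def mobiusSetoid : Setoid (ℝ × Set.Icc (-1 : ℝ) 1) where
  r a b := ∃ n : ℤ, b.1 = a.1 + n ∧ (b.2 : ℝ) = (-1 : ℝ) ^ n * a.2
  iseqv := by
    refine ⟨fun a => ⟨0, by simp⟩, ?_, ?_⟩
    · rintro a b ⟨n, h1, h2⟩
      refine ⟨-n, by rw [h1]; push_cast; ring, ?_⟩
      rw [h2, ← mul_assoc, ← zpow_add₀ (by norm_num)]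
      simp
    · rintro a b c ⟨n, h1, h2⟩ ⟨m, h3, h4⟩
      refine ⟨n + m, by rw [h3, h1]; push_cast; ring, ?_⟩
      rw [h4, h2, zpow_add₀ (by norm_num)]
      ring

/-- The (closed) Möbius strip. -/
abbrev MobiusStrip : Type := Quotient mobiusSetoid

/-- A subset `C` of a surface (in use: a simple closed curve) is orientation-reversing if every
neighbourhood of it, however thin, contains a Möbius strip, that is, an embedded copy of one. -/
def IsOrientationReversing {S : Type*} [TopologicalSpace S] (C : Set S) : Prop :=
  ∀ U : Set S, IsOpen U → C ⊆ U → ∃ f : MobiusStrip → S, IsEmbedding f ∧ Set.range f ⊆ U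

end ImmersedSurface

/-! Suppose that `C` meets the singular set in an even number of points. The image `X` of `φ` is
compact and looks locally like a union of coordinate planes. Hence the complement of `X` near `X`
has a two-colouring in which the colours switch across every sheet (`exists_isColoring`). Locally
this is the product of the signs of the coordinates; any two local colourings differ by a constant
sign, and they are glued along convex faces of boxes, which plays the role of the vanishing of
H¹(ℝ³; ℤ/2).

Off the singular set, a point of `C` lies on one sheet, and a fixed colour marks one side of it.
Along `C` the marked side jumps exactly when another sheet is crossed, so once at each singular
point of `C`, by transversality and the absence of triple points. The jumps are compensated by the
sign of `sinProd`, a product of half-angle sines with one simple zero at each crossing. This product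
is well defined on the circle because the number of crossings is even. The result is a continuous
choice of sides along `C`, which extends over the crossings and then to a neighbourhood of `C`
(`IsCoorientation.exists_extension`).

Such a neighbourhood contains a Möbius strip, and no Möbius strip in ℝ³ has a continuous choice of
sides (`IsCoorientation.false_of_mobiusStrip`). Indeed, thickening the strip towards the chosen side
gives, at each point of the core line, an injective germ ℝ³ → ℝ³. The sign of its local degree is
constant along the line, but one turn around the strip composes the germ with a reflection. The case
of no crossings gives the first claim of the theorem, zero being even.

Since `φ` is only continuous, a degree for continuous maps is needed. It is defined by the integral
of a Jacobian of smooth approximations. Integration by parts gives homotopy invariance, and a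
smoothed left inverse shows that injective maps have nonzero degree (`HasDeg.ne_zero`). -/

namespace ImmersedSurface

open Topology MeasureTheory Set Filter Metric
open scoped ContDiff

/-! ### Determinants of three gradients and integration by parts -/

/-- The partial derivative of a function on `E3` in the `i`-th coordinate direction. -/
noncomputable def partialDeriv (i : Fin 3) (u : E3 → ℝ) (x : E3) : ℝ :=
  fderiv ℝ u x (EuclideanSpace.single i 1)

/-- The determinant of the three gradients `∇u`, `∇v`, `∇w`. -/
noncomputable def gradDet (u v w : E3 → ℝ) (x : E3) : ℝ :=
  partialDeriv 0 u x * (partialDeriv 1 v x * partialDeriv 2 w x - partialDeriv 2 v x * partialDeriv 1 w x)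
  - partialDeriv 1 u x * (partialDeriv 0 v x * partialDeriv 2 w x - partialDeriv 2 v x * partialDeriv 0 w x)
  + partialDeriv 2 u x * (partialDeriv 0 v x * partialDeriv 1 w x - partialDeriv 1 v x * partialDeriv 0 w x)

lemma contDiff_partialDeriv {u : E3 → ℝ} (hu : ContDiff ℝ ∞ u) (i : Fin 3) :
    ContDiff ℝ ∞ (partialDeriv i u) := by
  unfold partialDeriv
  exact (hu.fderiv_right (m := ∞) (by simp)).clm_apply contDiff_const

lemma contDiff_gradDet {u v w : E3 → ℝ} (hu : ContDiff ℝ ∞ u) (hv : ContDiff ℝ ∞ v)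
    (hw : ContDiff ℝ ∞ w) : ContDiff ℝ ∞ (gradDet u v w) := by
  have a := contDiff_partialDeriv hu
  have b := contDiff_partialDeriv hv
  have c := contDiff_partialDeriv hw
  unfold gradDet
  exact (((a 0).mul (((b 1).mul (c 2)).sub ((b 2).mul (c 1)))).sub
    ((a 1).mul (((b 0).mul (c 2)).sub ((b 2).mul (c 0))))).add
    ((a 2).mul (((b 0).mul (c 1)).sub ((b 1).mul (c 0))))

lemma partialDeriv_comm {u : E3 → ℝ} (hu : ContDiff ℝ ∞ u) (i j : Fin 3) (x : E3) :
    partialDeriv i (partialDeriv j u) x = partialDeriv j (partialDeriv i u) x := by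
  have hd : Differentiable ℝ (fderiv ℝ u) :=
    (hu.fderiv_right (m := ∞) (by simp)).differentiable (by simp)
  have key : ∀ a b : Fin 3, partialDeriv a (partialDeriv b u) x =
      fderiv ℝ (fderiv ℝ u) x (EuclideanSpace.single a 1) (EuclideanSpace.single b 1) := by
    intro a b
    unfold partialDeriv
    rw [fderiv_clm_apply (hd x) (differentiableAt_const _)]
    simp
  rw [key, key]
  exact (hu.contDiffAt.isSymmSndFDerivAt (by
    rw [minSmoothness_of_isRCLikeNormedField]; exact WithTop.coe_le_coe.2 (le_top (a := (2 : ℕ∞))))) _ _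

lemma partialDeriv_mul {u v : E3 → ℝ} (hu : ContDiff ℝ ∞ u) (hv : ContDiff ℝ ∞ v) (i : Fin 3)
    (x : E3) : partialDeriv i (fun y => u y * v y) x =
      partialDeriv i u x * v x + u x * partialDeriv i v x := by
  unfold partialDeriv
  rw [fderiv_fun_mul (hu.differentiable (by simp) x) (hv.differentiable (by simp) x)]
  simp; ring

lemma partialDeriv_sub {u v : E3 → ℝ} (hu : ContDiff ℝ ∞ u) (hv : ContDiff ℝ ∞ v) (i : Fin 3)
    (x : E3) : partialDeriv i (fun y => u y - v y) x = partialDeriv i u x - partialDeriv i v x := by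
  unfold partialDeriv
  rw [fderiv_fun_sub (hu.differentiable (by simp) x) (hv.differentiable (by simp) x)]
  simp

lemma hasCompactSupport_partialDeriv {u : E3 → ℝ} (hu : HasCompactSupport u) (i : Fin 3) :
    HasCompactSupport (partialDeriv i u) :=
  hu.fderiv_apply (𝕜 := ℝ) _

lemma integral_partialDeriv_mul {u v : E3 → ℝ} (hu : ContDiff ℝ ∞ u) (hv : ContDiff ℝ ∞ v)
    (hc : HasCompactSupport u) (i : Fin 3) :
    ∫ x, partialDeriv i u x * v x = - ∫ x, u x * partialDeriv i v x := by
  have h := integral_mul_fderiv_eq_neg_fderiv_mul_of_integrable (𝕜 := ℝ)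
    (μ := (volume : Measure E3)) (f := u) (g := v)
    (v := EuclideanSpace.single i 1) ?_ ?_ ?_ (fun x _ => hu.differentiable (by simp) x)
    (fun x _ => hv.differentiable (by simp) x)
  · unfold partialDeriv
    rw [h, neg_neg]
  · exact ((contDiff_partialDeriv hu i).continuous.mul hv.continuous).integrable_of_hasCompactSupport
      (hasCompactSupport_partialDeriv hc i).mul_right
  · exact (hu.continuous.mul (contDiff_partialDeriv hv i).continuous).integrable_of_hasCompactSupport
      hc.mul_right
  · exact (hu.continuous.mul hv.continuous).integrable_of_hasCompactSupport hc.mul_right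

/-- The integrand is the divergence of `u (∇v × ∇w)`: the field `∇v × ∇w` is divergence-free because
second derivatives commute. The `P i j` are its components up to sign. -/
lemma integral_gradDet_eq_zero {u v w : E3 → ℝ} (hu : ContDiff ℝ ∞ u) (hv : ContDiff ℝ ∞ v)
    (hw : ContDiff ℝ ∞ w) (hc : HasCompactSupport u) : ∫ x, gradDet u v w x = 0 := by
  have pv := contDiff_partialDeriv hv
  have pw := contDiff_partialDeriv hw
  let P : Fin 3 → Fin 3 → E3 → ℝ := fun i j x =>
    partialDeriv i v x * partialDeriv j w x - partialDeriv j v x * partialDeriv i w x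
  have hP : ∀ i j, ContDiff ℝ ∞ (P i j) := fun i j =>
    ((pv i).mul (pw j)).sub ((pv j).mul (pw i))
  have hint : ∀ k i j, Integrable (fun x => partialDeriv k u x * P i j x) := fun k i j =>
    ((contDiff_partialDeriv hu k).continuous.mul
      (hP i j).continuous).integrable_of_hasCompactSupport
      (hasCompactSupport_partialDeriv hc k).mul_right
  have hint' : ∀ k i j, Integrable (fun x => u x * partialDeriv k (P i j) x) := fun k i j =>
    (hu.continuous.mul (contDiff_partialDeriv (hP i j) k).continuous).integrable_of_hasCompactSupport
      hc.mul_right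
  have hdP : ∀ k i j x, partialDeriv k (P i j) x =
      (partialDeriv k (partialDeriv i v) x * partialDeriv j w x +
        partialDeriv i v x * partialDeriv k (partialDeriv j w) x) -
      (partialDeriv k (partialDeriv j v) x * partialDeriv i w x +
        partialDeriv j v x * partialDeriv k (partialDeriv i w) x) := by
    intro k i j x
    rw [← partialDeriv_mul (pv i) (pw j), ← partialDeriv_mul (pv j) (pw i),
      ← partialDeriv_sub ((pv i).mul (pw j)) ((pv j).mul (pw i))]
  have h1 : ∫ x, gradDet u v w x = ∫ x, ((partialDeriv 0 u x * P 1 2 x -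
      partialDeriv 1 u x * P 0 2 x) + partialDeriv 2 u x * P 0 1 x) := rfl
  have i1 : Integrable fun x => partialDeriv 0 u x * P 1 2 x - partialDeriv 1 u x * P 0 2 x :=
    (hint 0 1 2).sub (hint 1 0 2)
  have i2 : Integrable fun x => u x * partialDeriv 0 (P 1 2) x - u x * partialDeriv 1 (P 0 2) x :=
    (hint' 0 1 2).sub (hint' 1 0 2)
  rw [h1, integral_add i1 (hint 2 0 1),
    integral_sub (hint 0 1 2) (hint 1 0 2), integral_partialDeriv_mul hu (hP 1 2) hc,
    integral_partialDeriv_mul hu (hP 0 2) hc, integral_partialDeriv_mul hu (hP 0 1) hc]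
  have h2 : (∫ x, u x * partialDeriv 0 (P 1 2) x) - (∫ x, u x * partialDeriv 1 (P 0 2) x) +
      (∫ x, u x * partialDeriv 2 (P 0 1) x) = 0 := by
    rw [← integral_sub (hint' 0 1 2) (hint' 1 0 2),
      ← integral_add i2 (hint' 2 0 1)]
    rw [← integral_zero E3 ℝ]
    congr 1
    funext x
    simp only [hdP]
    rw [partialDeriv_comm hv 1 0, partialDeriv_comm hv 2 0, partialDeriv_comm hv 2 1,
      partialDeriv_comm hw 1 0, partialDeriv_comm hw 2 0, partialDeriv_comm hw 2 1]
    ring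
  linarith

lemma gradDet_rotate (u v w : E3 → ℝ) (x : E3) : gradDet u v w x = gradDet v w u x := by
  unfold gradDet; ring

/-- Integration by parts for `gradDet`. -/
lemma integral_mul_gradDet {χ u v w : E3 → ℝ} (hχ : ContDiff ℝ ∞ χ) (hu : ContDiff ℝ ∞ u)
    (hv : ContDiff ℝ ∞ v) (hw : ContDiff ℝ ∞ w) (hc : HasCompactSupport χ) :
    ∫ x, χ x * gradDet u v w x = - ∫ x, u x * gradDet χ v w x := by
  have h := integral_gradDet_eq_zero (hχ.mul hu) hv hw hc.mul_right
  have e : ∀ x, gradDet (fun y => χ y * u y) v w x = χ x * gradDet u v w x + u x * gradDet χ v w x := by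
    intro x
    simp only [gradDet, partialDeriv_mul hχ hu]
    ring
  simp_rw [e] at h
  rw [integral_add] at h
  · linarith
  · exact (hχ.continuous.mul (contDiff_gradDet hu hv hw).continuous).integrable_of_hasCompactSupport
      hc.mul_right
  · refine (hu.continuous.mul
      (contDiff_gradDet hχ hv hw).continuous).integrable_of_hasCompactSupport ?_
    refine HasCompactSupport.mul_left (HasCompactSupport.intro' hc isClosed_closure fun x hx => ?_)
    have : ∀ i, partialDeriv i χ x = 0 := fun i => by
      unfold partialDeriv
      rw [fderiv_of_notMem_tsupport ℝ hx]; rfl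
    simp [gradDet, this]

lemma gradDet_sub {u u' v w : E3 → ℝ} (hu : ContDiff ℝ ∞ u) (hu' : ContDiff ℝ ∞ u') (x : E3) :
    gradDet (fun y => u y - u' y) v w x = gradDet u v w x - gradDet u' v w x := by
  simp only [gradDet, partialDeriv_sub hu hu']; ring

/-- Integration by parts turns the difference of the two sides into the integral of `-(u - u')
det(∇χ, ∇v, ∇w)`, which vanishes pointwise under the hypothesis. -/
lemma integral_mul_gradDet_congr_left {χ u u' v w : E3 → ℝ} (hχ : ContDiff ℝ ∞ χ)
    (hu : ContDiff ℝ ∞ u) (hu' : ContDiff ℝ ∞ u') (hv : ContDiff ℝ ∞ v) (hw : ContDiff ℝ ∞ w)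
    (hc : HasCompactSupport χ)
    (h : ∀ x, fderiv ℝ χ x ≠ 0 → u x = u' x ∨ fderiv ℝ v x = 0 ∨ fderiv ℝ w x = 0) :
    ∫ x, χ x * gradDet u v w x = ∫ x, χ x * gradDet u' v w x := by
  have i : ∀ {u}, ContDiff ℝ ∞ u → Integrable (fun x => χ x * gradDet u v w x) := fun hu =>
    (hχ.continuous.mul (contDiff_gradDet hu hv hw).continuous).integrable_of_hasCompactSupport
      hc.mul_right
  rw [← sub_eq_zero, ← integral_sub (i hu) (i hu')]
  simp_rw [← mul_sub, ← gradDet_sub hu hu']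
  rw [integral_mul_gradDet hχ (hu.sub hu') hv hw hc, neg_eq_zero, ← integral_zero E3 ℝ]
  congr 1
  funext x
  by_cases hx : fderiv ℝ χ x = 0
  · simp [gradDet, partialDeriv, hx]
  · rcases h x hx with h | h | h <;> simp [gradDet, partialDeriv, h]

/-- The integral of `χ det DF` depends only on the behaviour of `F` where `χ` is not locally
constant. -/
lemma integral_mul_gradDet_congr {χ : E3 → ℝ} {F F' : Fin 3 → E3 → ℝ} (hχ : ContDiff ℝ ∞ χ)
    (hF : ∀ i, ContDiff ℝ ∞ (F i)) (hF' : ∀ i, ContDiff ℝ ∞ (F' i)) (hc : HasCompactSupport χ)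
    (h : ∀ x, fderiv ℝ χ x ≠ 0 →
      ∃ i, F i x = F' i x ∧ fderiv ℝ (F i) x = 0 ∧ fderiv ℝ (F' i) x = 0) :
    ∫ x, χ x * gradDet (F 0) (F 1) (F 2) x = ∫ x, χ x * gradDet (F' 0) (F' 1) (F' 2) x := by
  -- The components are replaced one at a time, each rotated into the first slot. Where `∇χ ≠ 0`,
  -- the good index `i` is either the one being replaced, where the values agree, or one of the
  -- other two, whose gradient vanishes before and after replacement.
  have s1 := integral_mul_gradDet_congr_left hχ (hF 0) (hF' 0) (hF 1) (hF 2) hc (by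
    intro x hx
    obtain ⟨i, h1, h2, h3⟩ := h x hx
    fin_cases i <;> simp_all)
  have s2 := integral_mul_gradDet_congr_left hχ (hF 1) (hF' 1) (hF 2) (hF' 0) hc (by
    intro x hx
    obtain ⟨i, h1, h2, h3⟩ := h x hx
    fin_cases i <;> simp_all)
  have s3 := integral_mul_gradDet_congr_left hχ (hF 2) (hF' 2) (hF' 0) (hF' 1) hc (by
    intro x hx
    obtain ⟨i, h1, h2, h3⟩ := h x hx
    fin_cases i <;> simp_all)
  simp_rw [gradDet_rotate (F' 0)] at s1 ⊢
  rw [s1, s2]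
  simp_rw [gradDet_rotate (F' 1)]
  rw [s3]

/-! ### The degree over the origin of a continuous map on a ball -/

/-- A smooth step function, equal to `0` on `(-∞, -ε]` and to `1` on `[ε, ∞)`. -/
noncomputable def stepFun (ε s : ℝ) : ℝ := Real.smoothTransition ((s + ε) / (2 * ε))

/-- A smooth radial cutoff function, equal to `1` on the ball of radius `r / 2` and to `0` outside
the ball of radius `r`. -/
noncomputable def cutoff (r : ℝ) (x : E3) : ℝ :=
  Real.smoothTransition ((r ^ 2 - ‖x‖ ^ 2) / (3 * r ^ 2 / 4))

lemma contDiff_stepFun (ε : ℝ) : ContDiff ℝ ∞ (stepFun ε) :=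
  Real.smoothTransition.contDiff.comp ((contDiff_id.add contDiff_const).div_const _)

lemma stepFun_of_le {ε s : ℝ} (hε : 0 < ε) (h : s ≤ -ε) : stepFun ε s = 0 :=
  Real.smoothTransition.zero_of_nonpos (div_nonpos_of_nonpos_of_nonneg (by linarith) (by linarith))

lemma stepFun_of_ge {ε s : ℝ} (hε : 0 < ε) (h : ε ≤ s) : stepFun ε s = 1 :=
  Real.smoothTransition.one_of_one_le ((one_le_div (by linarith)).2 (by linarith))

lemma contDiff_cutoff (r : ℝ) : ContDiff ℝ ∞ (cutoff r) :=
  Real.smoothTransition.contDiff.comp ((contDiff_const.sub (contDiff_norm_sq ℝ)).div_const _)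

lemma cutoff_of_le {r : ℝ} (hr : 0 < r) {x : E3} (h : ‖x‖ ≤ r / 2) : cutoff r x = 1 :=
  Real.smoothTransition.one_of_one_le ((one_le_div (by positivity)).2
    (by nlinarith [norm_nonneg x]))

lemma cutoff_of_ge {r : ℝ} (hr : 0 < r) {x : E3} (h : r ≤ ‖x‖) : cutoff r x = 0 :=
  Real.smoothTransition.zero_of_nonpos (div_nonpos_of_nonpos_of_nonneg
    (by nlinarith) (by positivity))

lemma cutoff_nonneg (r : ℝ) (x : E3) : 0 ≤ cutoff r x := Real.smoothTransition.nonneg _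

lemma hasCompactSupport_cutoff {r : ℝ} (hr : 0 < r) : HasCompactSupport (cutoff r) :=
  HasCompactSupport.intro (isCompact_closedBall (0 : E3) r) fun x hx =>
    cutoff_of_ge hr (by simpa using (not_le.1 (by simpa using hx)).le)

lemma norm_of_fderiv_cutoff_ne_zero {r : ℝ} (hr : 0 < r) {x : E3} (h : fderiv ℝ (cutoff r) x ≠ 0) :
    r / 2 ≤ ‖x‖ ∧ ‖x‖ ≤ r := by
  constructor
  · by_contra! hx
    refine h ?_
    have : cutoff r =ᶠ[𝓝 x] fun _ => (1 : ℝ) := by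
      filter_upwards [(continuous_norm.continuousAt (x := x)).eventually_lt_const hx] with y hy
      exact cutoff_of_le hr hy.le
    rw [this.fderiv_eq]; simp
  · by_contra! hx
    refine h ?_
    have : cutoff r =ᶠ[𝓝 x] fun _ => (0 : ℝ) := by
      filter_upwards [(continuous_norm.continuousAt (x := x)).eventually_const_lt hx] with y hy
      exact cutoff_of_ge hr hy.le
    rw [this.fderiv_eq]; simp

lemma norm_le_two_mul {y : E3} {c : ℝ} (hc : 0 ≤ c) (h : ∀ i, |y i| ≤ c) : ‖y‖ ≤ 2 * c := by
  rw [EuclideanSpace.norm_eq, Real.sqrt_le_left (by linarith), Fin.sum_univ_three]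
  have := fun i => sq_le_sq' (abs_le.1 (h i)).1 (abs_le.1 (h i)).2
  simp only [Real.norm_eq_abs, sq_abs]
  nlinarith [this 0, this 1, this 2]

lemma exists_norm_le_two_mul_abs (y : E3) : ∃ i, ‖y‖ ≤ 2 * |y i| := by
  by_contra! h
  obtain ⟨i, hi⟩ := Finite.exists_max fun i => |y i|
  exact absurd (norm_le_two_mul (abs_nonneg _) hi) (not_le.2 (h i))

lemma abs_coord_le_norm (y : E3) (i : Fin 3) : |y i| ≤ ‖y‖ := by
  simpa using PiLp.norm_apply_le y i

/-- The coordinate functions of `g`, composed with the step function. -/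
noncomputable def stepComp (ε : ℝ) (g : E3 → E3) (i : Fin 3) (x : E3) : ℝ := stepFun ε (g x i)

lemma contDiff_coord {g : E3 → E3} (hg : ContDiff ℝ ∞ g) (i : Fin 3) :
    ContDiff ℝ ∞ fun x => g x i := contDiff_euclidean.1 hg i

lemma contDiff_stepComp {g : E3 → E3} (hg : ContDiff ℝ ∞ g) (ε : ℝ) (i : Fin 3) :
    ContDiff ℝ ∞ (stepComp ε g i) := (contDiff_stepFun ε).comp (contDiff_coord hg i)

lemma fderiv_stepComp_eq_zero {g : E3 → E3} (hg : Continuous g) {ε : ℝ} (hε : 0 < ε) {i : Fin 3}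
    {x : E3} (h : ε < |g x i|) : fderiv ℝ (stepComp ε g i) x = 0 := by
  have hc : Continuous fun x => g x i := by fun_prop
  rcases lt_abs.1 h with h | h
  · have : stepComp ε g i =ᶠ[𝓝 x] fun _ => (1 : ℝ) := by
      filter_upwards [hc.continuousAt.eventually_const_lt h] with y hy
      exact stepFun_of_ge hε hy.le
    rw [this.fderiv_eq]; simp
  · have : stepComp ε g i =ᶠ[𝓝 x] fun _ => (0 : ℝ) := by
      filter_upwards [hc.continuousAt.eventually_lt_const (lt_neg.1 h)] with y hy
      exact stepFun_of_le hε hy.le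
    rw [this.fderiv_eq]; simp

/-- The number of times (up to smoothing) that a smooth map `g` covers the origin with the ball of
radius `r`, counted with signs. -/
noncomputable def degInt (g : E3 → E3) (r ε : ℝ) : ℝ :=
  ∫ x, cutoff r x * gradDet (stepComp ε g 0) (stepComp ε g 1) (stepComp ε g 2) x

/-- The gradient of the cutoff lives on the shell `r / 2 ≤ ‖x‖ ≤ r`. A coordinate in which both maps
lie beyond the step, on the same side, gives equal and locally constant step functions there. This
is the only source of homotopy invariance below. -/
lemma degInt_congr {g g' : E3 → E3} (hg : ContDiff ℝ ∞ g) (hg' : ContDiff ℝ ∞ g') {r ε ε' : ℝ}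
    (hr : 0 < r) (hε : 0 < ε) (hε' : 0 < ε')
    (h : ∀ x, r / 2 ≤ ‖x‖ → ‖x‖ ≤ r →
      ∃ i, (ε < g x i ∧ ε' < g' x i) ∨ (g x i < -ε ∧ g' x i < -ε')) :
    degInt g r ε = degInt g' r ε' := by
  refine integral_mul_gradDet_congr (contDiff_cutoff r) (contDiff_stepComp hg ε)
    (contDiff_stepComp hg' ε') (hasCompactSupport_cutoff hr) fun x hx => ?_
  obtain ⟨h1, h2⟩ := norm_of_fderiv_cutoff_ne_zero hr hx
  obtain ⟨i, ⟨a, b⟩ | ⟨a, b⟩⟩ := h x h1 h2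
  · exact ⟨i, by rw [stepComp, stepComp, stepFun_of_ge hε a.le, stepFun_of_ge hε' b.le],
      fderiv_stepComp_eq_zero hg.continuous hε (a.trans_le (le_abs_self _)),
      fderiv_stepComp_eq_zero hg'.continuous hε' (b.trans_le (le_abs_self _))⟩
  · exact ⟨i, by rw [stepComp, stepComp, stepFun_of_le hε a.le, stepFun_of_le hε' b.le],
      fderiv_stepComp_eq_zero hg.continuous hε (lt_abs.2 (Or.inr (by linarith))),
      fderiv_stepComp_eq_zero hg'.continuous hε' (lt_abs.2 (Or.inr (by linarith)))⟩

/-- `f` has degree `d` over the origin on the ball of radius `r`. -/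
def HasDeg (f : E3 → E3) (r d : ℝ) : Prop :=
  ∃ ε₀ > 0, ∀ g, ContDiff ℝ ∞ g → (∀ x, ‖x‖ ≤ r → ‖g x - f x‖ < ε₀) →
    ∀ ε, 0 < ε → ε < ε₀ → degInt g r ε = d

lemma exists_pos_forall_le_norm {f : E3 → E3} {r : ℝ} (hf : ContinuousOn f (closedBall 0 r))
    (h0 : ∀ x, r / 2 ≤ ‖x‖ → ‖x‖ ≤ r → f x ≠ 0) :
    ∃ m > 0, ∀ x, r / 2 ≤ ‖x‖ → ‖x‖ ≤ r → m ≤ ‖f x‖ := by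
  have hK : IsCompact (closedBall (0 : E3) r ∩ {x | r / 2 ≤ ‖x‖}) :=
    (isCompact_closedBall _ _).inter_right (isClosed_le continuous_const continuous_norm)
  obtain ⟨m, hm, h⟩ := hK.exists_forall_le' (f := fun x => ‖f x‖) (a := 0)
    (hf.norm.mono inter_subset_left) fun x hx =>
      norm_pos_iff.2 (h0 x hx.2 (by simpa using hx.1))
  exact ⟨m, hm, fun x h1 h2 => h x ⟨by simpa using h2, h1⟩⟩

lemma exists_hasDeg {f : E3 → E3} {r : ℝ} (hr : 0 < r) (hf : ContinuousOn f (closedBall 0 r))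
    (h0 : ∀ x, r / 2 ≤ ‖x‖ → ‖x‖ ≤ r → f x ≠ 0) : ∃ d, HasDeg f r d := by
  obtain ⟨m, hm, hmf⟩ := exists_pos_forall_le_norm hf h0
  have key : ∀ g g' : E3 → E3, ContDiff ℝ ∞ g → ContDiff ℝ ∞ g' →
      (∀ x, ‖x‖ ≤ r → ‖g x - f x‖ < m / 8) → (∀ x, ‖x‖ ≤ r → ‖g' x - f x‖ < m / 8) →
      ∀ ε ε', 0 < ε → ε < m / 8 → 0 < ε' → ε' < m / 8 → degInt g r ε = degInt g' r ε' := by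
    intro g g' hg hg' hgf hgf' ε ε' hε hε1 hε' hε1'
    refine degInt_congr hg hg' hr hε hε' fun x h1 h2 => ?_
    -- Some coordinate of `f x` has absolute value at least `m / 2`. Perturbing by less than `m / 8`
    -- keeps its sign and leaves more than `m / 8`, for `g` and `g'` alike.
    obtain ⟨i, hi⟩ := exists_norm_le_two_mul_abs (f x)
    have a := hmf x h1 h2
    have b := abs_le.1 ((abs_coord_le_norm _ i).trans (hgf x h2).le)
    have b' := abs_le.1 ((abs_coord_le_norm _ i).trans (hgf' x h2).le)
    simp only [PiLp.sub_apply] at b b'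
    refine ⟨i, ?_⟩
    rcases le_total 0 (f x i) with h | h
    · rw [abs_of_nonneg h] at hi
      left; constructor <;> linarith
    · rw [abs_of_nonpos h] at hi
      right; constructor <;> linarith
  by_cases h : ∃ g, ContDiff ℝ ∞ g ∧ ∀ x, ‖x‖ ≤ r → ‖g x - f x‖ < m / 8
  · obtain ⟨g, hg, hgf⟩ := h
    exact ⟨degInt g r (m / 16), m / 8, by positivity, fun g' hg' hgf' ε hε hε' =>
      key _ _ hg' hg hgf' hgf _ _ hε hε' (by positivity) (by linarith)⟩
  -- Without a smooth map close to `f` the condition is vacuous, and any value serves.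
  · exact ⟨0, m / 8, by positivity, fun g' hg' hgf' => absurd ⟨g', hg', hgf'⟩ h⟩

instance : TietzeExtension E3 := TietzeExtension.of_tvs ℝ

lemma exists_smooth_approx {f : E3 → E3} {r : ℝ} (hf : ContinuousOn f (closedBall 0 r)) {δ : ℝ}
    (hδ : 0 < δ) : ∃ g, ContDiff ℝ ∞ g ∧ ∀ x, ‖x‖ ≤ r → ‖g x - f x‖ < δ := by
  obtain ⟨F, hF⟩ := ContinuousMap.exists_restrict_eq (isClosed_closedBall (x := (0 : E3)) (ε := r))
    ⟨(closedBall 0 r).domRestrict f, hf.domRestrict⟩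
  obtain ⟨g, hg, hgF, -⟩ := F.continuous.exists_contDiff_approx ⊤ (ε := fun _ => δ)
    continuous_const fun _ => hδ
  refine ⟨g, hg, fun x hx => ?_⟩
  have hx' : x ∈ closedBall (0 : E3) r := by simpa using hx
  have : F x = f x := congrArg (fun q => q ⟨x, hx'⟩) hF
  rw [← this, ← dist_eq_norm]
  exact hgF x

/-- Continuity of `f` supplies a smooth approximation, so that the condition in `HasDeg` is not
vacuous. -/
lemma HasDeg.unique {f : E3 → E3} {r d d' : ℝ} (h : HasDeg f r d) (h' : HasDeg f r d')
    (hf : ContinuousOn f (closedBall 0 r)) : d = d' := by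
  obtain ⟨ε, hε, h⟩ := h
  obtain ⟨ε', hε', h'⟩ := h'
  obtain ⟨g, hg, hgf⟩ := exists_smooth_approx hf (lt_min hε hε')
  have hm := lt_min hε hε'
  rw [← h g hg (fun x hx => (hgf x hx).trans_le (min_le_left _ _)) (min ε ε' / 2) (by linarith)
    (by linarith [min_le_left ε ε']), ← h' g hg
    (fun x hx => (hgf x hx).trans_le (min_le_right _ _)) (min ε ε' / 2) (by linarith)
    (by linarith [min_le_right ε ε'])]

lemma HasDeg.exists_forall_near {f : E3 → E3} {r d : ℝ} (h : HasDeg f r d) :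
    ∃ δ > 0, ∀ f' : E3 → E3, (∀ x, ‖x‖ ≤ r → ‖f' x - f x‖ ≤ δ) → HasDeg f' r d := by
  obtain ⟨ε, hε, h⟩ := h
  refine ⟨ε / 2, by positivity, fun f' hf' => ⟨ε / 2, by positivity, fun g hg hgf t ht htε =>
    h g hg (fun x hx => ?_) t ht (by linarith)⟩⟩
  have := norm_add_le (g x - f' x) (f' x - f x)
  rw [sub_add_sub_cancel] at this
  linarith [hf' x hx, hgf x hx]

lemma HasDeg.congr {f f' : E3 → E3} {r d : ℝ} (h : HasDeg f r d)
    (hf : ∀ x, ‖x‖ ≤ r → f x = f' x) : HasDeg f' r d := by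
  obtain ⟨δ, hδ, h⟩ := h.exists_forall_near
  exact h f' fun x hx => by simp [hf x hx, hδ.le]

lemma gradDet_stepComp_eq_zero {g : E3 → E3} (hg : Continuous g) {ε : ℝ} (hε : 0 < ε) {i : Fin 3}
    {x : E3} (h : ε < |g x i|) :
    gradDet (stepComp ε g 0) (stepComp ε g 1) (stepComp ε g 2) x = 0 := by
  have := fderiv_stepComp_eq_zero hg hε h
  fin_cases i <;> simp_all [gradDet, partialDeriv]

/-- One approximation `g` serves both radii, and the two integrands agree pointwise: both cutoffs
are `1` on the ball of radius `r' / 2` and `0` beyond `r`, while in between `g` stays away from zero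
and the determinant vanishes. -/
lemma HasDeg.of_radius_le {f : E3 → E3} {r r' d : ℝ} (h : HasDeg f r d) (hr : 0 < r')
    (hrr : r' ≤ r) (hf : ContinuousOn f (closedBall 0 r)) (h0 : ∀ x, ‖x‖ ≤ r → f x = 0 → x = 0) :
    HasDeg f r' d := by
  obtain ⟨d', h'⟩ := exists_hasDeg hr (hf.mono (closedBall_subset_closedBall hrr))
    fun x h1 h2 h3 => by
      have := h0 x (h2.trans hrr) h3
      rw [this, norm_zero] at h1; linarith
  suffices d = d' by rwa [this]
  have hK : IsCompact (closedBall (0 : E3) r ∩ {x | r' / 2 ≤ ‖x‖}) :=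
    (isCompact_closedBall _ _).inter_right (isClosed_le continuous_const continuous_norm)
  obtain ⟨m, hm, hmf⟩ := hK.exists_forall_le' (f := fun x => ‖f x‖) (a := 0)
    (hf.norm.mono inter_subset_left) fun x hx => norm_pos_iff.2 fun h3 => by
      have h1 := hx.2
      rw [mem_ofPred_eq, h0 x (by simpa using hx.1) h3, norm_zero] at h1; linarith
  obtain ⟨ε, hε, h⟩ := h
  obtain ⟨ε', hε', h'⟩ := h'
  have hpos : 0 < min (min ε ε') (m / 8) := by positivity
  set t := min (min ε ε') (m / 8) with ht
  have t1 : t ≤ ε := (min_le_left _ _).trans (min_le_left _ _)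
  have t2 : t ≤ ε' := (min_le_left _ _).trans (min_le_right _ _)
  have t3 : t ≤ m / 8 := min_le_right _ _
  obtain ⟨g, hg, hgf⟩ := exists_smooth_approx hf hpos
  rw [← h g hg (fun x hx => (hgf x hx).trans_le t1) (t / 2) (by linarith) (by linarith),
    ← h' g hg (fun x hx => (hgf x (hx.trans hrr)).trans_le t2) (t / 2) (by linarith) (by linarith)]
  unfold degInt
  congr 1
  funext x
  rcases le_total ‖x‖ (r' / 2) with h1 | h1
  · rw [cutoff_of_le (hr.trans_le hrr) (by linarith), cutoff_of_le hr h1]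
  rcases le_total r ‖x‖ with h2 | h2
  · rw [cutoff_of_ge (hr.trans_le hrr) h2, cutoff_of_ge hr (hrr.trans h2)]
  · obtain ⟨i, hi⟩ := exists_norm_le_two_mul_abs (f x)
    have a := hmf x ⟨by simpa using h2, h1⟩
    have b := abs_le.1 ((abs_coord_le_norm _ i).trans (hgf x h2).le)
    simp only [PiLp.sub_apply] at b
    rw [gradDet_stepComp_eq_zero hg.continuous (by linarith) (i := i), mul_zero, mul_zero]
    rcases le_total 0 (f x i) with h | h
    · rw [abs_of_nonneg h] at hi
      exact lt_abs.2 (Or.inl (by linarith))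
    · rw [abs_of_nonpos h] at hi
      exact lt_abs.2 (Or.inr (by linarith))

/-! ### Change of variables, and nonzero degree of injective maps -/

lemma euclidean_eq_sum (v : E3) :
    v = v 0 • EuclideanSpace.single 0 1 + v 1 • EuclideanSpace.single 1 1 +
      v 2 • EuclideanSpace.single 2 1 := by
  ext i; fin_cases i <;> simp

lemma fderiv_apply_eq_sum (u : E3 → ℝ) (x v : E3) :
    fderiv ℝ u x v = v 0 * partialDeriv 0 u x + v 1 * partialDeriv 1 u x +
      v 2 * partialDeriv 2 u x := by
  conv_lhs => rw [euclidean_eq_sum v]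
  simp only [map_add, map_smul, partialDeriv, smul_eq_mul]

lemma partialDeriv_coord {g : E3 → E3} (hg : ContDiff ℝ ∞ g) (i k : Fin 3) (x : E3) :
    partialDeriv k (fun y => g y i) x = fderiv ℝ g x (EuclideanSpace.single k 1) i := by
  have h := (hg.differentiable (by simp) x).hasFDerivAt
  have h2 := (EuclideanSpace.proj i : E3 →L[ℝ] ℝ).hasFDerivAt (x := g x) |>.comp x h
  unfold partialDeriv
  have : (fun y => g y i) = (EuclideanSpace.proj i : E3 →L[ℝ] ℝ) ∘ g := rfl
  rw [this, h2.fderiv]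
  rfl

lemma partialDeriv_comp {g : E3 → E3} {a : E3 → ℝ} (ha : ContDiff ℝ ∞ a) (hg : ContDiff ℝ ∞ g)
    (k : Fin 3) (x : E3) : partialDeriv k (fun y => a (g y)) x =
      partialDeriv k (fun y => g y 0) x * partialDeriv 0 a (g x) +
      partialDeriv k (fun y => g y 1) x * partialDeriv 1 a (g x) +
      partialDeriv k (fun y => g y 2) x * partialDeriv 2 a (g x) := by
  simp only [partialDeriv_coord hg]
  rw [← fderiv_apply_eq_sum]
  unfold partialDeriv
  have : (fun y => a (g y)) = a ∘ g := rfl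
  rw [this, fderiv_comp x (ha.differentiable (by simp) _) (hg.differentiable (by simp) _)]
  rfl

/-- The Jacobian determinant. -/
noncomputable def jacobian (g : E3 → E3) : E3 → ℝ :=
  gradDet (fun y => g y 0) (fun y => g y 1) (fun y => g y 2)

lemma contDiff_jacobian {g : E3 → E3} (hg : ContDiff ℝ ∞ g) : ContDiff ℝ ∞ (jacobian g) :=
  contDiff_gradDet (contDiff_coord hg 0) (contDiff_coord hg 1) (contDiff_coord hg 2)

lemma gradDet_comp {g : E3 → E3} {a b c : E3 → ℝ} (ha : ContDiff ℝ ∞ a) (hb : ContDiff ℝ ∞ b)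
    (hc : ContDiff ℝ ∞ c) (hg : ContDiff ℝ ∞ g) (x : E3) :
    gradDet (fun y => a (g y)) (fun y => b (g y)) (fun y => c (g y)) x =
      gradDet a b c (g x) * jacobian g x := by
  simp only [gradDet, jacobian, partialDeriv_comp ha hg, partialDeriv_comp hb hg,
    partialDeriv_comp hc hg]
  ring

lemma partialDeriv_coord_id (i k : Fin 3) (x : E3) :
    partialDeriv k (fun y : E3 => y i) x = if i = k then 1 else 0 := by
  rw [partialDeriv_coord (g := fun y => y) contDiff_id]
  simp

lemma gradDet_coord_zero (a : E3 → ℝ) (x : E3) :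
    gradDet a (fun y => y 1) (fun y => y 2) x = partialDeriv 0 a x := by
  simp [gradDet, partialDeriv_coord_id]

lemma gradDet_coord_one (a : E3 → ℝ) (x : E3) :
    gradDet a (fun y => y 2) (fun y => y 0) x = partialDeriv 1 a x := by
  simp [gradDet, partialDeriv_coord_id]

lemma gradDet_coord_two (a : E3 → ℝ) (x : E3) :
    gradDet a (fun y => y 0) (fun y => y 1) x = partialDeriv 2 a x := by
  simp [gradDet, partialDeriv_coord_id]

/-- The pairing of a function with the pushforward of `χ det Dg`. -/
noncomputable def pushInt (χ : E3 → ℝ) (g : E3 → E3) (η : E3 → ℝ) : ℝ :=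
  ∫ x, χ x * (η (g x) * jacobian g x)

/-- By the chain rule, `∂ᵢη(g x)` times the Jacobian is the determinant of the gradients of `η ∘ g`
and the two other components of `g`. Integrating by parts puts the derivative on `χ`, where `η ∘ g`
vanishes. So the pushforward of `χ det Dg` has zero derivative away from the image of the shell. -/
lemma pushInt_partialDeriv {χ : E3 → ℝ} {g : E3 → E3} {η : E3 → ℝ} (hχ : ContDiff ℝ ∞ χ)
    (hc : HasCompactSupport χ) (hg : ContDiff ℝ ∞ g) (hη : ContDiff ℝ ∞ η)
    (h : ∀ x, fderiv ℝ χ x ≠ 0 → η (g x) = 0) (i : Fin 3) :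
    pushInt χ g (partialDeriv i η) = 0 := by
  have c : ∀ j : Fin 3, ContDiff ℝ ∞ fun y : E3 => y j := contDiff_coord contDiff_id
  have cg := contDiff_coord hg
  have hηg : ContDiff ℝ ∞ fun y => η (g y) := hη.comp hg
  have gen : ∀ j k : Fin 3, (∀ x, gradDet (fun y => η (g y)) (fun y => g y j) (fun y => g y k) x =
      partialDeriv i η (g x) * jacobian g x) → pushInt χ g (partialDeriv i η) = 0 := by
    intro j k hjk
    unfold pushInt
    simp_rw [← hjk]
    rw [integral_mul_gradDet hχ hηg (cg j) (cg k) hc, neg_eq_zero, ← integral_zero E3 ℝ]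
    congr 1
    funext x
    by_cases hx : fderiv ℝ χ x = 0
    · simp [gradDet, partialDeriv, hx]
    · simp [h x hx]
  obtain rfl | rfl | rfl : i = 0 ∨ i = 1 ∨ i = 2 := by fin_cases i <;> simp
  · exact gen 1 2 fun x => by rw [gradDet_comp hη (c 1) (c 2) hg, gradDet_coord_zero]
  · exact gen 2 0 fun x => by rw [gradDet_comp hη (c 2) (c 0) hg, gradDet_coord_one]
  · exact gen 0 1 fun x => by rw [gradDet_comp hη (c 0) (c 1) hg, gradDet_coord_two]

lemma hasDerivAt_comp_sub_smul {η : E3 → ℝ} (hη : ContDiff ℝ ∞ η) (z v : E3) (t : ℝ) :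
    HasDerivAt (fun t : ℝ => η (z - t • v)) (-(fderiv ℝ η (z - t • v) v)) t := by
  have h1 : HasDerivAt (fun t : ℝ => z - t • v) (-v) t := by
    simpa using ((hasDerivAt_id t).smul_const v).const_sub z
  have h2 := (hη.differentiable (by simp) (z - t • v)).hasFDerivAt.comp_hasDerivAt t h1
  rwa [map_neg] at h2

/-- The derivative in `t` of the pairing with `η (· - t • v)` is minus the pairing with a
directional derivative, hence zero by `pushInt_partialDeriv`. -/
lemma pushInt_translate {χ : E3 → ℝ} {g : E3 → E3} {η : E3 → ℝ} (hχ : ContDiff ℝ ∞ χ)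
    (hc : HasCompactSupport χ) (hg : ContDiff ℝ ∞ g) (hη : ContDiff ℝ ∞ η)
    (hηc : HasCompactSupport η) (v : E3)
    (h : ∀ x, fderiv ℝ χ x ≠ 0 → ∀ t ∈ Icc (0 : ℝ) 1, η (g x - t • v) = 0) :
    pushInt χ g (fun z => η (z - v)) = pushInt χ g η := by
  have hsub : ∀ t : ℝ, ContDiff ℝ ∞ fun z => η (z - t • v) := fun t =>
    hη.comp (contDiff_id.sub contDiff_const)
  have hcont' : ∀ t : ℝ, Continuous fun z => fderiv ℝ η (z - t • v) v := fun t =>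
    ((hη.continuous_fderiv (by simp)).comp (continuous_id.sub continuous_const)).clm_apply
      continuous_const
  obtain ⟨B, hB⟩ := (hηc.fderiv (𝕜 := ℝ)).exists_bound_of_continuous
    (hη.continuous_fderiv (by simp))
  have hJ : Continuous fun x => χ x * jacobian g x :=
    hχ.continuous.mul (contDiff_jacobian hg).continuous
  have hderiv : ∀ t : ℝ, HasDerivAt (fun t : ℝ => pushInt χ g fun z => η (z - t • v))
      (∫ x, χ x * (-(fderiv ℝ η (g x - t • v) v) * jacobian g x)) t := by
    intro t
    refine (hasDerivAt_integral_of_dominated_loc_of_deriv_le (μ := (volume : Measure E3))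
      (F := fun t x => χ x * (η (g x - t • v) * jacobian g x))
      (F' := fun t x => χ x * (-(fderiv ℝ η (g x - t • v) v) * jacobian g x))
      (bound := fun x => ‖χ x * jacobian g x‖ * (B * ‖v‖)) (s := univ) univ_mem ?_ ?_ ?_ ?_ ?_ ?_).2
    · exact Eventually.of_forall fun s => (hχ.continuous.mul (((hsub s).continuous.comp
        hg.continuous).mul (contDiff_jacobian hg).continuous)).aestronglyMeasurable
    · exact (hχ.continuous.mul (((hsub t).continuous.comp
        hg.continuous).mul (contDiff_jacobian hg).continuous)).integrable_of_hasCompactSupport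
        hc.mul_right
    · exact (hχ.continuous.mul ((((hcont' t).comp
        hg.continuous).neg).mul (contDiff_jacobian hg).continuous)).aestronglyMeasurable
    · refine Eventually.of_forall fun x s _ => ?_
      have : ‖fderiv ℝ η (g x - s • v) v‖ ≤ B * ‖v‖ :=
        (ContinuousLinearMap.le_opNorm _ _).trans
          (mul_le_mul_of_nonneg_right (hB _) (norm_nonneg _))
      calc ‖χ x * (-(fderiv ℝ η (g x - s • v) v) * jacobian g x)‖
          = ‖χ x * jacobian g x‖ * ‖fderiv ℝ η (g x - s • v) v‖ := by
            simp only [norm_mul, norm_neg]; ring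
        _ ≤ _ := mul_le_mul_of_nonneg_left this (norm_nonneg _)
    · exact (hJ.norm.mul continuous_const).integrable_of_hasCompactSupport
        hc.mul_right.norm.mul_right
    · refine Eventually.of_forall fun x s _ => ?_
      exact ((hasDerivAt_comp_sub_smul hη (g x) v s).mul_const _).const_mul _
  have hzero : ∀ t ∈ Icc (0 : ℝ) 1,
      ∫ x, χ x * (-(fderiv ℝ η (g x - t • v) v) * jacobian g x) = 0 := by
    intro t ht
    have hp := pushInt_partialDeriv hχ hc hg (hsub t) fun x hx => h x hx t ht
    have hpd : ∀ i z, partialDeriv i (fun z => η (z - t • v)) z = partialDeriv i η (z - t • v) := by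
      intro i z
      unfold partialDeriv
      rw [fderiv_comp_sub (f := η)]
    have hint : ∀ i, Integrable fun x => χ x * (partialDeriv i (fun z => η (z - t • v)) (g x) *
        jacobian g x) := fun i =>
      (hχ.continuous.mul (((contDiff_partialDeriv (hsub t) i).continuous.comp
        hg.continuous).mul (contDiff_jacobian hg).continuous)).integrable_of_hasCompactSupport
        hc.mul_right
    have e : ∀ x, χ x * (-(fderiv ℝ η (g x - t • v) v) * jacobian g x) =
        ((-v 0) * (χ x * (partialDeriv 0 (fun z => η (z - t • v)) (g x) * jacobian g x)) +
        (-v 1) * (χ x * (partialDeriv 1 (fun z => η (z - t • v)) (g x) * jacobian g x))) +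
        (-v 2) * (χ x * (partialDeriv 2 (fun z => η (z - t • v)) (g x) * jacobian g x)) := by
      intro x
      rw [fderiv_apply_eq_sum, hpd, hpd, hpd]; ring
    simp_rw [e]
    have i01 : Integrable fun x =>
        (-v 0) * (χ x * (partialDeriv 0 (fun z => η (z - t • v)) (g x) * jacobian g x)) +
        (-v 1) * (χ x * (partialDeriv 1 (fun z => η (z - t • v)) (g x) * jacobian g x)) :=
      ((hint 0).const_mul (-v 0)).add ((hint 1).const_mul (-v 1))
    unfold pushInt at hp
    rw [integral_add i01 ((hint 2).const_mul _),
      integral_add ((hint 0).const_mul _) ((hint 1).const_mul _), integral_const_mul,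
      integral_const_mul, integral_const_mul, hp, hp, hp]
    ring
  have hconst := constant_of_has_deriv_right_zero
    (f := fun t : ℝ => pushInt χ g fun z => η (z - t • v)) (a := 0) (b := 1)
    (fun t _ => (hderiv t).continuousAt.continuousWithinAt) (fun t ht => by
      have := (hderiv t).hasDerivWithinAt (s := Ici t)
      rwa [hzero t ⟨ht.1, ht.2.le⟩] at this) 1 (right_mem_Icc.2 zero_le_one)
  simpa using hconst

/-- Translation invariance, averaged over `v` with weight `ζ`, followed by Fubini. -/
lemma pushInt_mul_integral {χ : E3 → ℝ} {g : E3 → E3} {η ζ : E3 → ℝ} (hχ : ContDiff ℝ ∞ χ)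
    (hc : HasCompactSupport χ) (hg : ContDiff ℝ ∞ g) (hη : ContDiff ℝ ∞ η)
    (hηc : HasCompactSupport η) (hζ : Continuous ζ) (hζc : HasCompactSupport ζ)
    (h : ∀ x, fderiv ℝ χ x ≠ 0 → ∀ v, ζ v ≠ 0 → ∀ t ∈ Icc (0 : ℝ) 1, η (g x - t • v) = 0) :
    pushInt χ g η * ∫ v, ζ v =
      ∫ x, χ x * jacobian g x * ∫ v, ζ v * η (g x - v) := by
  have h1 : ∀ v, ζ v * pushInt χ g (fun z => η (z - v)) = pushInt χ g η * ζ v := by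
    intro v
    by_cases hv : ζ v = 0
    · simp [hv]
    · rw [pushInt_translate hχ hc hg hη hηc v fun x hx t ht => h x hx v hv t ht]; ring
  rw [← integral_const_mul]
  simp_rw [← h1]
  unfold pushInt
  simp_rw [← integral_const_mul]
  rw [integral_integral_swap]
  · congr 1
    funext x
    congr 1
    funext v
    ring
  · refine Continuous.integrable_of_hasCompactSupport ?_ ?_
    · have := (contDiff_jacobian hg).continuous
      have h2 := hχ.continuous
      have h3 := hη.continuous
      have h4 := hg.continuous
      unfold Function.uncurry
      fun_prop
    · refine HasCompactSupport.intro (hζc.isCompact.prod hc.isCompact) fun p hp => ?_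
      simp only [mem_prod, not_and_or] at hp
      rcases hp with hp | hp
      · simp [Function.uncurry, image_eq_zero_of_notMem_tsupport hp]
      · simp [Function.uncurry, image_eq_zero_of_notMem_tsupport hp]

/-- Both products equal the pairing with the convolution of `η` and `ζ`, which is symmetric. Thus
`pushInt χ g η` is proportional to the integral of `η`, the factor being the degree. The bound on
the shell keeps all the translates involved away from the image of the shell. -/
lemma pushInt_mul_integral_comm {χ : E3 → ℝ} {g : E3 → E3} {η ζ : E3 → ℝ} (hχ : ContDiff ℝ ∞ χ)
    (hc : HasCompactSupport χ) (hg : ContDiff ℝ ∞ g) (hη : ContDiff ℝ ∞ η)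
    (hηc : HasCompactSupport η) (hζ : ContDiff ℝ ∞ ζ) (hζc : HasCompactSupport ζ) {a b : ℝ}
    (ha : ∀ y, η y ≠ 0 → ‖y‖ ≤ a) (hb : ∀ y, ζ y ≠ 0 → ‖y‖ ≤ b)
    (h : ∀ x, fderiv ℝ χ x ≠ 0 → a + b < ‖g x‖) :
    pushInt χ g η * ∫ v, ζ v = pushInt χ g ζ * ∫ v, η v := by
  have far : ∀ {x v : E3} {c d t : ℝ}, c + d < ‖g x‖ → ‖v‖ ≤ d → t ∈ Icc (0 : ℝ) 1 →
      c < ‖g x - t • v‖ := by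
    intro x v c d t h1 h2 ht
    have h3 := norm_sub_norm_le (g x) (t • v)
    have h4 : ‖t • v‖ ≤ ‖v‖ := by
      rw [norm_smul, Real.norm_of_nonneg ht.1]
      exact mul_le_of_le_one_left (norm_nonneg _) ht.2
    linarith
  rw [pushInt_mul_integral hχ hc hg hη hηc hζ.continuous hζc, pushInt_mul_integral hχ hc hg hζ hζc
    hη.continuous hηc]
  · congr 1
    funext x
    congr 1
    rw [← integral_sub_left_eq_self (fun v => ζ v * η (g x - v)) volume (g x)]
    congr 1
    funext v
    rw [sub_sub_cancel, mul_comm]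
  · intro x hx v hv t ht
    by_contra hne
    exact absurd (hb _ hne) (not_le.2 (far (by linarith [h x hx]) (ha v hv) ht))
  · intro x hx v hv t ht
    by_contra hne
    exact absurd (ha _ hne) (not_le.2 (far (h x hx) (hb v hv) ht))

/-- The function whose pairing with `pushInt` is the degree. -/
noncomputable def bump (ε : ℝ) (y : E3) : ℝ :=
  deriv (stepFun ε) (y 0) * deriv (stepFun ε) (y 1) * deriv (stepFun ε) (y 2)

lemma contDiff_deriv_stepFun (ε : ℝ) : ContDiff ℝ ∞ (deriv (stepFun ε)) :=
  (contDiff_infty_iff_deriv.1 (contDiff_stepFun ε)).2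

lemma contDiff_bump (ε : ℝ) : ContDiff ℝ ∞ (bump ε) := by
  have c : ∀ j : Fin 3, ContDiff ℝ ∞ fun y : E3 => deriv (stepFun ε) (y j) := fun j =>
    (contDiff_deriv_stepFun ε).comp (contDiff_coord contDiff_id j)
  exact ((c 0).mul (c 1)).mul (c 2)

lemma monotone_stepFun {ε : ℝ} (hε : 0 < ε) : Monotone (stepFun ε) := fun a b h =>
  Real.smoothTransition.monotone (by gcongr)

lemma deriv_stepFun_eq_zero {ε : ℝ} (hε : 0 < ε) {s : ℝ} (h : ε < |s|) :
    deriv (stepFun ε) s = 0 := by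
  rcases lt_abs.1 h with h | h
  · have : stepFun ε =ᶠ[𝓝 s] fun _ => (1 : ℝ) := by
      filter_upwards [lt_mem_nhds h] with y hy
      exact stepFun_of_ge hε hy.le
    rw [this.deriv_eq]; simp
  · have : stepFun ε =ᶠ[𝓝 s] fun _ => (0 : ℝ) := by
      filter_upwards [gt_mem_nhds (lt_neg.1 h)] with y hy
      exact stepFun_of_le hε hy.le
    rw [this.deriv_eq]; simp

lemma exists_deriv_stepFun_pos {ε : ℝ} (hε : 0 < ε) : ∃ s, |s| ≤ ε ∧ 0 < deriv (stepFun ε) s := by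
  obtain ⟨c, hc, h⟩ := exists_deriv_eq_slope (stepFun ε) (a := -ε) (b := ε) (by linarith)
    (contDiff_stepFun ε).continuous.continuousOn
    ((contDiff_stepFun ε).differentiable (by simp)).differentiableOn
  refine ⟨c, abs_le.2 ⟨hc.1.le, hc.2.le⟩, ?_⟩
  rw [h, stepFun_of_le hε le_rfl, stepFun_of_ge hε le_rfl]
  exact div_pos (by norm_num) (by linarith)

lemma bump_nonneg {ε : ℝ} (hε : 0 < ε) (y : E3) : 0 ≤ bump ε y :=
  mul_nonneg (mul_nonneg (monotone_stepFun hε).deriv_nonneg (monotone_stepFun hε).deriv_nonneg)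
    (monotone_stepFun hε).deriv_nonneg

lemma norm_le_of_bump_ne_zero {ε : ℝ} (hε : 0 < ε) {y : E3} (h : bump ε y ≠ 0) : ‖y‖ ≤ 2 * ε := by
  refine norm_le_two_mul hε.le fun i => ?_
  by_contra! hi
  have := deriv_stepFun_eq_zero hε hi
  refine h ?_
  unfold bump
  fin_cases i <;> simp_all

lemma hasCompactSupport_bump {ε : ℝ} (hε : 0 < ε) : HasCompactSupport (bump ε) :=
  HasCompactSupport.intro (isCompact_closedBall (0 : E3) (2 * ε)) fun y hy => by
    by_contra h
    exact hy (by simpa using norm_le_of_bump_ne_zero hε h)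

lemma exists_bump_pos {ε : ℝ} (hε : 0 < ε) : ∃ y, ‖y‖ ≤ 2 * ε ∧ 0 < bump ε y := by
  obtain ⟨s, hs, h⟩ := exists_deriv_stepFun_pos hε
  refine ⟨!₂[s, s, s], norm_le_two_mul hε.le fun i => ?_, ?_⟩
  · fin_cases i <;> simpa using hs
  · simp only [bump]
    simp only [Matrix.cons_val]
    positivity

lemma integral_bump_ne_zero {ε : ℝ} (hε : 0 < ε) : ∫ y, bump ε y ≠ 0 := by
  obtain ⟨y, -, hy⟩ := exists_bump_pos hε
  exact ((contDiff_bump ε).continuous.integral_pos_of_hasCompactSupport_nonneg_nonzero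
    (hasCompactSupport_bump hε) (bump_nonneg hε) hy.ne').ne'

lemma partialDeriv_stepFun_comp {u : E3 → ℝ} (hu : ContDiff ℝ ∞ u) (ε : ℝ) (k : Fin 3) (x : E3) :
    partialDeriv k (fun y => stepFun ε (u y)) x = deriv (stepFun ε) (u x) * partialDeriv k u x := by
  have h1 := ((contDiff_stepFun ε).differentiable (by simp) (u x)).hasDerivAt.comp_hasFDerivAt x
    (hu.differentiable (by simp) x).hasFDerivAt
  unfold partialDeriv
  have : (fun y => stepFun ε (u y)) = stepFun ε ∘ u := rfl
  rw [this, h1.fderiv]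
  rfl

lemma gradDet_stepComp {g : E3 → E3} (hg : ContDiff ℝ ∞ g) (ε : ℝ) (x : E3) :
    gradDet (stepComp ε g 0) (stepComp ε g 1) (stepComp ε g 2) x = bump ε (g x) * jacobian g x := by
  unfold gradDet jacobian gradDet stepComp bump
  simp only [partialDeriv_stepFun_comp (contDiff_coord hg _)]
  ring

lemma degInt_eq_pushInt {g : E3 → E3} (hg : ContDiff ℝ ∞ g) (r ε : ℝ) :
    degInt g r ε = pushInt (cutoff r) g (bump ε) := by
  unfold degInt pushInt
  simp_rw [gradDet_stepComp hg]

lemma jacobian_id (x : E3) : jacobian (fun y => y) x = 1 := by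
  simp [jacobian, gradDet, partialDeriv_coord_id]

lemma degInt_id_ne_zero {r ε : ℝ} (hr : 0 < r) (hε : 0 < ε) (h : 2 * ε ≤ r / 2) :
    degInt (fun y => y) r ε ≠ 0 := by
  rw [degInt_eq_pushInt (g := fun y => y) contDiff_id]
  unfold pushInt
  simp only [jacobian_id, mul_one]
  obtain ⟨y, hy, hy'⟩ := exists_bump_pos hε
  refine (((contDiff_cutoff r).continuous.mul
    (contDiff_bump ε).continuous).integral_pos_of_hasCompactSupport_nonneg_nonzero
    (hasCompactSupport_cutoff hr).mul_right
    (fun y => mul_nonneg (cutoff_nonneg r y) (bump_nonneg hε y)) (x := y) ?_).ne'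
  rw [Pi.mul_apply, cutoff_of_le hr (hy.trans h), one_mul]
  exact hy'.ne'

/-- An injective continuous map has nonzero degree. -/
lemma HasDeg.ne_zero {f : E3 → E3} {r d : ℝ} (hr : 0 < r) (hf : ContinuousOn f (closedBall 0 r))
    (hinj : InjOn f (closedBall 0 r)) (h0 : f 0 = 0) (h : HasDeg f r d) : d ≠ 0 := by
  have hball : ∀ {x : E3}, ‖x‖ ≤ r → x ∈ closedBall (0 : E3) r := fun hx => by simpa using hx
  have hz : (0 : E3) ∈ closedBall (0 : E3) r := hball (by simpa using hr.le)
  obtain ⟨m, hm, hmf⟩ := exists_pos_forall_le_norm hf fun x h1 h2 h3 => by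
    have := hinj (hball h2) hz (h3.trans h0.symm)
    rw [this, norm_zero] at h1; linarith
  -- a radius within which `f` is small
  obtain ⟨s, hs, hsr, hsf⟩ : ∃ s > 0, s ≤ r / 2 ∧ ∀ x : E3, ‖x‖ ≤ s → ‖f x‖ < m / 4 := by
    have h1 : ContinuousAt f 0 := hf.continuousAt (closedBall_mem_nhds _ hr)
    obtain ⟨δ, hδ, h2⟩ := Metric.continuousAt_iff.1 h1 (m / 4) (by positivity)
    refine ⟨min (δ / 2) (r / 2), by positivity, min_le_right _ _, fun x hx => ?_⟩
    have := h2 (x := x) (by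
      rw [dist_zero_right]; linarith [hx.trans (min_le_left _ _)])
    rwa [h0, dist_zero_right] at this
  -- a continuous left inverse of `f` and a smooth approximation of it
  have hK : IsCompact (f '' closedBall 0 r) := (isCompact_closedBall _ _).image_of_continuousOn hf
  obtain ⟨k, hk⟩ : ∃ k : C(E3, E3), ∀ x, ‖x‖ ≤ r → k (f x) = x := by
    have hemb : IsClosedEmbedding ((closedBall (0 : E3) r).domRestrict f) :=
      have : CompactSpace (closedBall (0 : E3) r) := isCompact_iff_compactSpace.1
        (isCompact_closedBall _ _)
      hf.domRestrict.isClosedEmbedding (injOn_iff_injective.1 hinj)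
    obtain ⟨k, hk⟩ := ContinuousMap.exists_extension hemb ⟨Subtype.val, continuous_subtype_val⟩
    exact ⟨k, fun x hx => congrArg (fun q => q ⟨x, hball hx⟩) hk⟩
  obtain ⟨l, hl, hlk, -⟩ := k.continuous.exists_contDiff_approx ⊤ (ε := fun _ => s / 8)
    continuous_const fun _ => by positivity
  obtain ⟨δ, hδ, hkδ⟩ : ∃ δ > 0, ∀ x, ‖x‖ ≤ r → ∀ y, ‖y - f x‖ < δ → ‖k y - x‖ < s / 8 := by
    have := hK.uniformContinuousAt_of_continuousAt k (fun a _ => k.continuous.continuousAt)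
      (Metric.dist_mem_uniformity (ε := s / 8) (by positivity))
    obtain ⟨δ, hδ, h2⟩ := Metric.mem_uniformity_dist.1 this
    refine ⟨δ, hδ, fun x hx y hy => ?_⟩
    have h3 := h2 (a := f x) (b := y) (by rwa [dist_comm, dist_eq_norm])
      (mem_image_of_mem f (hball hx))
    simp only [hk x hx] at h3
    rwa [mem_ofPred_eq, dist_comm, dist_eq_norm] at h3
  obtain ⟨ε₀, hε₀, hdeg⟩ := h
  obtain ⟨g, hg, hgf⟩ := exists_smooth_approx hf
    (show 0 < min ε₀ (min δ (m / 8)) by positivity)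
  have hg1 : ∀ x, ‖x‖ ≤ r → ‖g x - f x‖ < ε₀ := fun x hx => (hgf x hx).trans_le (min_le_left _ _)
  have hg2 : ∀ x, ‖x‖ ≤ r → ‖g x - f x‖ < δ := fun x hx =>
    (hgf x hx).trans_le ((min_le_right _ _).trans (min_le_left _ _))
  have hg3 : ∀ x, ‖x‖ ≤ r → ‖g x - f x‖ < m / 8 := fun x hx =>
    (hgf x hx).trans_le ((min_le_right _ _).trans (min_le_right _ _))
  have hlg : ∀ x, ‖x‖ ≤ r → ‖l (g x) - x‖ < s / 4 := by
    intro x hx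
    have h1 := hkδ x hx _ (hg2 x hx)
    have h2 : ‖l (g x) - k (g x)‖ < s / 8 := by rw [← dist_eq_norm]; exact hlk _
    have := norm_add_le (l (g x) - k (g x)) (k (g x) - x)
    rw [sub_add_sub_cancel] at this
    linarith
  have hlgs : ContDiff ℝ ∞ fun x => l (g x) := hl.comp hg
  -- On the shell `‖x‖ ≥ r / 2 ≥ s`, so some coordinate of `x` has size at least `s / 2`. As `l ∘ g`
  -- is within `s / 4` of the identity, that coordinate remains beyond `s / 8`.
  have e1 : degInt (fun x => l (g x)) r (s / 8) = degInt (fun y => y) r (s / 8) := by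
    refine degInt_congr (g' := fun y => y) hlgs contDiff_id hr (by positivity) (by positivity) fun x h1 h2 => ?_
    obtain ⟨i, hi⟩ := exists_norm_le_two_mul_abs x
    have b := abs_le.1 ((abs_coord_le_norm _ i).trans (hlg x h2).le)
    simp only [PiLp.sub_apply] at b
    refine ⟨i, ?_⟩
    rcases le_total 0 (x i) with h | h
    · rw [abs_of_nonneg h] at hi
      left; constructor <;> linarith
    · rw [abs_of_nonpos h] at hi
      right; constructor <;> linarith
  have n1 := e1 ▸ degInt_id_ne_zero hr (show 0 < s / 8 by positivity) (by linarith)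
  -- pull the computation back to the target of `g`
  let θ : ContDiffBump (0 : E3) := ⟨m / 2, 5 * m / 8, by positivity, by linarith⟩
  have hη0 : ContDiff ℝ ∞ fun y => bump (s / 8) (l y) * jacobian l y :=
    ((contDiff_bump _).comp hl).mul (contDiff_jacobian hl)
  have hθ : ContDiff ℝ ∞ θ := θ.contDiff
  let η : E3 → ℝ := fun y => θ y * (bump (s / 8) (l y) * jacobian l y)
  have hη : ContDiff ℝ ∞ η := hθ.mul hη0
  have e2 : degInt (fun x => l (g x)) r (s / 8) = pushInt (cutoff r) g η := by
    unfold degInt pushInt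
    congr 1
    funext x
    have h1 : gradDet (stepComp (s / 8) (fun x => l (g x)) 0) (stepComp (s / 8) (fun x => l (g x)) 1)
        (stepComp (s / 8) (fun x => l (g x)) 2) x =
        bump (s / 8) (l (g x)) * jacobian l (g x) * jacobian g x := by
      rw [← gradDet_stepComp hl]
      exact gradDet_comp (contDiff_stepComp hl _ 0) (contDiff_stepComp hl _ 1)
        (contDiff_stepComp hl _ 2) hg x
    rw [h1]
    rcases le_total r ‖x‖ with hx | hx
    · simp [cutoff_of_ge hr hx]
    by_cases hb : bump (s / 8) (l (g x)) = 0
    · simp [η, hb]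
    have h2 := norm_le_of_bump_ne_zero (by positivity) hb
    have h3 := hlg x hx
    have h4 := norm_sub_norm_le x (l (g x))
    rw [norm_sub_rev] at h4
    have h5 := hsf x (by linarith)
    have h6 := norm_sub_norm_le (g x) (f x)
    have h7 : θ (g x) = 1 := θ.one_of_mem_closedBall (by
      have := hg3 x hx
      simp only [mem_closedBall, dist_zero_right, θ]; linarith)
    simp [η, h7]
  have hpos : 0 < min ε₀ (m / 16) := by positivity
  set ε := min ε₀ (m / 16) / 2 with hε
  have hε1 : ε < ε₀ := by linarith [min_le_left ε₀ (m / 16)]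
  have hε2 : ε < m / 16 := by linarith [min_le_right ε₀ (m / 16)]
  have hε3 : 0 < ε := by linarith
  have e3 := hdeg g hg hg1 ε hε3 hε1
  rw [degInt_eq_pushInt hg] at e3
  -- Multiplicativity of the degree: up to the integral of a bump, the degree of `l ∘ g` is `d`
  -- times the integral of `η`. If `d` were zero, the degree of a map close to the identity would
  -- vanish.
  have key := pushInt_mul_integral_comm (contDiff_cutoff r) (hasCompactSupport_cutoff hr) hg hη
    (θ.hasCompactSupport.mul_right) (contDiff_bump ε) (hasCompactSupport_bump hε3)
    (a := 5 * m / 8) (b := 2 * ε) (fun y hy => by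
      have : θ y ≠ 0 := left_ne_zero_of_mul hy
      by_contra! hy'
      exact this (θ.zero_of_le_dist (by simpa using hy'.le)))
    (fun y hy => norm_le_of_bump_ne_zero hε3 hy) fun x hx => by
      obtain ⟨h1, h2⟩ := norm_of_fderiv_cutoff_ne_zero hr hx
      have h3 := norm_sub_norm_le (f x) (g x)
      rw [norm_sub_rev] at h3
      linarith [hmf x h1 h2, hg3 x h2]
  rintro rfl
  rw [e3, zero_mul, ← e2] at key
  exact mul_ne_zero n1 (integral_bump_ne_zero hε3) key

/-! ### Local degree: reflection and homotopy -/

/-- The reflection of `E3` in the plane `x 1 = 0`. -/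
noncomputable def reflectOne : E3 ≃ₗᵢ[ℝ] E3 :=
  LinearIsometryEquiv.piLpCongrRight 2 fun i : Fin 3 =>
    if i = 1 then LinearIsometryEquiv.neg ℝ else LinearIsometryEquiv.refl ℝ ℝ

lemma reflectOne_apply (x : E3) (i : Fin 3) :
    reflectOne x i = if i = 1 then - x i else x i := by
  simp only [reflectOne, LinearIsometryEquiv.piLpCongrRight_apply]
  fin_cases i <;> simp

lemma reflectOne_reflectOne (x : E3) : reflectOne (reflectOne x) = x := by
  ext i; simp only [reflectOne_apply]; split_ifs <;> simp

lemma reflectOne_single (i : Fin 3) : reflectOne (EuclideanSpace.single i 1) =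
    (if i = 1 then (-1 : ℝ) else 1) • EuclideanSpace.single i 1 := by
  ext j
  rw [reflectOne_apply]
  fin_cases i <;> fin_cases j <;> simp

lemma contDiff_reflectOne : ContDiff ℝ ∞ reflectOne :=
  reflectOne.contDiff

lemma partialDeriv_comp_reflectOne {u : E3 → ℝ} (hu : ContDiff ℝ ∞ u) (k : Fin 3) (x : E3) :
    partialDeriv k (fun y => u (reflectOne y)) x =
      (if k = 1 then (-1 : ℝ) else 1) * partialDeriv k u (reflectOne x) := by
  have h := (hu.differentiable (by simp) (reflectOne x)).hasFDerivAt.comp x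
    reflectOne.toContinuousLinearEquiv.toContinuousLinearMap.hasFDerivAt
  unfold partialDeriv
  have : (fun y => u (reflectOne y)) = u ∘ reflectOne := rfl
  rw [this, h.fderiv]
  simp only [ContinuousLinearMap.comp_apply, ContinuousLinearEquiv.coe_coe,
    LinearIsometryEquiv.coe_toContinuousLinearEquiv, reflectOne_single, map_smul, smul_eq_mul]

lemma degInt_comp_reflectOne {g : E3 → E3} (hg : ContDiff ℝ ∞ g) (r ε : ℝ) :
    degInt (fun x => g (reflectOne x)) r ε = - degInt g r ε := by
  have h1 := reflectOne.measurePreserving.integral_comp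
    reflectOne.toHomeomorph.measurableEmbedding
    (fun x => cutoff r x * gradDet (stepComp ε g 0) (stepComp ε g 1) (stepComp ε g 2) x)
  unfold degInt
  rw [← h1, ← integral_neg]
  congr 1
  funext x
  have h2 : cutoff r (reflectOne x) = cutoff r x := by simp [cutoff]
  have h3 : ∀ i, stepComp ε (fun x => g (reflectOne x)) i = fun x => stepComp ε g i (reflectOne x) :=
    fun i => rfl
  rw [h2, h3, h3, h3]
  unfold gradDet
  simp only [partialDeriv_comp_reflectOne (contDiff_stepComp hg ε _)]
  simp
  ring

lemma HasDeg.comp_reflectOne {f : E3 → E3} {r d : ℝ} (h : HasDeg f r d) :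
    HasDeg (fun x => f (reflectOne x)) r (-d) := by
  obtain ⟨ε, hε, h⟩ := h
  refine ⟨ε, hε, fun g hg hgf t ht htε => ?_⟩
  have hg' := hg.comp contDiff_reflectOne
  rw [← h (g ∘ reflectOne) hg' (fun x hx => ?_) t ht htε, ← degInt_comp_reflectOne hg']
  · simp [reflectOne_reflectOne]
  · have := hgf (reflectOne x) (by simpa using hx)
    simpa only [reflectOne_reflectOne, Function.comp_apply] using this

/-- `f` has an isolated zero of local degree `d` at the origin. -/
def HasLocalDegree (f : E3 → E3) (d : ℝ) : Prop :=
  ∃ r > 0, ContinuousOn f (closedBall 0 r) ∧ (∀ x, ‖x‖ ≤ r → f x = 0 → x = 0) ∧ HasDeg f r d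

lemma exists_hasDeg_of_isolated {f : E3 → E3} {r : ℝ} (hr : 0 < r)
    (hf : ContinuousOn f (closedBall 0 r)) (h0 : ∀ x, ‖x‖ ≤ r → f x = 0 → x = 0) :
    ∃ d, HasDeg f r d :=
  exists_hasDeg hr hf fun x h1 h2 h3 => by
    rw [h0 x h2 h3, norm_zero] at h1; linarith

lemma HasLocalDegree.unique {f : E3 → E3} {d d' : ℝ} (h : HasLocalDegree f d)
    (h' : HasLocalDegree f d') : d = d' := by
  obtain ⟨r, hr, hf, h0, h⟩ := h
  obtain ⟨r', hr', hf', h0', h'⟩ := h'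
  have hm := lt_min hr hr'
  exact (h.of_radius_le hm (min_le_left _ _) hf h0).unique
    (h'.of_radius_le hm (min_le_right _ _) hf' h0')
    (hf.mono (closedBall_subset_closedBall (min_le_left _ _)))

lemma HasLocalDegree.congr {f f' : E3 → E3} {d : ℝ} (h : HasLocalDegree f d) {r : ℝ} (hr : 0 < r)
    (hff : ∀ x, ‖x‖ ≤ r → f x = f' x) : HasLocalDegree f' d := by
  obtain ⟨r', hr', hf, h0, h⟩ := h
  have hm := lt_min hr hr'
  have hff' : ∀ x, ‖x‖ ≤ min r r' → f x = f' x := fun x hx => hff x (hx.trans (min_le_left _ _))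
  refine ⟨min r r', hm, ?_, fun x hx h3 => h0 x (hx.trans (min_le_right _ _)) ?_,
    (h.of_radius_le hm (min_le_right _ _) hf h0).congr hff'⟩
  · refine (hf.mono (closedBall_subset_closedBall (min_le_right _ _))).congr fun x hx => ?_
    exact (hff' x (by simpa using hx)).symm
  · rw [hff' x hx, h3]

lemma HasLocalDegree.ne_zero {f : E3 → E3} {d : ℝ} (h : HasLocalDegree f d) {r : ℝ} (hr : 0 < r)
    (hinj : InjOn f (closedBall 0 r)) (hz : f 0 = 0) : d ≠ 0 := by
  obtain ⟨r', hr', hf, h0, h⟩ := h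
  have hm := lt_min hr hr'
  exact (h.of_radius_le hm (min_le_right _ _) hf h0).ne_zero hm
    (hf.mono (closedBall_subset_closedBall (min_le_right _ _)))
    (hinj.mono (closedBall_subset_closedBall (min_le_left _ _))) hz

lemma HasLocalDegree.comp_reflectOne {f : E3 → E3} {d : ℝ} (h : HasLocalDegree f d) :
    HasLocalDegree (fun x => f (reflectOne x)) (-d) := by
  obtain ⟨r, hr, hf, h0, h⟩ := h
  refine ⟨r, hr, hf.comp reflectOne.continuous.continuousOn fun x hx => by simpa using hx,
    fun x hx h3 => ?_, h.comp_reflectOne⟩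
  simpa using h0 (reflectOne x) (by simpa using hx) h3

/-- Homotopy invariance of the local degree. -/
lemma HasLocalDegree.homotopy {T : Type*} [TopologicalSpace T] [PreconnectedSpace T]
    {f : T → E3 → E3} {r : ℝ} (hr : 0 < r)
    (hf : ContinuousOn (fun p : T × E3 => f p.1 p.2) (univ ×ˢ closedBall 0 r))
    (h0 : ∀ t x, ‖x‖ ≤ r → f t x = 0 → x = 0) {a b : T} {d : ℝ} (h : HasLocalDegree (f a) d) :
    HasLocalDegree (f b) d := by
  have hft : ∀ t, ContinuousOn (f t) (closedBall 0 r) := fun t =>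
    hf.comp (f := fun x : E3 => (t, x)) (by fun_prop) fun x hx => ⟨mem_univ _, hx⟩
  have hopen : ∀ d, IsOpen {t | HasDeg (f t) r d} := by
    intro d
    rw [isOpen_iff_mem_nhds]
    intro t ht
    obtain ⟨δ, hδ, hd⟩ := HasDeg.exists_forall_near ht
    have : CompactSpace (closedBall (0 : E3) r) :=
      isCompact_iff_compactSpace.1 (isCompact_closedBall _ _)
    -- Over the compact ball, currying turns joint continuity into continuity in `t` for the uniform
    -- distance.
    let F : C(T × closedBall (0 : E3) r, E3) := ⟨fun p => f p.1 p.2,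
      hf.comp_continuous (f := fun p : T × closedBall (0 : E3) r => (p.1, (p.2 : E3)))
        (by fun_prop) fun p => ⟨mem_univ _, p.2.2⟩⟩
    filter_upwards [F.curry.continuous.continuousAt (x := t) (ball_mem_nhds _ hδ)] with t' ht'
    refine hd _ fun x hx => ?_
    have h1 := ContinuousMap.dist_apply_le_dist (f := F.curry t') (g := F.curry t)
      (⟨x, by simpa using hx⟩ : closedBall (0 : E3) r)
    rw [← dist_eq_norm]
    exact h1.trans (mem_ball.1 ht').le
  -- A degree exists for every `t` and is unique, so the complement is the union of the open sets
  -- belonging to the other values.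
  have hclosed : IsClosed {t | HasDeg (f t) r d} := by
    have : {t | HasDeg (f t) r d}ᶜ = ⋃ (d') (_ : d' ≠ d), {t | HasDeg (f t) r d'} := by
      ext t
      simp only [mem_compl_iff, mem_ofPred_eq, mem_iUnion, exists_prop]
      constructor
      · intro hn
        obtain ⟨d', hd'⟩ := exists_hasDeg_of_isolated hr (hft t) (h0 t)
        exact ⟨d', fun e => hn (e ▸ hd'), hd'⟩
      · rintro ⟨d', hne, hd'⟩ hd
        exact hne (hd'.unique hd (hft t))
    rw [← isOpen_compl_iff, this]
    exact isOpen_biUnion fun d' _ => hopen d'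
  have ha : HasDeg (f a) r d := by
    obtain ⟨d', hd'⟩ := exists_hasDeg_of_isolated hr (hft a) (h0 a)
    have : HasLocalDegree (f a) d' := ⟨r, hr, hft a, h0 a, hd'⟩
    rwa [h.unique this]
  have := IsClopen.eq_univ ⟨hclosed, hopen d⟩ ⟨a, ha⟩
  exact ⟨r, hr, hft b, h0 b, eq_univ_iff_forall.1 this b⟩

/-! ### Coorientations, and thickening a strip towards the chosen side -/

section Coorientation

variable {S : Type*} [TopologicalSpace S]

/-- On the open set `V`, the immersion `φ` maps injectively into the coordinate plane `x j = 0` of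
the chart `h`, and the positive side of this plane is the side `σ s` at all points `s` of `A`. -/
structure IsCoorientedChart (φ : S → E3) (σ : S → Set E3) (A V : Set S)
    (h : OpenPartialHomeomorph E3 E3) (j : Fin 3) : Prop where
  isOpen : IsOpen V
  injOn : InjOn φ V
  mem_source : ∀ s ∈ V, φ s ∈ h.source
  coord_eq_zero : ∀ s ∈ V, h (φ s) j = 0
  side : ∀ s ∈ V ∩ A, ∀ᶠ x in 𝓝 (φ s), (x ∈ σ s ↔ 0 < h x j)

/-- The family `σ` of sets describes a continuous choice of sides of the immersed surface `φ` over
the set `A`. -/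
def IsCoorientation (φ : S → E3) (σ : S → Set E3) (A : Set S) : Prop :=
  ∀ s ∈ A, ∃ V h j, s ∈ V ∧ IsCoorientedChart φ σ A V h j

end Coorientation

/-- The map `v ↦ (x + v 0, v 1)` followed by `G` and by the chart `h`, and then thickened in the
`j`-th coordinate direction of the chart. -/
noncomputable def thickChart (G : ℝ → ℝ → E3) (h : OpenPartialHomeomorph E3 E3) (j : Fin 3)
    (x : ℝ) (v : E3) : E3 :=
  h (G (x + v 0) (v 1)) + v 2 • EuclideanSpace.single j 1

/-- The thickening of `G` along the `j`-th coordinate direction of the chart `h`, centred at the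
image of `(x, 0)`. -/
noncomputable def thick (G : ℝ → ℝ → E3) (h : OpenPartialHomeomorph E3 E3) (j : Fin 3)
    (x : ℝ) (v : E3) : E3 :=
  h.symm (thickChart G h j x v) - G x 0

section Thick

variable {S : Type*} [TopologicalSpace S] {φ : S → E3} {σ σ' : S → Set E3} {A V V' : Set S}
  {h h' : OpenPartialHomeomorph E3 E3} {j j' : Fin 3} {F : ℝ → ℝ → S}

local notation "G₀" => fun x t => φ (F x t)

lemma thickChart_coord (hV : IsCoorientedChart φ σ A V h j) {x : ℝ} {v : E3}
    (hF : F (x + v 0) (v 1) ∈ V) : thickChart G₀ h j x v j = v 2 := by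
  simp [thickChart, hV.coord_eq_zero _ hF]

lemma continuousAt_thickChart (hV : IsCoorientedChart φ σ A V h j) (hφ : Continuous φ)
    (hFc : Continuous fun p : ℝ × ℝ => F p.1 p.2) {x : ℝ} {v : E3} (hF : F (x + v 0) (v 1) ∈ V) :
    ContinuousAt (fun p : ℝ × E3 => thickChart G₀ h j p.1 p.2) (x, v) := by
  have h1 : Continuous fun p : ℝ × E3 => φ (F (p.1 + p.2 0) (p.2 1)) :=
    hφ.comp (hFc.comp (f := fun p : ℝ × E3 => (p.1 + p.2 0, p.2 1)) (by fun_prop))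
  have h2 : ContinuousAt h (φ (F (x + v 0) (v 1))) := h.continuousAt (hV.mem_source _ hF)
  have h3 : ContinuousAt (fun p : ℝ × E3 => h (φ (F (p.1 + p.2 0) (p.2 1)))) (x, v) :=
    ContinuousAt.comp (x := (x, v)) (f := fun p : ℝ × E3 => φ (F (p.1 + p.2 0) (p.2 1)))
      (g := h) h2 h1.continuousAt
  unfold thickChart
  exact h3.add (by fun_prop)

/-- Near a point of a chart, the thickening takes place within any given neighbourhood. -/
lemma exists_radius_thickChart (hV : IsCoorientedChart φ σ A V h j) (hφ : Continuous φ)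
    (hFc : Continuous fun p : ℝ × ℝ => F p.1 p.2) {x₀ : ℝ} (hx₀ : F x₀ 0 ∈ V) {W : Set E3}
    (hW : W ∈ 𝓝 (h (φ (F x₀ 0)))) :
    ∃ r > 0, r ≤ 1 / 4 ∧ ∀ x, |x - x₀| ≤ r → ∀ v : E3, ‖v‖ ≤ r →
      F (x + v 0) (v 1) ∈ V ∧ thickChart G₀ h j x v ∈ W := by
  have hx₀' : F (x₀ + (0 : E3) 0) ((0 : E3) 1) ∈ V := by simpa using hx₀
  have hc := continuousAt_thickChart hV hφ hFc hx₀'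
  have hW' : W ∈ 𝓝 (thickChart G₀ h j x₀ 0) := by simpa [thickChart] using hW
  have h1 : Continuous fun p : ℝ × E3 => F (p.1 + p.2 0) (p.2 1) :=
    hFc.comp (f := fun p : ℝ × E3 => (p.1 + p.2 0, p.2 1)) (by fun_prop)
  have h2 := (h1.continuousAt (x := (x₀, (0 : E3)))).preimage_mem_nhds (hV.isOpen.mem_nhds hx₀')
  obtain ⟨ε, hε, hε'⟩ := Metric.mem_nhds_iff.1 (inter_mem h2 (hc hW'))
  refine ⟨min (ε / 2) (1 / 4), by positivity, min_le_right _ _, fun x hx v hv => ?_⟩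
  have : ((x, v) : ℝ × E3) ∈ ball (x₀, (0 : E3)) ε := by
    rw [mem_ball, Prod.dist_eq, max_lt_iff, Real.dist_eq, dist_zero_right]
    have := min_le_left (ε / 2) (1 / 4 : ℝ)
    constructor <;> dsimp only <;> linarith
  exact hε' this

/-- The thickening is injective near the origin: the `j`-th chart coordinate recovers `v 2`, because
the sheet lies in the plane where it vanishes. Injectivity of `φ` on the sheet and of the strip
recover `v 0` and `v 1`. The bound `1 / 4` keeps the two points of the strip less than one turn
apart. -/
lemma eq_zero_of_thickChart (hV : IsCoorientedChart φ σ A V h j)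
    (hFi : ∀ x x' t t', |x - x'| < 1 → |t| ≤ 1 → |t'| ≤ 1 → F x t = F x' t' → x = x' ∧ t = t')
    {x : ℝ} {v w : E3} (hv : ‖v‖ ≤ 1 / 4) (hw : ‖w‖ ≤ 1 / 4) (hFv : F (x + v 0) (v 1) ∈ V)
    (hFw : F (x + w 0) (w 1) ∈ V) (e : thickChart G₀ h j x v = thickChart G₀ h j x w) : v = w := by
  have e2 : v 2 = w 2 := by rw [← thickChart_coord hV hFv, e, thickChart_coord hV hFw]
  have e3 : h (φ (F (x + v 0) (v 1))) = h (φ (F (x + w 0) (w 1))) := by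
    simpa [thickChart, e2] using e
  have e4 := hV.injOn hFv hFw (h.injOn (hV.mem_source _ hFv) (hV.mem_source _ hFw) e3)
  have a := fun i => abs_le.1 ((abs_coord_le_norm v i).trans hv)
  have b := fun i => abs_le.1 ((abs_coord_le_norm w i).trans hw)
  obtain ⟨e0, e1⟩ := hFi _ _ _ _ (by
    rw [abs_lt]; constructor <;> linarith [(a 0).1, (a 0).2, (b 0).1, (b 0).2])
    (abs_le.2 ⟨by linarith [(a 1).1], by linarith [(a 1).2]⟩)
    (abs_le.2 ⟨by linarith [(b 1).1], by linarith [(b 1).2]⟩) e4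
  ext i
  fin_cases i
  · simpa using e0
  · exact e1
  · exact e2

lemma thick_zero (hV : IsCoorientedChart φ σ A V h j) {x : ℝ} (hx : F x 0 ∈ V) :
    thick G₀ h j x 0 = 0 := by
  have := h.left_inv (hV.mem_source _ hx)
  simp [thick, thickChart, this]

/-- The thickening at `x₀` is injective near the origin, so its degree is nonzero. Moving the centre
`x` is a homotopy without further zeros, so the same degree persists nearby. -/
lemma exists_hasLocalDegree_thick (hV : IsCoorientedChart φ σ A V h j) (hφ : Continuous φ)
    (hFc : Continuous fun p : ℝ × ℝ => F p.1 p.2)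
    (hFi : ∀ x x' t t', |x - x'| < 1 → |t| ≤ 1 → |t'| ≤ 1 → F x t = F x' t' → x = x' ∧ t = t')
    {x₀ : ℝ} (hx₀ : F x₀ 0 ∈ V) :
    ∃ d ≠ 0, ∀ᶠ x in 𝓝 x₀, HasLocalDegree (thick G₀ h j x) d := by
  obtain ⟨r, hr, hr4, hrW⟩ := exists_radius_thickChart hV hφ hFc hx₀
    (h.open_target.mem_nhds (h.map_source (hV.mem_source _ hx₀)))
  have hcont : ContinuousOn (fun p : ℝ × E3 => thick G₀ h j p.1 p.2)
      (closedBall x₀ r ×ˢ closedBall 0 r) := by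
    rintro ⟨x, v⟩ ⟨hx, hv⟩
    obtain ⟨h1, h2⟩ := hrW x (by simpa [Real.dist_eq] using hx) v (by simpa using hv)
    have h3 := continuousAt_thickChart hV hφ hFc h1
    have h4 : ContinuousAt (fun p : ℝ × E3 => h.symm (thickChart G₀ h j p.1 p.2)) (x, v) :=
      ContinuousAt.comp (x := (x, v)) (g := h.symm) (h.continuousAt_symm h2) h3
    have h5 : Continuous fun p : ℝ × E3 => φ (F p.1 0) :=
      hφ.comp (hFc.comp (f := fun p : ℝ × E3 => (p.1, (0 : ℝ))) (by fun_prop))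
    exact (h4.sub h5.continuousAt).continuousWithinAt
  have hinj : ∀ x, |x - x₀| ≤ r → InjOn (thick G₀ h j x) (closedBall 0 r) := by
    intro x hx v hv w hw e
    obtain ⟨h1, h2⟩ := hrW x hx v (by simpa using hv)
    obtain ⟨h3, h4⟩ := hrW x hx w (by simpa using hw)
    exact eq_zero_of_thickChart hV hFi ((by simpa using hv : ‖v‖ ≤ r).trans hr4)
      ((by simpa using hw : ‖w‖ ≤ r).trans hr4) h1 h3
      (h.symm.injOn h2 h4 (sub_left_injective e))
  have hz : (0 : E3) ∈ closedBall (0 : E3) r := by simpa using hr.le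
  have hmem : ∀ x, |x - x₀| ≤ r → F x 0 ∈ V := fun x hx => by
    simpa using (hrW x hx 0 (by simpa using hr.le)).1
  have h0 : ∀ x, |x - x₀| ≤ r → ∀ v, ‖v‖ ≤ r → thick G₀ h j x v = 0 → v = 0 := fun x hx v hv e =>
    hinj x hx (by simpa using hv) hz (e.trans (thick_zero hV (hmem x hx)).symm)
  have hx₀r : |x₀ - x₀| ≤ r := by simpa using hr.le
  have hc₀ : ContinuousOn (thick G₀ h j x₀) (closedBall 0 r) :=
    hcont.comp (f := fun v : E3 => (x₀, v)) (by fun_prop) fun v hv => ⟨by simpa using hr.le, hv⟩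
  obtain ⟨d, hd⟩ := exists_hasDeg_of_isolated hr hc₀ (h0 x₀ hx₀r)
  have hd' : HasLocalDegree (thick G₀ h j x₀) d := ⟨r, hr, hc₀, h0 x₀ hx₀r, hd⟩
  refine ⟨d, hd'.ne_zero hr (hinj x₀ hx₀r) (thick_zero hV hx₀), ?_⟩
  filter_upwards [closedBall_mem_nhds x₀ hr] with x hx
  have : PreconnectedSpace (closedBall x₀ r) :=
    Subtype.preconnectedSpace (convex_closedBall x₀ r).isPreconnected
  exact HasLocalDegree.homotopy (T := closedBall x₀ r) (f := fun t => thick G₀ h j t) hr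
    (hcont.comp (f := fun p : closedBall x₀ r × E3 => ((p.1 : ℝ), p.2)) (by fun_prop)
      fun p hp => ⟨p.1.2, hp.2⟩)
    (fun t v hv => h0 t (Real.dist_eq (t : ℝ) x₀ ▸ t.2) v hv)
    (a := ⟨x₀, mem_closedBall_self hr.le⟩) (b := ⟨x, hx⟩) hd'

set_option maxHeartbeats 400000 in
/-- The local degree of the thickening does not depend on the cooriented chart. -/
lemma HasLocalDegree.thick_congr (hV : IsCoorientedChart φ σ A V h j)
    (hV' : IsCoorientedChart φ σ A V' h' j') (hφ : Continuous φ)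
    (hFc : Continuous fun p : ℝ × ℝ => F p.1 p.2)
    (hFi : ∀ x x' t t', |x - x'| < 1 → |t| ≤ 1 → |t'| ≤ 1 → F x t = F x' t' → x = x' ∧ t = t')
    {x : ℝ} (hx : F x 0 ∈ V) (hx' : F x 0 ∈ V') (hA : F x 0 ∈ A) {d : ℝ}
    (hd : HasLocalDegree (thick G₀ h j x) d) : HasLocalDegree (thick G₀ h' j' x) d := by
  set p := φ (F x 0) with hp
  have hps : p ∈ h.source := hV.mem_source _ hx
  have hps' : p ∈ h'.source := hV'.mem_source _ hx'
  -- The two thickenings will be joined by straight segments in the chart `h`; a ball inside its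
  -- target keeps these segments in the domain of `h.symm`.
  obtain ⟨ρ, hρ, hρt⟩ := Metric.isOpen_iff.1 h.open_target _ (h.map_source hps)
  -- a neighbourhood of `p` on which both charts are defined and agree about the sides
  have hN : ∀ᶠ y in 𝓝 p, y ∈ h.source ∧ h y ∈ ball (h p) ρ ∧ (0 < h' y j' ↔ 0 < h y j) := by
    filter_upwards [h.open_source.mem_nhds hps, (h.continuousAt hps) (ball_mem_nhds _ hρ),
      hV.side _ ⟨hx, hA⟩, hV'.side _ ⟨hx', hA⟩] with y h1 h2 h3 h4
    exact ⟨h1, h2, h4.symm.trans h3⟩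
  obtain ⟨r₁, hr₁, hr₁4, hr₁W⟩ := exists_radius_thickChart hV hφ hFc hx (ball_mem_nhds _ hρ)
  have hN' : ∀ᶠ y in 𝓝 (h' p), y ∈ h'.target ∧ h'.symm y ∈ h.source ∧
      h (h'.symm y) ∈ ball (h p) ρ ∧ (0 < h' (h'.symm y) j' ↔ 0 < h (h'.symm y) j) := by
    have h1 := h'.continuousAt_symm (h'.map_source hps')
    rw [ContinuousAt, h'.left_inv hps'] at h1
    filter_upwards [h'.open_target.mem_nhds (h'.map_source hps'), h1.eventually hN] with y h2 h3
    exact ⟨h2, h3⟩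
  obtain ⟨r₂, hr₂, hr₂4, hr₂W⟩ := exists_radius_thickChart hV' hφ hFc hx' hN'
  set r := min r₁ r₂ with hr_def
  have hr : 0 < r := lt_min hr₁ hr₂
  have hr4 : r ≤ 1 / 4 := (min_le_left _ _).trans hr₁4
  have hxx : ∀ {s : ℝ}, 0 < s → |x - x| ≤ s := fun hs => by simpa using hs.le
  have a₁ : ∀ v : E3, ‖v‖ ≤ r → F (x + v 0) (v 1) ∈ V ∧ thickChart G₀ h j x v ∈ ball (h p) ρ :=
    fun v hv => hr₁W x (hxx hr₁) v (hv.trans (min_le_left _ _))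
  have a₂ := fun (v : E3) (hv : ‖v‖ ≤ r) => hr₂W x (hxx hr₂) v (hv.trans (min_le_right _ _))
  let H' : E3 → E3 := fun v => h'.symm (thickChart G₀ h' j' x v)
  let Q : ℝ → E3 → E3 := fun τ v => (1 - τ) • thickChart G₀ h j x v + τ • h (H' v)
  have hQt : ∀ τ ∈ Icc (0 : ℝ) 1, ∀ v : E3, ‖v‖ ≤ r → Q τ v ∈ h.target := by
    intro τ hτ v hv
    exact hρt ((convex_ball (h p) ρ) (a₁ v hv).2 (a₂ v hv).2.2.2.1 (by linarith [hτ.2]) hτ.1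
      (by ring))
  have c₁ : ContinuousOn (thickChart G₀ h j x) (closedBall 0 r) := fun v hv =>
    (ContinuousAt.comp (x := v) (f := fun v : E3 => (x, v))
      (g := fun p : ℝ × E3 => thickChart G₀ h j p.1 p.2)
      (continuousAt_thickChart hV hφ hFc (a₁ v (by simpa using hv)).1)
      (by fun_prop)).continuousWithinAt
  have c₂ : ContinuousOn (fun v => h (H' v)) (closedBall 0 r) := fun v hv => by
    have hv' : ‖v‖ ≤ r := by simpa using hv
    have h1 : ContinuousAt (thickChart G₀ h' j' x) v :=
      ContinuousAt.comp (x := v) (f := fun v : E3 => (x, v))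
        (g := fun p : ℝ × E3 => thickChart G₀ h' j' p.1 p.2)
        (continuousAt_thickChart hV' hφ hFc (a₂ v hv').1) (by fun_prop)
    have h2 : ContinuousAt H' v :=
      ContinuousAt.comp (x := v) (g := h'.symm) (h'.continuousAt_symm (a₂ v hv').2.1) h1
    exact (ContinuousAt.comp (x := v) (g := h) (h.continuousAt (a₂ v hv').2.2.1)
      h2).continuousWithinAt
  let f : Icc (0 : ℝ) 1 → E3 → E3 := fun τ v => h.symm (Q τ v) - p
  have hf : ContinuousOn (fun q : Icc (0 : ℝ) 1 × E3 => f q.1 q.2) (univ ×ˢ closedBall 0 r) := by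
    refine ContinuousOn.sub ?_ continuousOn_const
    refine h.continuousOn_symm.comp (f := fun q : Icc (0 : ℝ) 1 × E3 => Q q.1 q.2) ?_
      fun q hq => hQt _ q.1.2 _ (by simpa using hq.2)
    have b₁ : ContinuousOn (fun q : Icc (0 : ℝ) 1 × E3 => thickChart G₀ h j x q.2)
        (univ ×ˢ closedBall 0 r) := c₁.comp (by fun_prop) fun q hq => hq.2
    have b₂ : ContinuousOn (fun q : Icc (0 : ℝ) 1 × E3 => h (H' q.2))
        (univ ×ˢ closedBall 0 r) := c₂.comp (f := fun q : Icc (0 : ℝ) 1 × E3 => q.2)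
          (by fun_prop) fun q hq => hq.2
    have s₁ : Continuous fun q : Icc (0 : ℝ) 1 × E3 => 1 - (q.1 : ℝ) := by fun_prop
    have s₂ : Continuous fun q : Icc (0 : ℝ) 1 × E3 => (q.1 : ℝ) := by fun_prop
    exact (s₁.continuousOn.smul b₁).add (s₂.continuousOn.smul b₂)
  have hz : ‖(0 : E3)‖ ≤ r := by simpa using hr.le
  have hK0 : thickChart G₀ h j x 0 = h p := by simp [thickChart, hp]
  have hK0' : thickChart G₀ h' j' x 0 = h' p := by simp [thickChart, hp]
  have h0 : ∀ (τ : Icc (0 : ℝ) 1) (v : E3), ‖v‖ ≤ r → f τ v = 0 → v = 0 := by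
    rintro ⟨τ, hτ⟩ v hv e
    obtain ⟨hFv, hKv⟩ := a₁ v hv
    obtain ⟨hFv', hKt, hHs, hHb, hside⟩ := a₂ v hv
    have e1 : Q τ v = h p := by
      rw [← h.right_inv (hQt τ hτ v hv)]
      exact congrArg h (sub_eq_zero.1 e)
    rw [h'.right_inv hKt, thickChart_coord hV' hFv'] at hside
    have e2 : (1 - τ) * v 2 + τ * h (H' v) j = 0 := by
      have := congrArg (fun y : E3 => y j) e1
      simp only [Q, PiLp.add_apply, PiLp.smul_apply, smul_eq_mul, thickChart_coord hV hFv] at this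
      rw [this, hp, hV.coord_eq_zero _ hx]
    -- The charts agree about the sides, so for `v 2 ≠ 0` the two endpoints of the segment have
    -- `j`-th coordinates on the same side, weakly if `v 2 < 0`. A zero then forces `τ = 1`, where
    -- the thickening in `h'` is injective. For `v 2 = 0` both endpoints are the same point of the
    -- surface, and the thickening in `h` is injective.
    rcases lt_trichotomy (v 2) 0 with hlt | heq | hgt
    · have h1 : h (H' v) j ≤ 0 := not_lt.1 fun hc => absurd (hside.2 hc) (not_lt.2 hlt.le)
      have h2 : τ = 1 := by
        by_contra hne
        have h3 : 0 < 1 - τ := sub_pos.2 (lt_of_le_of_ne hτ.2 hne)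
        nlinarith [hτ.1]
      subst h2
      have e3 : h (H' v) = h p := by simpa [Q] using e1
      have e4 : H' v = p := h.injOn hHs hps e3
      have e5 : thickChart G₀ h' j' x v = thickChart G₀ h' j' x 0 := by
        rw [hK0', ← e4, h'.right_inv hKt]
      exact eq_zero_of_thickChart hV' hFi (hv.trans hr4) (hz.trans hr4) hFv' (a₂ 0 hz).1 e5
    · have e3 : h (H' v) = thickChart G₀ h j x v := by
        simp [H', thickChart, heq, h'.left_inv (hV'.mem_source _ hFv')]
      have e4 : thickChart G₀ h j x v = thickChart G₀ h j x 0 := by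
        rw [hK0, ← e1]
        simp only [Q, e3]
        rw [← add_smul]; simp
      exact eq_zero_of_thickChart hV hFi (hv.trans hr4) (hz.trans hr4) hFv (a₁ 0 hz).1 e4
    · have h1 := hside.1 hgt
      rcases hτ.1.eq_or_lt with h2 | h2
      · rw [← h2] at e2; linarith
      · nlinarith [hτ.2, mul_pos h2 h1, mul_nonneg (sub_nonneg.2 hτ.2) hgt.le]
  have hd0 : HasLocalDegree (f ⟨0, by simp⟩) d := by
    refine hd.congr hr fun v hv => ?_
    simp [f, Q, thick, hp]
  refine (HasLocalDegree.homotopy hr hf h0 (b := ⟨1, by simp⟩) hd0).congr hr fun v hv => ?_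
  simp only [f, Q, thick, H', sub_self, zero_smul, one_smul, zero_add]
  rw [h.left_inv (a₂ v hv).2.2.1]

end Thick

/-! ### A Möbius strip in space is one-sided -/

/-- The universal covering of the Möbius strip, extended constantly in the second variable. -/
noncomputable def mobiusCover (x t : ℝ) : MobiusStrip :=
  Quotient.mk mobiusSetoid (x, projIcc (-1) 1 (by norm_num) t)

lemma continuous_mobiusCover : Continuous fun p : ℝ × ℝ => mobiusCover p.1 p.2 := by
  have h : Continuous (Quotient.mk mobiusSetoid) := continuous_quot_mk
  exact h.comp (continuous_fst.prodMk (continuous_projIcc.comp continuous_snd))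

lemma mobiusCover_add_one (x t : ℝ) : mobiusCover (x + 1) t = mobiusCover x (-t) := by
  refine Quotient.sound ⟨-1, by push_cast; ring, ?_⟩
  simp only [coe_projIcc, zpow_neg, zpow_one]
  rcases le_total t (-1) with h | h
  · rw [min_eq_right (by linarith : t ≤ 1), max_eq_left h, min_eq_left (by linarith : 1 ≤ -t)]
    norm_num
  rcases le_total t 1 with h' | h'
  · rw [min_eq_right h', max_eq_right h, min_eq_right (by linarith : -t ≤ 1),
      max_eq_right (by linarith : -1 ≤ -t)]
    norm_num
  · rw [min_eq_left h', min_eq_right (by linarith : -t ≤ 1), max_eq_left (by linarith : -t ≤ -1)]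
    norm_num

lemma eq_of_mobiusCover_eq {x x' t t' : ℝ} (hx : |x - x'| < 1) (ht : |t| ≤ 1) (ht' : |t'| ≤ 1)
    (h : mobiusCover x t = mobiusCover x' t') : x = x' ∧ t = t' := by
  obtain ⟨n, h1, h2⟩ := Quotient.exact h
  simp only at h1 h2
  rw [projIcc_of_mem _ (abs_le.1 ht), projIcc_of_mem _ (abs_le.1 ht')] at h2
  have hn : n = 0 := by
    rw [h1, abs_lt] at hx
    have a : (n : ℝ) < 1 := by linarith
    have b : (-1 : ℝ) < n := by linarith
    have a' : n < 1 := by exact_mod_cast a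
    have b' : -1 < n := by exact_mod_cast b
    omega
  subst hn
  simp at h1 h2
  exact ⟨h1.symm, h2.symm⟩

/-- The immersed surface is one-sided along any Möbius strip. -/
theorem IsCoorientation.false_of_mobiusStrip {S : Type*} [TopologicalSpace S] {φ : S → E3}
    {σ : S → Set E3} {A : Set S} (hσ : IsCoorientation φ σ A) (hφ : Continuous φ)
    {f : MobiusStrip → S} (hf : Continuous f) (hfi : Function.Injective f) (hfA : range f ⊆ A) :
    False := by
  set F : ℝ → ℝ → S := fun x t => f (mobiusCover x t) with hF
  have hFc : Continuous fun p : ℝ × ℝ => F p.1 p.2 := hf.comp continuous_mobiusCover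
  have hFi : ∀ x x' t t', |x - x'| < 1 → |t| ≤ 1 → |t'| ≤ 1 → F x t = F x' t' →
      x = x' ∧ t = t' := fun x x' t t' h1 h2 h3 h4 => eq_of_mobiusCover_eq h1 h2 h3 (hfi h4)
  have hFA : ∀ x t, F x t ∈ A := fun x t => hfA (mem_range_self _)
  let P : Set ℝ := {x | ∃ V h j, F x 0 ∈ V ∧ IsCoorientedChart φ σ A V h j ∧
    ∃ d > 0, HasLocalDegree (thick (fun x t => φ (F x t)) h j x) d}
  -- all cooriented charts at `x` have a degree of the same sign
  have hlocal : ∀ x, (∀ᶠ y in 𝓝 x, y ∈ P) ∨ (∀ᶠ y in 𝓝 x, y ∉ P) := by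
    intro x
    obtain ⟨V, h, j, hxV, hV⟩ := hσ _ (hFA x 0)
    obtain ⟨d, hd0, hd⟩ := exists_hasLocalDegree_thick hV hφ hFc hFi hxV
    have hxV' : ∀ᶠ y in 𝓝 x, F y 0 ∈ V := by
      have : Continuous fun y => F y 0 := hFc.comp (f := fun y : ℝ => (y, (0 : ℝ))) (by fun_prop)
      exact this.continuousAt.preimage_mem_nhds (hV.isOpen.mem_nhds hxV)
    rcases lt_or_gt_of_ne hd0 with hneg | hpos
    · right
      filter_upwards [hd, hxV'] with y hy hyV
      rintro ⟨V', h', j', hyV', hV', d', hd', hdeg⟩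
      have := (hdeg.thick_congr hV' hV hφ hFc hFi hyV' hyV (hFA y 0)).unique hy
      linarith
    · left
      filter_upwards [hd, hxV'] with y hy hyV
      exact ⟨V, h, j, hyV, hV, d, hpos, hy⟩
  have hclopen : IsClopen P := by
    constructor
    · rw [← isOpen_compl_iff, isOpen_iff_mem_nhds]
      intro x hx
      rcases hlocal x with h | h
      · exact absurd h.self_of_nhds hx
      · exact h
    · rw [isOpen_iff_mem_nhds]
      intro x hx
      rcases hlocal x with h | h
      · exact h
      · exact absurd hx h.self_of_nhds
  -- going once around the strip changes the sign
  have hflip : (0 : ℝ) ∈ P ↔ (0 + 1 : ℝ) ∉ P := by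
    obtain ⟨V, h, j, hxV, hV⟩ := hσ _ (hFA 0 0)
    obtain ⟨d, hd0, hd⟩ := exists_hasLocalDegree_thick hV hφ hFc hFi hxV
    have hd := hd.self_of_nhds
    have hF1 : ∀ x t, F (x + 1) t = F x (-t) := fun x t => congrArg f (mobiusCover_add_one x t)
    have hxV1 : F (0 + 1) 0 ∈ V := by rw [hF1]; simpa using hxV
    -- The deck transformation reverses the second strip variable and leaves the chart direction
    -- alone, so a full turn is precomposition with `reflectOne`.
    have e : thick (fun x t => φ (F x t)) h j (0 + 1) =
        fun v => thick (fun x t => φ (F x t)) h j 0 (reflectOne v) := by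
      funext v
      have e1 : F (0 + 1 + v 0) (v 1) = F (0 + v 0) (-v 1) := by rw [← hF1]; congr 1; ring
      simp only [thick, thickChart, reflectOne_apply, e1, hF1]
      simp
    have hd1 : HasLocalDegree (thick (fun x t => φ (F x t)) h j (0 + 1)) (-d) := by
      rw [e]; exact hd.comp_reflectOne
    have hiff : ∀ x c, F x 0 ∈ V → HasLocalDegree (thick (fun x t => φ (F x t)) h j x) c →
        (x ∈ P ↔ 0 < c) := by
      intro x c hx hc
      constructor
      · rintro ⟨V', h', j', hyV', hV', d', hd', hdeg⟩
        rwa [(hdeg.thick_congr hV' hV hφ hFc hFi hyV' hx (hFA x 0)).unique hc] at hd'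
      · exact fun h0 => ⟨V, h, j, hx, hV, c, h0, hc⟩
    rw [hiff 0 d hxV hd, hiff (0 + 1) (-d) hxV1 hd1]
    rcases lt_or_gt_of_ne hd0 with h | h <;> constructor <;> intro h' <;> linarith
  -- The line is connected, so `P` is empty or everything; both are incompatible with the change of
  -- sign.
  rcases isClopen_iff.1 hclopen with h | h <;> simp [h] at hflip

/-! ### Two-colourings of the complement in a chart -/

/-- A function that is locally constant near a preconnected set, up to values outside a dense set,
is constant near this set. -/
lemma eventually_eq_of_isPreconnected {E β : Type*} [TopologicalSpace E] {K D : Set E} {v : E → β}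
    (hK : IsPreconnected K) (hD : ∀ y ∈ K, ∃ᶠ x in 𝓝 y, x ∈ D)
    (h : ∀ y ∈ K, ∃ c, ∀ᶠ x in 𝓝 y, x ∈ D → v x = c) {a : E} (ha : a ∈ K) {c : β}
    (hc : ∀ᶠ x in 𝓝 a, x ∈ D → v x = c) : ∀ b ∈ K, ∀ᶠ x in 𝓝 b, x ∈ D → v x = c := by
  let A : β → Set E := fun c => {y | ∀ᶠ x in 𝓝 y, x ∈ D → v x = c}
  have hA : ∀ c, IsOpen (A c) := fun c => isOpen_iff_mem_nhds.2 fun y hy =>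
    eventually_eventually_nhds.2 hy
  intro b hb
  by_contra hbc
  obtain ⟨c', hc'⟩ := h b hb
  have hne : c' ≠ c := fun e => hbc (e ▸ hc')
  obtain ⟨y, hyK, hy, hy'⟩ := hK (A c) (⋃ (c') (_ : c' ≠ c), A c') (hA c)
    (isOpen_biUnion fun c' _ => hA c') (fun y hy => by
      obtain ⟨c₁, hc₁⟩ := h y hy
      by_cases e : c₁ = c
      · exact Or.inl (e ▸ hc₁)
      · exact Or.inr (mem_biUnion (x := c₁) e hc₁)) ⟨a, ha, hc⟩
    ⟨b, hb, mem_biUnion (x := c') hne hc'⟩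
  obtain ⟨c₁, hc₁, hy₁⟩ := mem_iUnion₂.1 hy'
  obtain ⟨x, hxD, hx, hx₁⟩ := ((hD y hyK).and_eventually (hy.and hy₁)).exists
  exact hc₁ ((hx₁ hxD).symm.trans (hx hxD))

/-- The chart `h` maps `X` to the union of the coordinate planes `x i = 0`, `i ∈ I`. -/
def IsPlanesChart (X : Set E3) (h : OpenPartialHomeomorph E3 E3) (I : Finset (Fin 3)) : Prop :=
  ∀ x ∈ h.source, x ∈ X ↔ ∃ i ∈ I, h x i = 0

/-- A two-colouring of the complement of `X` in the open set `U`, in which both colours meet at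
each point of `X`. -/
structure IsColoring (X : Set E3) (w : E3 → SignType) (U : Set E3) : Prop where
  isOpen : IsOpen U
  ne_zero : ∀ p ∈ U, p ∉ X → w p ≠ 0
  eventually_eq : ∀ p ∈ U, p ∉ X → ∀ᶠ x in 𝓝 p, w x = w p
  frequently_eq : ∀ p ∈ U, p ∈ X → ∀ c ≠ 0, ∃ᶠ x in 𝓝 p, x ∉ X ∧ w x = c

/-- The product of the signs of the coordinates with indices in `I`. -/
noncomputable def signProd (I : Finset (Fin 3)) (y : E3) : SignType :=
  ∏ i ∈ I, SignType.sign (y i)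

lemma signProd_ne_zero {I : Finset (Fin 3)} {y : E3} : signProd I y ≠ 0 ↔ ∀ i ∈ I, y i ≠ 0 := by
  simp [signProd, Finset.prod_ne_zero_iff]

lemma SignType.mul_self_eq_one {a : SignType} (h : a ≠ 0) : a * a = 1 := by
  revert h; cases a <;> decide

lemma eventually_sign_eq {s : ℝ} (hs : s ≠ 0) : ∀ᶠ t in 𝓝 s, SignType.sign t = SignType.sign s := by
  rcases lt_or_gt_of_ne hs with h | h
  · filter_upwards [gt_mem_nhds h] with t ht
    rw [sign_neg h, sign_neg ht]
  · filter_upwards [lt_mem_nhds h] with t ht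
    rw [sign_pos h, sign_pos ht]

lemma eventually_signProd_eq {I : Finset (Fin 3)} {y : E3} (hy : ∀ i ∈ I, y i ≠ 0) :
    ∀ᶠ z in 𝓝 y, signProd I z = signProd I y := by
  have : ∀ᶠ z in 𝓝 y, ∀ i ∈ I, SignType.sign (z i) = SignType.sign (y i) := by
    rw [Filter.eventually_all_finset]
    intro i hi
    have hc : Continuous fun z : E3 => z i := by fun_prop
    exact hc.continuousAt.eventually (eventually_sign_eq (hy i hi))
  filter_upwards [this] with z hz
  exact Finset.prod_congr rfl hz

/-- Near a common point of some coordinate planes, both signs occur. -/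
lemma frequently_signProd_eq {I : Finset (Fin 3)} {q : E3} {i₀ : Fin 3} (hi₀ : i₀ ∈ I)
    (hq : q i₀ = 0) {c : SignType} (hc : c ≠ 0) : ∃ᶠ y in 𝓝 q, signProd I y = c := by
  rw [Metric.nhds_basis_ball.frequently_iff]
  intro δ hδ
  -- A common small shift `t > 0` makes all the coordinates nonzero. The coordinate `i₀` may then be
  -- taken as `t` or `-t`, which selects the sign of the product.
  have h1 : ∀ᶠ t in 𝓝[>] (0 : ℝ), ∀ i, q i + t ≠ 0 := by
    rw [Filter.eventually_all]
    intro i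
    rcases le_or_gt 0 (q i) with h | h
    · filter_upwards [self_mem_nhdsWithin] with t ht
      have : 0 < t := ht
      linarith
    · filter_upwards [mem_nhdsWithin_of_mem_nhds (gt_mem_nhds (neg_pos.2 h))] with t ht
      linarith
  have h2 : ∀ᶠ t in 𝓝[>] (0 : ℝ), t < δ / 2 :=
    mem_nhdsWithin_of_mem_nhds (gt_mem_nhds (by positivity))
  obtain ⟨t, ht1, ht2, ht0 : 0 < t⟩ := (h1.and (h2.and self_mem_nhdsWithin)).exists
  set R : SignType := ∏ i ∈ I.erase i₀, SignType.sign (q i + t) with hR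
  have hR0 : R ≠ 0 := Finset.prod_ne_zero_iff.2 fun i _ => by simpa using ht1 i
  obtain ⟨s, hs, hsc⟩ : ∃ s : ℝ, |s| = t ∧ SignType.sign s = c * R := by
    have : c * R = 1 ∨ c * R = -1 := by
      revert hc hR0; generalize R = b; revert b c; decide
    rcases this with h | h
    · exact ⟨t, abs_of_pos ht0, by rw [h, sign_pos ht0]⟩
    · exact ⟨-t, by rw [abs_neg, abs_of_pos ht0], by rw [h, sign_neg (neg_neg_of_pos ht0)]⟩
  refine ⟨WithLp.toLp 2 fun i => if i = i₀ then s else q i + t, ?_, ?_⟩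
  · rw [mem_ball, dist_eq_norm]
    refine (norm_le_two_mul ht0.le fun i => ?_).trans_lt (by linarith : 2 * t < δ)
    by_cases hi : i = i₀
    · subst hi; simp [hq, hs]
    · simp [hi, abs_of_pos ht0]
  · rw [signProd, ← Finset.mul_prod_erase I _ hi₀]
    have : ∏ i ∈ I.erase i₀, SignType.sign ((WithLp.toLp 2 fun i => if i = i₀ then s else q i + t :
        E3) i) = R := by
      refine Finset.prod_congr rfl fun i hi => ?_
      simp [Finset.ne_of_mem_erase hi]
    rw [this]
    simp only [if_true, hsc, mul_assoc, SignType.mul_self_eq_one hR0, mul_one]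

lemma IsPlanesChart.isColoring {X : Set E3} {h : OpenPartialHomeomorph E3 E3} {I : Finset (Fin 3)}
    (hX : IsPlanesChart X h I) : IsColoring X (fun x => signProd I (h x)) h.source where
  isOpen := h.open_source
  ne_zero p hp hpX := signProd_ne_zero.2 fun i hi e => hpX ((hX p hp).2 ⟨i, hi, e⟩)
  eventually_eq p hp hpX := (h.continuousAt hp).eventually
    (eventually_signProd_eq fun i hi e => hpX ((hX p hp).2 ⟨i, hi, e⟩))
  frequently_eq p hp hpX c hc := by
    obtain ⟨i, hi, e⟩ := (hX p hp).1 hpX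
    have h1 := h.continuousAt_symm (h.map_source hp)
    rw [ContinuousAt, h.left_inv hp] at h1
    have h2 := (frequently_signProd_eq hi e hc).and_eventually
      (h.open_target.mem_nhds (h.map_source hp))
    refine h1.frequently (h2.mono fun y hy => ?_)
    have hy1 : signProd I (h (h.symm y)) = c := by rw [h.right_inv hy.2]; exact hy.1
    refine ⟨fun hyX => ?_, hy1⟩
    exact signProd_ne_zero.1 (hy1 ▸ hc) _ ((hX _ (h.map_target hy.2)).1 hyX).choose_spec.1
      ((hX _ (h.map_target hy.2)).1 hyX).choose_spec.2

lemma IsPlanesChart.frequently_notMem {X : Set E3} {h : OpenPartialHomeomorph E3 E3}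
    {I : Finset (Fin 3)} (hX : IsPlanesChart X h I) {p : E3} (hp : p ∈ h.source) :
    ∃ᶠ x in 𝓝 p, x ∉ X := by
  by_cases hpX : p ∈ X
  · exact (hX.isColoring.frequently_eq p hp hpX 1 one_ne_zero).mono fun x hx => hx.1
  · intro hc
    exact hpX (not_not.1 hc.self_of_nhds)

lemma frequently_coord_ne_zero (I : Finset (Fin 3)) (q : E3) :
    ∃ᶠ y in 𝓝 q, ∀ i ∈ I, y i ≠ 0 := by
  have := IsPlanesChart.frequently_notMem (X := {x | ∃ i ∈ I, x i = 0})
    (h := OpenPartialHomeomorph.refl E3) (I := I) (fun x _ => Iff.rfl) (mem_univ q)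
  simpa using this

/-- The open cube with centre `q` and side length `2 * δ`. -/
def cube (q : E3) (δ : ℝ) : Set E3 := {y | ∀ i, |y i - q i| < δ}

lemma convex_cube (q : E3) (δ : ℝ) : Convex ℝ (cube q δ) := by
  have : cube q δ = ⋂ i, (EuclideanSpace.proj i : E3 →L[ℝ] ℝ) ⁻¹' (ball (q i) δ) := by
    ext y; simp [cube, Real.dist_eq]
  rw [this]
  exact convex_iInter fun i => (convex_ball _ _).linear_preimage
    (EuclideanSpace.proj i : E3 →L[ℝ] ℝ).toLinearMap

lemma cube_mem_nhds (q : E3) {δ : ℝ} (hδ : 0 < δ) : cube q δ ∈ 𝓝 q := by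
  filter_upwards [ball_mem_nhds q hδ] with y hy i
  rw [mem_ball, dist_eq_norm] at hy
  exact (abs_coord_le_norm (y - q) i).trans_lt hy

lemma exists_cube_subset {q : E3} {N : Set E3} (hN : N ∈ 𝓝 q) : ∃ δ > 0, cube q δ ⊆ N := by
  obtain ⟨δ, hδ, h⟩ := Metric.mem_nhds_iff.1 hN
  refine ⟨δ / 4, by positivity, fun y hy => h ?_⟩
  rw [mem_ball, dist_eq_norm]
  have := norm_le_two_mul (y := y - q) (c := δ / 4) (by positivity) fun i => (hy i).le
  linarith

lemma IsColoring.eq_of_isPreconnected {X U K : Set E3} {w : E3 → SignType} (hw : IsColoring X w U)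
    {h : OpenPartialHomeomorph E3 E3} (hK : IsPreconnected K) (hKt : K ⊆ h.target)
    (hKU : ∀ y ∈ K, h.symm y ∈ U ∧ h.symm y ∉ X) {a b : E3} (ha : a ∈ K) (hb : b ∈ K) :
    w (h.symm a) = w (h.symm b) := by
  have key : ∀ y ∈ K, ∀ᶠ z in 𝓝 y, w (h.symm z) = w (h.symm y) := fun y hy =>
    (h.continuousAt_symm (hKt hy)).eventually
      (hw.eventually_eq _ (hKU y hy).1 (hKU y hy).2)
  have := eventually_eq_of_isPreconnected (D := univ) (v := fun y => w (h.symm y)) hK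
    (fun y _ => Eventually.frequently (by simp))
    (fun y hy => ⟨_, (key y hy).mono fun z hz _ => hz⟩) hb
    ((key b hb).mono fun z hz _ => hz) a ha
  exact this.self_of_nhds trivial

/-- Across a single coordinate plane, a colouring changes exactly as the sign of the coordinate. -/
lemma IsColoring.exists_eventually_mul_signProd {X U : Set E3} {w : E3 → SignType}
    (hw : IsColoring X w U) {h : OpenPartialHomeomorph E3 E3} {I : Finset (Fin 3)}
    (hX : IsPlanesChart X h I) {y : E3} (hy : y ∈ h.target) (hyU : h.symm y ∈ U) {i : Fin 3}
    (hi : i ∈ I) (hyi : y i = 0) (hyj : ∀ j ∈ I, j ≠ i → y j ≠ 0) :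
    ∃ c, ∀ᶠ z in 𝓝 y, (∀ j ∈ I, z j ≠ 0) → w (h.symm z) * signProd I z = c := by
  set R : SignType := ∏ j ∈ I.erase i, SignType.sign (y j) with hR
  have hR' : ∀ᶠ z in 𝓝 y, signProd (I.erase i) z = R := eventually_signProd_eq fun j hj =>
    hyj j (Finset.mem_of_mem_erase hj) (Finset.ne_of_mem_erase hj)
  have hR0 : R ≠ 0 := Finset.prod_ne_zero_iff.2 fun j hj => by
    simpa using hyj j (Finset.mem_of_mem_erase hj) (Finset.ne_of_mem_erase hj)
  have hU' : ∀ᶠ z in 𝓝 y, h.symm z ∈ U := (h.continuousAt_symm hy) (hw.isOpen.mem_nhds hyU)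
  obtain ⟨δ, hδ, hsub⟩ := exists_cube_subset
    (hR'.and (hU'.and (h.open_target.mem_nhds hy)))
  have hnotX : ∀ z ∈ cube y δ, z i ≠ 0 → h.symm z ∉ X := by
    intro z hz hzi hzX
    obtain ⟨j, hj, hj0⟩ := (hX _ (h.map_target (hsub hz).2.2)).1 hzX
    rw [h.right_inv (hsub hz).2.2] at hj0
    have h1 : signProd (I.erase i) z ≠ 0 := by rw [(hsub hz).1]; exact hR0
    exact signProd_ne_zero.1 h1 j (Finset.mem_erase.2 ⟨fun e => hzi (e ▸ hj0), hj⟩) hj0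
  -- the colouring is constant on each of the two halves of the cube
  have hlin : IsLinearMap ℝ fun z : E3 => z i := (EuclideanSpace.proj i : E3 →L[ℝ] ℝ).isLinear
  have hpos : ∀ a ∈ cube y δ ∩ {z | 0 < z i}, ∀ b ∈ cube y δ ∩ {z | 0 < z i},
      w (h.symm a) = w (h.symm b) := fun a ha b hb =>
    hw.eq_of_isPreconnected ((convex_cube y δ).inter (convex_halfSpace_gt hlin 0)).isPreconnected
      (fun z hz => (hsub hz.1).2.2)
      (fun z hz => ⟨(hsub hz.1).2.1, hnotX z hz.1 (ne_of_gt hz.2)⟩) ha hb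
  have hneg : ∀ a ∈ cube y δ ∩ {z | z i < 0}, ∀ b ∈ cube y δ ∩ {z | z i < 0},
      w (h.symm a) = w (h.symm b) := fun a ha b hb =>
    hw.eq_of_isPreconnected ((convex_cube y δ).inter (convex_halfSpace_lt hlin 0)).isPreconnected
      (fun z hz => (hsub hz.1).2.2)
      (fun z hz => ⟨(hsub hz.1).2.1, hnotX z hz.1 (ne_of_lt hz.2)⟩) ha hb
  obtain ⟨a, ha, hai⟩ : ∃ a ∈ cube y δ, 0 < a i :=
    ⟨y + EuclideanSpace.single i (δ / 2), fun j => by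
      by_cases hj : j = i
      · subst hj; simp [abs_of_pos (half_pos hδ), hδ]
      · simp [hj, hδ], by simp [hyi, hδ]⟩
  obtain ⟨b, hb, hbi⟩ : ∃ b ∈ cube y δ, b i < 0 :=
    ⟨y - EuclideanSpace.single i (δ / 2), fun j => by
      by_cases hj : j = i
      · subst hj; simp [abs_of_pos (half_pos hδ), hδ]
      · simp [hj, hδ], by simp [hyi, hδ]⟩
  have hane := hw.ne_zero _ (hsub ha).2.1 (hnotX a ha hai.ne')
  have hbne := hw.ne_zero _ (hsub hb).2.1 (hnotX b hb hbi.ne)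
  -- If the two halves of the cube had the same colour, the opposite colour would not occur near
  -- `y`, against `frequently_eq`.
  have hab : w (h.symm b) = - w (h.symm a) := by
    have hne : w (h.symm a) ≠ w (h.symm b) := by
      intro e
      have hyX : h.symm y ∈ X := (hX _ (h.map_target hy)).2 ⟨i, hi, by rw [h.right_inv hy, hyi]⟩
      have hc : -w (h.symm a) ≠ 0 := by simpa using hane
      have h1 := h.continuousAt (h.map_target hy)
      rw [ContinuousAt, h.right_inv hy] at h1
      have h2 := (hw.frequently_eq _ hyU hyX _ hc).and_eventually
        ((h1.eventually (cube_mem_nhds y hδ)).and (h.open_source.mem_nhds (h.map_target hy)))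
      obtain ⟨x, ⟨hxX, hxw⟩, hxc, hxs⟩ := h2.exists
      have hxc : h x ∈ cube y δ := hxc
      have hx0 : h x i ≠ 0 := fun e => hxX ((hX x hxs).2 ⟨i, hi, e⟩)
      rw [← h.left_inv hxs] at hxw
      have hself : -w (h.symm a) ≠ w (h.symm a) := by
        revert hane; generalize w (h.symm a) = c; revert c; decide
      rcases lt_or_gt_of_ne hx0 with hlt | hgt
      · exact hself (by rw [← hxw, e]; exact hneg _ ⟨hxc, hlt⟩ _ ⟨hb, hbi⟩)
      · exact hself (by rw [← hxw]; exact hpos _ ⟨hxc, hgt⟩ _ ⟨ha, hai⟩)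
    revert hane hbne hne
    generalize w (h.symm a) = c; generalize w (h.symm b) = d; revert c d; decide
  refine ⟨w (h.symm a) * R, ?_⟩
  filter_upwards [cube_mem_nhds y hδ] with z hz hzI
  rw [signProd, ← Finset.mul_prod_erase I _ hi]
  have hzR : ∏ j ∈ I.erase i, SignType.sign (z j) = R := (hsub hz).1
  rw [hzR]
  rcases lt_or_gt_of_ne (hzI i hi) with hlt | hgt
  · rw [hneg z ⟨hz, hlt⟩ b ⟨hb, hbi⟩, hab, sign_neg hlt]
    generalize w (h.symm a) = c; generalize R = d; revert c d; decide
  · rw [hpos z ⟨hz, hgt⟩ a ⟨ha, hai⟩, sign_pos hgt, one_mul]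

/-- In a chart, any colouring agrees with the product of the signs of the coordinates, up to a
constant sign. -/
lemma IsColoring.exists_eq_mul_signProd {X U : Set E3} {w : E3 → SignType}
    (hw : IsColoring X w U) {h : OpenPartialHomeomorph E3 E3} {I : Finset (Fin 3)}
    (hX : IsPlanesChart X h I) {p : E3} (hp : p ∈ h.source) (hpU : p ∈ U) :
    ∃ c ≠ 0, ∀ᶠ x in 𝓝 p, x ∉ X → w x = c * signProd I (h x) := by
  have hq := h.map_source hp
  have hN : ∀ᶠ y in 𝓝 (h p), y ∈ h.target ∧ h.symm y ∈ U := by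
    have h1 := h.continuousAt_symm hq
    rw [ContinuousAt, h.left_inv hp] at h1
    exact (show ∀ᶠ y in 𝓝 (h p), y ∈ h.target from h.open_target.mem_nhds hq).and
      (h1 (hw.isOpen.mem_nhds hpU))
  obtain ⟨δ, hδ, hB⟩ := exists_cube_subset hN
  let v : E3 → SignType := fun y => w (h.symm y) * signProd I y
  let D : Set E3 := {y | ∀ i ∈ I, y i ≠ 0}
  have hBX : ∀ y ∈ cube (h p) δ, y ∈ D → h.symm y ∉ X := by
    intro y hy hyD hyX
    obtain ⟨i, hi, e⟩ := (hX _ (h.map_target (hB hy).1)).1 hyX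
    rw [h.right_inv (hB hy).1] at e
    exact hyD i hi e
  -- Along a segment parallel to the `i`-th axis with ends in `D`, only the `i`-th coordinate can
  -- vanish. So at most one plane is crossed at a time, and there `w` and the product of signs
  -- change together.
  have hstep : ∀ y ∈ cube (h p) δ, y ∈ D → ∀ y' ∈ cube (h p) δ, y' ∈ D → ∀ i,
      (∀ j, j ≠ i → y' j = y j) → v y' = v y := by
    intro y hy hyD y' hy' hyD' i hij
    have hseg : ∀ z ∈ segment ℝ y y', z ∈ cube (h p) δ ∧ ∀ j, j ≠ i → z j = y j := by
      intro z hz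
      refine ⟨(convex_cube _ _).segment_subset hy hy' hz, fun j hj => ?_⟩
      obtain ⟨a, b, -, -, hab, rfl⟩ := hz
      simp only [PiLp.add_apply, PiLp.smul_apply, smul_eq_mul, hij j hj]
      rw [← add_mul, hab, one_mul]
    have hloc : ∀ z ∈ cube (h p) δ, z ∈ D → ∀ᶠ x in 𝓝 z, v x = v z := by
      intro z hz hzD
      filter_upwards [(h.continuousAt_symm (hB hz).1).eventually
        (hw.eventually_eq _ (hB hz).2 (hBX z hz hzD)), eventually_signProd_eq hzD] with x h1 h2
      simp only [v, h1, h2]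
    have h1 := eventually_eq_of_isPreconnected (D := D) (v := v) (c := v y)
      (convex_segment y y').isPreconnected (fun z _ => frequently_coord_ne_zero I z) (fun z hz => by
        obtain ⟨hzB, hzj⟩ := hseg z hz
        by_cases hzD : z ∈ D
        · exact ⟨v z, (hloc z hzB hzD).mono fun x hx _ => hx⟩
        · simp only [D, mem_ofPred_eq, not_forall, not_not] at hzD
          obtain ⟨k, hk, hk0⟩ := hzD
          have hki : k = i := by
            by_contra hne
            exact hyD k hk (by rw [← hzj k hne]; exact hk0)
          subst hki
          exact hw.exists_eventually_mul_signProd hX (hB hzB).1 (hB hzB).2 hk hk0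
            fun j hj hjk => by rw [hzj j hjk]; exact hyD j hj)
      (left_mem_segment ℝ y y') ((hloc y hy hyD).mono fun x hx _ => hx) y' (right_mem_segment ℝ y y')
    exact h1.self_of_nhds hyD'
  -- Three axis-parallel segments join any two points. The intermediate corners stay in the cube and
  -- in `D` because both are coordinatewise conditions.
  have hconst : ∀ y ∈ cube (h p) δ, y ∈ D → ∀ y' ∈ cube (h p) δ, y' ∈ D → v y' = v y := by
    intro y hy hyD y' hy' hyD'
    have mk : ∀ a b c : ℝ, (a = y 0 ∨ a = y' 0) → (b = y 1 ∨ b = y' 1) → (c = y 2 ∨ c = y' 2) →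
        (!₂[a, b, c] : E3) ∈ cube (h p) δ ∧ (!₂[a, b, c] : E3) ∈ D := by
      intro a b c ha hb hc
      constructor
      · intro i
        fin_cases i
        · rcases ha with rfl | rfl
          exacts [hy 0, hy' 0]
        · rcases hb with rfl | rfl
          exacts [hy 1, hy' 1]
        · rcases hc with rfl | rfl
          exacts [hy 2, hy' 2]
      · intro i hi
        fin_cases i
        · rcases ha with rfl | rfl
          exacts [hyD 0 hi, hyD' 0 hi]
        · rcases hb with rfl | rfl
          exacts [hyD 1 hi, hyD' 1 hi]
        · rcases hc with rfl | rfl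
          exacts [hyD 2 hi, hyD' 2 hi]
    obtain ⟨a1, a2⟩ := mk (y' 0) (y 1) (y 2) (Or.inr rfl) (Or.inl rfl) (Or.inl rfl)
    obtain ⟨b1, b2⟩ := mk (y' 0) (y' 1) (y 2) (Or.inr rfl) (Or.inr rfl) (Or.inl rfl)
    rw [hstep _ b1 b2 y' hy' hyD' 2 (fun j hj => by fin_cases j <;> simp_all),
      hstep _ a1 a2 _ b1 b2 1 (fun j hj => by fin_cases j <;> simp_all),
      hstep y hy hyD _ a1 a2 0 (fun j hj => by fin_cases j <;> simp_all)]
  obtain ⟨y, hyD, hy⟩ := ((frequently_coord_ne_zero I (h p)).and_eventually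
    (cube_mem_nhds (h p) hδ)).exists
  have hne : v y ≠ 0 :=
    mul_ne_zero (hw.ne_zero _ (hB hy).2 (hBX y hy hyD)) (signProd_ne_zero.2 hyD)
  refine ⟨v y, hne, ?_⟩
  filter_upwards [(h.continuousAt hp) (cube_mem_nhds (h p) hδ), h.open_source.mem_nhds hp]
    with x hx hxs hxX
  have hxD : h x ∈ D := fun i hi e => hxX ((hX x hxs).2 ⟨i, hi, e⟩)
  rw [← hconst y hy hyD _ hx hxD]
  simp only [v, h.left_inv hxs]
  rw [mul_assoc, SignType.mul_self_eq_one (signProd_ne_zero.2 hxD), mul_one]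

lemma SignType.eq_mul_of_mul_eq {a b e : SignType} (hb : b ≠ 0) (h : a * b = e) : a = e * b := by
  rw [← h, mul_assoc, SignType.mul_self_eq_one hb, mul_one]

lemma IsColoring.of_local {X U : Set E3} {w : E3 → SignType} (hX : IsClosed X) (hU : IsOpen U)
    (h : ∀ p ∈ U, ∃ w' U', IsColoring X w' U' ∧ p ∈ U' ∧ ∀ᶠ x in 𝓝 p, x ∉ X → w x = w' x) :
    IsColoring X w U where
  isOpen := hU
  ne_zero p hp hpX := by
    obtain ⟨w', U', hw', hpU', e⟩ := h p hp
    rw [e.self_of_nhds hpX]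
    exact hw'.ne_zero p hpU' hpX
  eventually_eq p hp hpX := by
    obtain ⟨w', U', hw', hpU', e⟩ := h p hp
    filter_upwards [e, hw'.eventually_eq p hpU' hpX, hX.isOpen_compl.mem_nhds hpX] with x h1 h2 h3
    rw [h1 h3, h2, e.self_of_nhds hpX]
  frequently_eq p hp hpX c hc := by
    obtain ⟨w', U', hw', hpU', e⟩ := h p hp
    refine ((hw'.frequently_eq p hpU' hpX c hc).and_eventually e).mono ?_
    rintro x ⟨⟨h1, h2⟩, h3⟩
    exact ⟨h1, (h3 h1).trans h2⟩

lemma IsColoring.const_mul {X U : Set E3} {w : E3 → SignType} (hw : IsColoring X w U)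
    {e : SignType} (he : e ≠ 0) : IsColoring X (fun x => e * w x) U where
  isOpen := hw.isOpen
  ne_zero p hp hpX := mul_ne_zero he (hw.ne_zero p hp hpX)
  eventually_eq p hp hpX := (hw.eventually_eq p hp hpX).mono fun x hx => by rw [hx]
  frequently_eq p hp hpX c hc := (hw.frequently_eq p hp hpX (e * c) (mul_ne_zero he hc)).mono
    fun x hx => ⟨hx.1, by
      rw [hx.2, ← mul_assoc, SignType.mul_self_eq_one he, one_mul]⟩

/-! ### Gluing colourings over boxes -/

/-- The closed box with opposite corners `a` and `b`. -/
def box (a b : Fin 3 → ℝ) : Set E3 := {x | ∀ i, a i ≤ x i ∧ x i ≤ b i}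

lemma isCompact_box (a b : Fin 3 → ℝ) : IsCompact (box a b) := by
  have h : box a b = (EuclideanSpace.equiv (Fin 3) ℝ).toHomeomorph ⁻¹' (Icc a b) := by
    ext x
    simp only [box, mem_ofPred_eq, mem_preimage, mem_Icc, Pi.le_def]
    exact forall_and
  rw [h, Homeomorph.isCompact_preimage]
  exact isCompact_Icc

/-- A colouring exists on a neighbourhood of the box. -/
def BoxColorable (X : Set E3) (a b : Fin 3 → ℝ) : Prop :=
  ∃ w U, IsColoring X w U ∧ box a b ⊆ U

lemma box_subset_box {a b a' b' : Fin 3 → ℝ} (ha : a ≤ a') (hb : b' ≤ b) :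
    box a' b' ⊆ box a b := fun _ hx i => ⟨(ha i).trans (hx i).1, (hx i).2.trans (hb i)⟩

lemma BoxColorable.mono {X : Set E3} {a b a' b' : Fin 3 → ℝ} (h : BoxColorable X a b)
    (ha : a ≤ a') (hb : b' ≤ b) : BoxColorable X a' b' := by
  obtain ⟨w, U, hw, hU⟩ := h
  exact ⟨w, U, hw, (box_subset_box ha hb).trans hU⟩

/-- Two colourings of adjacent boxes can be glued, after changing the colours in one of them if
necessary. -/
lemma BoxColorable.glue {X : Set E3} (hXc : IsClosed X)
    (hX : ∀ p, ∃ h I, p ∈ h.source ∧ IsPlanesChart X h I) {a b : Fin 3 → ℝ} (hab : a ≤ b)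
    {i : Fin 3} {m : ℝ} (ham : a i ≤ m) (hmb : m ≤ b i)
    (h₁ : BoxColorable X a (Function.update b i m)) (h₂ : BoxColorable X (Function.update a i m) b) :
    BoxColorable X a b := by
  obtain ⟨w₁, U₁, hw₁, hU₁⟩ := h₁
  obtain ⟨w₂, U₂, hw₂, hU₂⟩ := h₂
  have hlin : IsLinearMap ℝ fun z : E3 => z i := (EuclideanSpace.proj i : E3 →L[ℝ] ℝ).isLinear
  have hbox₁ : ∀ x ∈ box a b, x i ≤ m → x ∈ U₁ := fun x hx hxm => hU₁ fun j => by
    refine ⟨(hx j).1, ?_⟩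
    by_cases hj : j = i
    · subst hj; simpa using hxm
    · simpa [hj] using (hx j).2
  have hbox₂ : ∀ x ∈ box a b, m ≤ x i → x ∈ U₂ := fun x hx hxm => hU₂ fun j => by
    refine ⟨?_, (hx j).2⟩
    by_cases hj : j = i
    · subst hj; simpa using hxm
    · simpa [hj] using (hx j).1
  let K : Set E3 := box a b ∩ {x | x i = m}
  have hKc : Convex ℝ K := by
    refine Convex.inter ?_ (convex_hyperplane hlin m)
    have : box a b = ⋂ j, (EuclideanSpace.proj j : E3 →L[ℝ] ℝ) ⁻¹' (Icc (a j) (b j)) := by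
      ext y; simp [box]
    rw [this]
    exact convex_iInter fun j => (convex_Icc _ _).linear_preimage
      (EuclideanSpace.proj j : E3 →L[ℝ] ℝ).toLinearMap
  have hKU : ∀ y ∈ K, y ∈ U₁ ∧ y ∈ U₂ := fun y hy =>
    ⟨hbox₁ y hy.1 (le_of_eq hy.2), hbox₂ y hy.1 (ge_of_eq hy.2)⟩
  have hdense : ∀ p, ∃ᶠ x in 𝓝 p, x ∈ Xᶜ := fun p => by
    obtain ⟨h, I, hp, hc⟩ := hX p
    exact hc.frequently_notMem hp
  -- Near a point of the common face both colourings are constants times the same product of signs,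
  -- so their product is locally constant off `X`. The face is connected, hence one sign `e` relates
  -- them along all of it.
  have hloc : ∀ y ∈ K, ∃ c, ∀ᶠ x in 𝓝 y, x ∈ Xᶜ → w₁ x * w₂ x = c := by
    intro y hy
    obtain ⟨h, I, hp, hc⟩ := hX y
    obtain ⟨c₁, -, e₁⟩ := hw₁.exists_eq_mul_signProd hc hp (hKU y hy).1
    obtain ⟨c₂, -, e₂⟩ := hw₂.exists_eq_mul_signProd hc hp (hKU y hy).2
    refine ⟨c₁ * c₂, ?_⟩
    filter_upwards [e₁, e₂, h.open_source.mem_nhds hp] with x h1 h2 hxs hxX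
    have h3 : signProd I (h x) ≠ 0 :=
      signProd_ne_zero.2 fun i hi e => hxX ((hc x hxs).2 ⟨i, hi, e⟩)
    rw [h1 hxX, h2 hxX, mul_mul_mul_comm, SignType.mul_self_eq_one h3, mul_one]
  let k₀ : E3 := WithLp.toLp 2 (Function.update a i m)
  have hk₀ : k₀ ∈ K := by
    refine ⟨fun j => ?_, by simp [k₀]⟩
    by_cases hj : j = i
    · subst hj; simp [k₀, ham, hmb]
    · simpa [k₀, hj] using hab j
  obtain ⟨e, he⟩ := hloc k₀ hk₀
  have he' := eventually_eq_of_isPreconnected hKc.isPreconnected (fun y _ => hdense y) hloc hk₀ he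
  have hene : e ≠ 0 := by
    obtain ⟨x, hxX, hx, hx1, hx2⟩ := ((hdense k₀).and_eventually (he.and
      ((hw₁.isOpen.eventually_mem (hKU _ hk₀).1).and
        (hw₂.isOpen.eventually_mem (hKU _ hk₀).2)))).exists
    rw [← hx hxX]
    exact mul_ne_zero (hw₁.ne_zero x hx1 hxX) (hw₂.ne_zero x hx2 hxX)
  let O : Set E3 := (U₁ ∩ U₂) ∩ {y | ∀ᶠ x in 𝓝 y, x ∈ Xᶜ → w₁ x * w₂ x = e}
  have hO : IsOpen O := (hw₁.isOpen.inter hw₂.isOpen).inter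
    (isOpen_iff_mem_nhds.2 fun y hy => eventually_eventually_nhds.2 hy)
  have hci : Continuous fun x : E3 => x i := by fun_prop
  classical
  refine ⟨fun x => if x i < m then w₁ x else e * w₂ x,
    (U₁ ∩ {x | x i < m}) ∪ (U₂ ∩ {x | m < x i}) ∪ O, IsColoring.of_local hXc
      (((hw₁.isOpen.inter (isOpen_lt hci continuous_const)).union
        (hw₂.isOpen.inter (isOpen_lt continuous_const hci))).union hO) ?_, ?_⟩
  · rintro p ((⟨hp, hpm⟩ | ⟨hp, hpm⟩) | ⟨⟨hp₁, hp₂⟩, hpO⟩)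
    · refine ⟨w₁, U₁, hw₁, hp, ?_⟩
      filter_upwards [hci.continuousAt.eventually_lt_const hpm] with x hx _
      simp [hx]
    · refine ⟨_, U₂, hw₂.const_mul hene, hp, ?_⟩
      filter_upwards [hci.continuousAt.eventually_const_lt hpm] with x hx _
      simp [hx.not_gt]
    · refine ⟨w₁, U₁, hw₁, hp₁, ?_⟩
      filter_upwards [hpO, hw₂.isOpen.mem_nhds hp₂] with x hx hx₂ hxX
      split_ifs
      · rfl
      · exact (SignType.eq_mul_of_mul_eq (hw₂.ne_zero x hx₂ hxX) (hx hxX)).symm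
  · intro x hx
    rcases lt_trichotomy (x i) m with h | h | h
    · exact Or.inl (Or.inl ⟨hbox₁ x hx h.le, h⟩)
    · exact Or.inr ⟨hKU x ⟨hx, h⟩, he' x ⟨hx, h⟩⟩
    · exact Or.inl (Or.inr ⟨hbox₂ x hx h.le, h⟩)

/-- A property of intervals that holds for small intervals and is compatible with gluing holds for
all intervals. -/
lemma interval_induction {Q : ℝ → ℝ → Prop} (hloc : ∀ t, ∃ ε > 0, Q (t - ε) (t + ε))
    (hmono : ∀ s s' t' t, s ≤ s' → t' ≤ t → Q s t → Q s' t')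
    (hglue : ∀ s m t, s ≤ m → m ≤ t → Q s m → Q m t → Q s t) {s t : ℝ} (hst : s ≤ t) : Q s t := by
  -- Replacing `t` by `max s t` makes the condition meaningful on the whole line, which is
  -- connected.
  let A : Set ℝ := {t | Q s (max s t)}
  have key : ∀ t, (∀ᶠ t' in 𝓝 t, (t' ∈ A ↔ t ∈ A)) := by
    intro t
    obtain ⟨ε, hε, hQ⟩ := hloc (max s t)
    have hc : Continuous fun t' => max s t' := by fun_prop
    filter_upwards [hc.continuousAt.preimage_mem_nhds (Icc_mem_nhds
      (show max s t - ε < max s t by linarith) (show max s t < max s t + ε by linarith))] with t' ht'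
    have step : ∀ u v, s ≤ u → max s t - ε ≤ u → u ≤ max s t + ε → max s t - ε ≤ v →
        v ≤ max s t + ε → Q s u → Q s v := by
      intro u v hsu hu hu' hv hv' h
      rcases le_total v u with huv | huv
      · exact hmono _ _ _ _ le_rfl huv h
      · exact hglue s u v hsu huv h (hmono _ _ _ _ hu hv' hQ)
    exact ⟨step _ _ (le_max_left _ _) ht'.1 ht'.2 (by linarith) (by linarith),
      step _ _ (le_max_left _ _) (by linarith) (by linarith) ht'.1 ht'.2⟩
  have hA : IsClopen A := by
    constructor
    · rw [← isOpen_compl_iff, isOpen_iff_mem_nhds]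
      intro x hx
      filter_upwards [key x] with y hy
      exact fun h => hx (hy.1 h)
    · rw [isOpen_iff_mem_nhds]
      intro x hx
      filter_upwards [key x] with y hy
      exact hy.2 hx
  have hs : s ∈ A := by
    obtain ⟨ε, hε, hQ⟩ := hloc s
    exact hmono _ _ _ _ (by linarith) (by simpa using hε.le) hQ
  have := eq_univ_iff_forall.1 (hA.eq_univ ⟨s, hs⟩) t
  simpa [A, max_eq_right hst] using this

/-- Induction on the number `k` of directions in which the box may have positive length. A point is
coloured by its chart. A slice orthogonal to the next direction is coloured on a neighbourhood,
hence by compactness on a thin slab; `interval_induction` glues the slabs. -/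
lemma boxColorable_of_planesCharts {X : Set E3} (hXc : IsClosed X)
    (hX : ∀ p, ∃ h I, p ∈ h.source ∧ IsPlanesChart X h I) (k : ℕ) :
    ∀ a b : Fin 3 → ℝ, a ≤ b → (∀ i : Fin 3, k ≤ i → a i = b i) → BoxColorable X a b := by
  induction k with
  | zero =>
    intro a b _ hab
    obtain ⟨h, I, hp, hc⟩ := hX (WithLp.toLp 2 a)
    refine ⟨_, _, hc.isColoring, fun x hx => ?_⟩
    have : x = WithLp.toLp 2 a := by
      ext i
      exact le_antisymm ((hx i).2.trans (hab i (Nat.zero_le _)).ge) (hx i).1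
    rwa [this]
  | succ k ih =>
    intro a b hle hab
    by_cases hk : k < 3
    swap
    · exact ih a b hle fun i hi => by have := i.2; omega
    set i₀ : Fin 3 := ⟨k, hk⟩ with hi₀
    have hQ := interval_induction
      (Q := fun s t => BoxColorable X (Function.update a i₀ s) (Function.update b i₀ t))
      ?_ ?_ ?_ (hle i₀)
    · simpa using hQ
    · intro t
      obtain ⟨w, U, hw, hU⟩ := ih (Function.update a i₀ t) (Function.update b i₀ t)
        (update_le_update_iff.2 ⟨le_rfl, fun j _ => hle j⟩) (fun i hi => by
          by_cases h : i = i₀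
          · subst h; simp
          · have : (i : ℕ) ≠ k := fun e => h (Fin.ext e)
            simpa [h] using hab i (by omega))
      obtain ⟨δ, hδ, hsub⟩ := (isCompact_box _ _).exists_thickening_subset_open hw.isOpen hU
      refine ⟨δ / 4, by positivity, w, U, hw, fun x hx => hsub ?_⟩
      rw [mem_thickening_iff]
      refine ⟨WithLp.toLp 2 (Function.update x i₀ t), fun j => ?_, ?_⟩
      · have := hx j
        by_cases h : j = i₀
        · subst h; simp
        · simpa [h] using this
      · rw [dist_eq_norm]
        refine (norm_le_two_mul (c := δ / 4) (by positivity) fun j => ?_).trans_lt (by linarith)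
        by_cases h : j = i₀
        · have h1 := hx j
          subst h
          simp only [Function.update_self] at h1
          simp only [PiLp.sub_apply, Function.update_self]
          rw [abs_le]; constructor <;> linarith
        · simpa [h] using (by positivity : 0 ≤ δ / 4)
    · intro s s' t' t hs ht h
      exact h.mono (update_le_update_iff.2 ⟨hs, fun _ _ => le_rfl⟩)
        (update_le_update_iff.2 ⟨ht, fun _ _ => le_rfl⟩)
    · intro s m t hsm hmt h₁ h₂
      refine BoxColorable.glue hXc hX (i := i₀) (m := m)
        (update_le_update_iff.2 ⟨hsm.trans hmt, fun j _ => hle j⟩) (by simpa using hsm)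
        (by simpa using hmt) ?_ ?_
      · simpa using h₁
      · simpa using h₂

/-- The complement of a compact set that is locally a union of coordinate planes can be coloured
near this set. -/
lemma exists_isColoring {X : Set E3} (hXc : IsCompact X)
    (hX : ∀ p ∈ X, ∃ h I, p ∈ h.source ∧ IsPlanesChart X h I) :
    ∃ w U, IsColoring X w U ∧ X ⊆ U := by
  have hX' : ∀ p, ∃ h I, p ∈ h.source ∧ IsPlanesChart X h I := by
    intro p
    by_cases hp : p ∈ X
    · exact hX p hp
    -- Off `X` the empty set of planes describes the complement.
    · refine ⟨(OpenPartialHomeomorph.refl E3).restr Xᶜ, ∅, ?_, fun x hx => ?_⟩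
      · simpa [hXc.isClosed.isOpen_compl.interior_eq] using hp
      · have : x ∉ X := by simpa [hXc.isClosed.isOpen_compl.interior_eq] using hx
        simp [this]
  obtain ⟨R, hR⟩ := hXc.isBounded.subset_closedBall (0 : E3)
  -- The absolute value orders the corners also when `R` is negative.
  obtain ⟨w, U, hw, hU⟩ := boxColorable_of_planesCharts hXc.isClosed hX' 3 (fun _ => -|R|)
    (fun _ => |R|) (fun _ => by simp) (fun i hi => by have := i.2; omega)
  refine ⟨w, U, hw, fun x hx => hU fun i => abs_le.1 ?_⟩
  have := hR hx
  rw [mem_closedBall, dist_zero_right] at this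
  exact (abs_coord_le_norm x i).trans (this.trans (le_abs_self R))

/-! ### Extending coorientations; the sheets of the immersion -/

section Surface

variable {S : Type*} [TopologicalSpace S] {φ : S → E3}

/-- A coorientation over a compact set extends to a neighbourhood. -/
lemma IsCoorientation.exists_extension [T2Space S] [LocallyCompactSpace S] {σ : S → Set E3}
    {C : Set S} (hσ : IsCoorientation φ σ C) (hφ : Continuous φ) (hC : IsCompact C) :
    ∃ U σ', IsOpen U ∧ C ⊆ U ∧ IsCoorientation φ σ' U := by
  have : Nonempty (OpenPartialHomeomorph E3 E3) := ⟨.refl E3⟩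
  choose! V h j hmem hV using hσ
  have hK : ∀ c ∈ C, ∃ K : Set S, IsCompact K ∧ c ∈ interior K ∧ K ⊆ V c := fun c hc =>
    exists_compact_subset (hV c hc).isOpen (hmem c hc)
  choose! K hKc hcK hKV using hK
  obtain ⟨t, ht, hCt⟩ := hC.elim_nhds_subcover (fun c => interior (K c))
    fun c hc => isOpen_interior.mem_nhds (hcK c hc)
  let agree : S → S → Set S := fun c c' =>
    {s | ∀ᶠ x in 𝓝 (φ s), (0 < h c x (j c) ↔ 0 < h c' x (j c'))}
  have hagree : ∀ c c', IsOpen (agree c c') := fun c c' => by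
    have : IsOpen {p | ∀ᶠ x in 𝓝 p, (0 < h c x (j c) ↔ 0 < h c' x (j c'))} :=
      isOpen_iff_mem_nhds.2 fun y hy => eventually_eventually_nhds.2 hy
    exact this.preimage hφ
  -- The bad set, where two of the finitely many charts disagree about the sides. It is closed, and
  -- it misses `C`, where `σ` dictates the side in every chart. Off it, any choice of chart defines
  -- the same germ of a side.
  let Z : Set S := ⋃ c ∈ t, ⋃ c' ∈ t, (K c ∩ K c') \ agree c c'
  have hZ : IsClosed Z := isClosed_biUnion_finset fun c hc => isClosed_biUnion_finset fun c' hc' =>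
    ((hKc _ (ht c hc)).isClosed.inter (hKc _ (ht c' hc')).isClosed).inter (hagree c c').isClosed_compl
  let W : Set S := (⋃ c ∈ t, interior (K c)) \ Z
  have hWt : ∀ s ∈ W, ∃ c ∈ t, s ∈ interior (K c) := fun s hs => by
    simpa using hs.1
  have hagr : ∀ s ∈ W, ∀ c ∈ t, ∀ c' ∈ t, s ∈ K c → s ∈ K c' →
      s ∈ agree c c' := by
    intro s hs c hc c' hc' h1 h2
    by_contra hn
    exact hs.2 (mem_biUnion hc (mem_biUnion hc' ⟨⟨h1, h2⟩, hn⟩))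
  choose! f hft hfK using hWt
  refine ⟨W, fun s => {x | 0 < h (f s) x (j (f s))},
    (isOpen_biUnion fun c _ => isOpen_interior).inter hZ.isOpen_compl, fun s hs => ⟨hCt hs, ?_⟩,
    fun s hs => ?_⟩
  · simp only [Z, mem_iUnion, not_exists]
    rintro c hc c' hc' ⟨⟨h1, h2⟩, h3⟩
    refine h3 ?_
    filter_upwards [(hV c (ht c hc)).side s ⟨hKV _ (ht c hc) h1, hs⟩,
      (hV c' (ht c' hc')).side s ⟨hKV _ (ht c' hc') h2, hs⟩] with x h4 h5
    exact h4.symm.trans h5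
  · set c := f s with hc
    have hVc := hV c (ht c (hft s hs))
    have hsub : interior (K c) ⊆ V c := interior_subset.trans (hKV c (ht c (hft s hs)))
    refine ⟨interior (K c), h c, j c, hfK s hs, isOpen_interior, hVc.injOn.mono hsub,
      fun s hs => hVc.mem_source s (hsub hs), fun s hs => hVc.coord_eq_zero s (hsub hs), ?_⟩
    rintro s' ⟨hs', hs'W⟩
    exact hagr s' hs'W _ (hft s' hs'W) c (hft s hs) (interior_subset (hfK s' hs'W))
      (interior_subset hs')

/-- A coorientation can be extended over a finite set of points in the presence of suitable
charts. -/
lemma exists_isCoorientation_of_diff_finite [T1Space S] {σ : S → Set E3} {C P : Set S}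
    (hP : P.Finite) (hC : ∀ s ∈ C, ∃ V h j, s ∈ V ∧ IsCoorientedChart φ σ (C \ P) V h j) :
    ∃ σ', IsCoorientation φ σ' C := by
  classical
  have : Nonempty (OpenPartialHomeomorph E3 E3) := ⟨.refl E3⟩
  choose! V h j hmem hV using hC
  refine ⟨fun s => if s ∈ P then {x | 0 < h s x (j s)} else σ s, fun s hs => ?_⟩
  have hVs := hV s hs
  -- Removing the other points of `P` leaves `s` as the only possible exceptional point of its
  -- chart, and there the side is taken from that chart itself.
  refine ⟨V s \ (P \ {s}), h s, j s, ⟨hmem s hs, fun hc => hc.2 rfl⟩,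
    hVs.isOpen.inter (hP.subset sdiff_subset).isClosed.isOpen_compl, hVs.injOn.mono sdiff_subset,
    fun s' hs' => hVs.mem_source s' hs'.1, fun s' hs' => hVs.coord_eq_zero s' hs'.1, ?_⟩
  rintro s' ⟨⟨hs', hs'P⟩, hs'C⟩
  by_cases hp : s' ∈ P
  · have : s' = s := by
      by_contra hne
      exact hs'P ⟨hp, hne⟩
    subst this
    simp [hp]
  · simpa [hp] using hVs.side s' ⟨hs', hs'C, hp⟩

/-- The local structure of a general position immersion in a chart: the data of
`IsCoordinatePlanesAt`, without the centring. -/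
structure IsSheetedChart (φ : S → E3) {k : ℕ} (hk : k ≤ 3) (h : OpenPartialHomeomorph E3 E3)
    (V : Fin k → Set S) : Prop where
  isOpen : ∀ i, IsOpen (V i)
  disjoint : ∀ i j, i ≠ j → Disjoint (V i) (V j)
  preimage : φ ⁻¹' h.source = ⋃ i, V i
  injOn : ∀ i, InjOn φ (V i)
  image : ∀ i, h '' (φ '' V i) = {x | x ∈ h.target ∧ x (Fin.castLE hk i) = 0}

variable {k : ℕ} {hk : k ≤ 3} {h : OpenPartialHomeomorph E3 E3} {V : Fin k → Set S}

lemma IsSheetedChart.mem_source (H : IsSheetedChart φ hk h V) {i : Fin k} {s : S} (hs : s ∈ V i) :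
    φ s ∈ h.source := by
  have : s ∈ φ ⁻¹' h.source := H.preimage ▸ mem_iUnion_of_mem i hs
  exact this

lemma IsSheetedChart.coord_eq_zero (H : IsSheetedChart φ hk h V) {i : Fin k} {s : S}
    (hs : s ∈ V i) : h (φ s) (Fin.castLE hk i) = 0 := by
  have : h (φ s) ∈ h '' (φ '' V i) := mem_image_of_mem _ (mem_image_of_mem _ hs)
  rw [H.image i] at this
  exact this.2

lemma IsSheetedChart.exists_mem (H : IsSheetedChart φ hk h V) {i : Fin k} {x : E3}
    (hx : x ∈ h.source) (hxi : h x (Fin.castLE hk i) = 0) : ∃ s ∈ V i, φ s = x := by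
  have : h x ∈ h '' (φ '' V i) := by
    rw [H.image i]
    exact ⟨h.map_source hx, hxi⟩
  obtain ⟨_, ⟨s, hs, rfl⟩, e⟩ := this
  exact ⟨s, hs, h.injOn (H.mem_source hs) hx e⟩

lemma IsSheetedChart.exists_sheet (H : IsSheetedChart φ hk h V) {s : S} (hs : φ s ∈ h.source) :
    ∃ i, s ∈ V i := by
  have : s ∈ φ ⁻¹' h.source := hs
  rw [H.preimage] at this
  simpa using this

/-- The set of indices of the coordinate planes in a chart with `k` sheets. -/
def sheetIndices {k : ℕ} (hk : k ≤ 3) : Finset (Fin 3) := Finset.univ.image (Fin.castLE hk)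

lemma IsSheetedChart.isPlanesChart (H : IsSheetedChart φ hk h V) :
    IsPlanesChart (range φ) h (sheetIndices hk) := by
  intro x hx
  simp only [sheetIndices, Finset.mem_image, Finset.mem_univ, true_and, exists_exists_eq_and]
  constructor
  · rintro ⟨s, rfl⟩
    obtain ⟨i, hi⟩ := H.exists_sheet hx
    exact ⟨i, H.coord_eq_zero hi⟩
  · rintro ⟨i, hi⟩
    obtain ⟨s, -, e⟩ := H.exists_mem hx hi
    exact ⟨s, e⟩

lemma IsSheetedChart.mem_singularSet_iff (H : IsSheetedChart φ hk h V) {i : Fin k} {s : S}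
    (hs : s ∈ V i) : s ∈ singularSet φ ↔ ∃ i', i' ≠ i ∧ h (φ s) (Fin.castLE hk i') = 0 := by
  constructor
  · rintro hd
    obtain ⟨y, hy, hys⟩ := hd.exists_ne s
    have hy : φ y = φ s := hy
    obtain ⟨i', hi'⟩ := H.exists_sheet (s := y) (hy ▸ H.mem_source hs)
    refine ⟨i', ?_, hy ▸ H.coord_eq_zero hi'⟩
    rintro rfl
    exact hys (H.injOn i' hi' hs hy)
  · rintro ⟨i', hne, h0⟩
    obtain ⟨y, hy, e⟩ := H.exists_mem (H.mem_source hs) h0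
    refine ⟨y, e, s, rfl, ?_⟩
    rintro rfl
    exact (H.disjoint i' i hne).le_bot ⟨hy, hs⟩

/-- In a chart centred at `p` every sheet passes through `p`, once each. This excludes `k = 3` away
from triple points. -/
lemma IsSheetedChart.encard_preimage (H : IsSheetedChart φ hk h V) {p : E3} (hp : p ∈ h.source)
    (hp0 : h p = 0) : (φ ⁻¹' {p}).encard = k := by
  have hex : ∀ i : Fin k, ∃ s ∈ V i, φ s = p := fun i => H.exists_mem hp (by simp [hp0])
  choose y hyV hyp using hex
  have hinj : Function.Injective y := by
    intro i i' e
    by_contra hne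
    exact (H.disjoint i i' hne).le_bot ⟨hyV i, e ▸ hyV i'⟩
  have hrange : φ ⁻¹' {p} = y '' univ := by
    ext s
    constructor
    · intro hs
      have hs : φ s = p := hs
      obtain ⟨i, hi⟩ := H.exists_sheet (s := s) (hs ▸ hp)
      exact ⟨i, trivial, H.injOn i (hyV i) hi ((hyp i).trans hs.symm)⟩
    · rintro ⟨i, -, rfl⟩
      exact hyp i
  rw [hrange, hinj.encard_image]
  simp

/-- Near a point of a sheet, the whole coordinate plane belongs to the sheet. -/
lemma IsSheetedChart.eventually_mem_image [CompactSpace S] (H : IsSheetedChart φ hk h V)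
    (hφ : Continuous φ) {i : Fin k} {s : S} (hs : s ∈ V i) {N : Set S} (hN : N ∈ 𝓝 s) :
    ∀ᶠ x in 𝓝 (φ s), h x (Fin.castLE hk i) = 0 → x ∈ φ '' N := by
  -- The complement of `O` is compact, and its image misses `φ s`: any other preimage of `φ s` lies
  -- on another sheet. So near `φ s` only points of `N` and of the other sheets are hit.
  let O : Set S := interior N ∪ ⋃ i' ∈ {i' | i' ≠ i}, V i'
  have hO : IsOpen O := isOpen_interior.union (isOpen_biUnion fun i' _ => H.isOpen i')
  have hK : IsCompact (φ '' Oᶜ) := hO.isClosed_compl.isCompact.image hφ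
  have hnot : φ s ∉ φ '' Oᶜ := by
    rintro ⟨y, hy, e⟩
    obtain ⟨i', hi'⟩ := H.exists_sheet (s := y) (e ▸ H.mem_source hs)
    by_cases hii : i' = i
    · subst hii
      have := H.injOn i' hi' hs e
      subst this
      exact hy (Or.inl (mem_interior_iff_mem_nhds.2 hN))
    · exact hy (Or.inr (mem_biUnion hii hi'))
  filter_upwards [hK.isClosed.isOpen_compl.mem_nhds hnot,
    h.open_source.mem_nhds (H.mem_source hs)] with x hx hxs hx0
  obtain ⟨y, hy, rfl⟩ := H.exists_mem hxs hx0
  have hyO : y ∈ O := by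
    by_contra hn
    exact hx (mem_image_of_mem φ hn)
  rcases hyO with hyN | hyO
  · exact mem_image_of_mem φ (interior_subset hyN)
  · obtain ⟨i', hi', hyV⟩ := mem_iUnion₂.1 hyO
    exact absurd ⟨hyV, hy⟩ (fun hc => (H.disjoint i' i hi').le_bot hc)

end Surface

/-! ### Sign changes at a crossing -/

lemma sign_eq_of_isPreconnected {E : Type*} [TopologicalSpace E] {K : Set E} {G : E → ℝ}
    (hK : IsPreconnected K) (hG : ContinuousOn G K) (h0 : ∀ y ∈ K, G y ≠ 0) {a b : E} (ha : a ∈ K)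
    (hb : b ∈ K) : SignType.sign (G a) = SignType.sign (G b) := by
  rcases lt_or_gt_of_ne (h0 a ha) with h1 | h1 <;> rcases lt_or_gt_of_ne (h0 b hb) with h2 | h2
  · rw [sign_neg h1, sign_neg h2]
  · obtain ⟨y, hy, e⟩ := hK.intermediate_value ha hb hG ⟨h1.le, h2.le⟩
    exact absurd e (h0 y hy)
  · obtain ⟨y, hy, e⟩ := hK.intermediate_value hb ha hG ⟨h2.le, h1.le⟩
    exact absurd e (h0 y hy)
  · rw [sign_pos h1, sign_pos h2]

/-- A function on a disc that vanishes precisely on the horizontal axis and takes values of both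
signs changes its sign across the axis. -/
lemma exists_sign_eq_mul_sign_coord {G : E2 → ℝ} {ρ : ℝ}
    (hG : ContinuousOn G (ball 0 ρ)) (h0 : ∀ y ∈ ball (0 : E2) ρ, G y = 0 ↔ y 1 = 0)
    (hpos : ∃ y ∈ ball (0 : E2) ρ, 0 < G y) (hneg : ∃ y ∈ ball (0 : E2) ρ, G y < 0) :
    ∃ c ≠ 0, ∀ y ∈ ball (0 : E2) ρ, SignType.sign (G y) = c * SignType.sign (y 1) := by
  have hlin : IsLinearMap ℝ fun z : E2 => z 1 :=
    (EuclideanSpace.proj (1 : Fin 2) : E2 →L[ℝ] ℝ).isLinear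
  have up : ∀ a ∈ ball (0 : E2) ρ ∩ {z | 0 < z 1}, ∀ b ∈ ball (0 : E2) ρ ∩ {z | 0 < z 1},
      SignType.sign (G a) = SignType.sign (G b) := fun a ha b hb =>
    sign_eq_of_isPreconnected ((convex_ball 0 ρ).inter (convex_halfSpace_gt hlin 0)).isPreconnected
      (hG.mono inter_subset_left) (fun y hy e => (ne_of_gt hy.2) ((h0 y hy.1).1 e)) ha hb
  have down : ∀ a ∈ ball (0 : E2) ρ ∩ {z | z 1 < 0}, ∀ b ∈ ball (0 : E2) ρ ∩ {z | z 1 < 0},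
      SignType.sign (G a) = SignType.sign (G b) := fun a ha b hb =>
    sign_eq_of_isPreconnected ((convex_ball 0 ρ).inter (convex_halfSpace_lt hlin 0)).isPreconnected
      (hG.mono inter_subset_left) (fun y hy e => (ne_of_lt hy.2) ((h0 y hy.1).1 e)) ha hb
  obtain ⟨y, hy, hGy⟩ := hpos
  obtain ⟨z, hz, hGz⟩ := hneg
  have hy0 : y 1 ≠ 0 := fun e => hGy.ne' ((h0 y hy).2 e)
  have hz0 : z 1 ≠ 0 := fun e => hGz.ne ((h0 z hz).2 e)
  have zero : ∀ (c : SignType), ∀ x ∈ ball (0 : E2) ρ, x 1 = 0 →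
      SignType.sign (G x) = c * SignType.sign (x 1) := fun c x hx e => by
    rw [(h0 x hx).2 e, e]; simp
  rcases lt_or_gt_of_ne hy0 with h1 | h1 <;> rcases lt_or_gt_of_ne hz0 with h2 | h2
  · have := down y ⟨hy, h1⟩ z ⟨hz, h2⟩
    rw [sign_pos hGy, sign_neg hGz] at this
    exact absurd this (by decide)
  · refine ⟨-1, by decide, fun x hx => ?_⟩
    rcases lt_trichotomy (x 1) 0 with h | h | h
    · rw [down x ⟨hx, h⟩ y ⟨hy, h1⟩, sign_pos hGy, sign_neg h]; rfl
    · exact zero _ x hx h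
    · rw [up x ⟨hx, h⟩ z ⟨hz, h2⟩, sign_neg hGz, sign_pos h]; rfl
  · refine ⟨1, by decide, fun x hx => ?_⟩
    rcases lt_trichotomy (x 1) 0 with h | h | h
    · rw [down x ⟨hx, h⟩ z ⟨hz, h2⟩, sign_neg hGz, sign_neg h]; rfl
    · exact zero _ x hx h
    · rw [up x ⟨hx, h⟩ y ⟨hy, h1⟩, sign_pos hGy, sign_pos h]; rfl
  · have := up y ⟨hy, h1⟩ z ⟨hz, h2⟩
    rw [sign_pos hGy, sign_neg hGz] at this
    exact absurd this (by decide)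

/-- An injective continuous function on an interval changes its sign at an inner zero. -/
lemma exists_sign_eq_mul_sign_sub {b : ℝ → ℝ} {θ₀ δ : ℝ} (hδ : 0 < δ)
    (hb : ContinuousOn b (Icc (θ₀ - δ) (θ₀ + δ))) (hi : InjOn b (Icc (θ₀ - δ) (θ₀ + δ)))
    (h0 : b θ₀ = 0) :
    ∃ c ≠ 0, ∀ᶠ θ in 𝓝 θ₀, SignType.sign (b θ) = c * SignType.sign (θ - θ₀) := by
  have hm : θ₀ ∈ Icc (θ₀ - δ) (θ₀ + δ) := ⟨by linarith, by linarith⟩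
  have hn : Icc (θ₀ - δ) (θ₀ + δ) ∈ 𝓝 θ₀ := Icc_mem_nhds (by linarith) (by linarith)
  rcases hb.strictMonoOn_of_injOn_Icc' (by linarith) hi with h | h
  · refine ⟨1, by decide, ?_⟩
    filter_upwards [hn] with θ hθ
    rw [one_mul]
    rcases lt_trichotomy θ θ₀ with hlt | rfl | hgt
    · rw [sign_neg (h0 ▸ h hθ hm hlt), sign_neg (sub_neg.2 hlt)]
    · simp [h0]
    · rw [sign_pos (h0 ▸ h hm hθ hgt), sign_pos (sub_pos.2 hgt)]
  · refine ⟨-1, by decide, ?_⟩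
    filter_upwards [hn] with θ hθ
    rcases lt_trichotomy θ θ₀ with hlt | rfl | hgt
    · rw [sign_pos (h0 ▸ h hθ hm hlt), sign_neg (sub_neg.2 hlt)]; rfl
    · simp [h0]
    · rw [sign_neg (h0 ▸ h hm hθ hgt), sign_pos (sub_pos.2 hgt)]; rfl

section Crossing

variable {S : Type*} [TopologicalSpace S] {φ : S → E3} {k : ℕ} {hk : k ≤ 3}
  {h : OpenPartialHomeomorph E3 E3} {V : Fin k → Set S}

/-- At a crossing of two sheets, the coordinate that vanishes on the second sheet changes its sign
on the first sheet when the singular set is crossed. -/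
lemma IsSheetedChart.exists_sign_eq [CompactSpace S] (H : IsSheetedChart φ hk h V)
    (hφ : Continuous φ) {i i' : Fin k} (hi' : ∀ l, l ≠ i ↔ l = i') {s₀ : S} (hs₀ : s₀ ∈ V i)
    (h0 : h (φ s₀) = 0) {e : OpenPartialHomeomorph S E2} (hes : s₀ ∈ e.source) (he0 : e s₀ = 0)
    (he : ∀ x ∈ e.source, x ∈ singularSet φ ↔ e x 1 = 0) :
    ∃ c ≠ 0, ∀ᶠ s in 𝓝 s₀,
      SignType.sign (h (φ s) (Fin.castLE hk i')) = c * SignType.sign (e s 1) := by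
  have hV : ∀ᶠ y in 𝓝 (0 : E2), y ∈ e.target ∧ e.symm y ∈ V i := by
    have h1 := e.continuousAt_symm (e.map_source hes)
    rw [ContinuousAt, e.left_inv hes] at h1
    rw [← he0]
    exact (e.open_target.eventually_mem (e.map_source hes)).and
      (h1.eventually ((H.isOpen i).eventually_mem hs₀))
  obtain ⟨ρ, hρ, hB⟩ := Metric.mem_nhds_iff.1 hV
  have hzero : ∀ s ∈ V i, s ∈ singularSet φ ↔ h (φ s) (Fin.castLE hk i') = 0 := by
    intro s hs
    rw [H.mem_singularSet_iff hs]
    simp [hi']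
  let G : E2 → ℝ := fun y => h (φ (e.symm y)) (Fin.castLE hk i')
  have hG : ContinuousOn G (ball 0 ρ) := by
    intro y hy
    have h1 : ContinuousAt (fun y => φ (e.symm y)) y :=
      hφ.continuousAt.comp (e.continuousAt_symm (hB hy).1)
    have h2 : ContinuousAt (fun y => h (φ (e.symm y))) y :=
      ContinuousAt.comp (x := y) (g := h) (h.continuousAt (H.mem_source (hB hy).2)) h1
    have h3 : Continuous fun z : E3 => z (Fin.castLE hk i') := by fun_prop
    exact (h3.continuousAt.comp h2).continuousWithinAt
  have hG0 : ∀ y ∈ ball (0 : E2) ρ, G y = 0 ↔ y 1 = 0 := by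
    intro y hy
    rw [← hzero _ (hB hy).2, he _ (e.map_target (hB hy).1), e.right_inv (hB hy).1]
  have hN : e.source ∩ e ⁻¹' ball 0 ρ ∈ 𝓝 s₀ :=
    inter_mem (e.open_source.mem_nhds hes)
      ((e.continuousAt hes).preimage_mem_nhds (by rw [he0]; exact ball_mem_nhds _ hρ))
  have hne : Fin.castLE hk i' ≠ Fin.castLE hk i := fun e =>
    (hi' i').2 rfl (Fin.castLE_injective hk e)
  have hp := H.mem_source hs₀
  -- The axis in direction `i'` lies in the plane of sheet `i`, so nearby points of it are images of
  -- points of the sheet. Along it the coordinate `i'` takes every small value, hence `G` takes both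
  -- signs.
  have hline : ∀ᶠ t in 𝓝 (0 : ℝ), ∃ y ∈ ball (0 : E2) ρ, G y = t := by
    have hc : Continuous fun t : ℝ => t • (EuclideanSpace.single (Fin.castLE hk i') 1 : E3) := by
      fun_prop
    have hc0 : ContinuousAt
        (fun t : ℝ => t • (EuclideanSpace.single (Fin.castLE hk i') 1 : E3)) 0 := hc.continuousAt
    have ht0 : (0 : ℝ) • (EuclideanSpace.single (Fin.castLE hk i') 1 : E3) = h (φ s₀) := by
      rw [h0, zero_smul]
    have h1 := h.continuousAt_symm (h.map_source hp)
    rw [ContinuousAt, h.left_inv hp, ← ht0] at h1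
    have h2 := hc0.eventually (h1.eventually (H.eventually_mem_image hφ hs₀ hN))
    have h3 := hc0.eventually (h.open_target.eventually_mem (by
      have h4 := h.map_source hp
      rwa [← ht0] at h4))
    filter_upwards [h2, h3] with t h2 h3
    rw [h.right_inv h3] at h2
    obtain ⟨s, ⟨hse, hsb⟩, e2⟩ := h2 (by simp [hne.symm])
    refine ⟨e s, hsb, ?_⟩
    simp only [G, e.left_inv hse, e2, h.right_inv h3]
    simp
  obtain ⟨c, hc, hcG⟩ := exists_sign_eq_mul_sign_coord hG hG0 (by
      obtain ⟨t, ht, ht0⟩ := ((hline.filter_mono (nhdsWithin_le_nhds (s := Ioi 0))).and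
        self_mem_nhdsWithin).exists
      obtain ⟨y, hy, e⟩ := ht
      exact ⟨y, hy, e ▸ ht0⟩) (by
      obtain ⟨t, ht, ht0⟩ := ((hline.filter_mono (nhdsWithin_le_nhds (s := Iio 0))).and
        self_mem_nhdsWithin).exists
      obtain ⟨y, hy, e⟩ := ht
      exact ⟨y, hy, e ▸ ht0⟩)
  refine ⟨c, hc, ?_⟩
  filter_upwards [hN] with s hs
  have := hcG (e s) hs.2
  simpa only [G, e.left_inv hs.1] using this

end Crossing

/-! ### A function on the circle with prescribed sign changes -/

section Winding

open Real

variable {S : Type*}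

/-- A product of half-angle sines with simple zeros at the angles `Θ s`, `s ∈ P`. -/
noncomputable def sinProd (P : Finset S) (Θ : S → ℝ) (θ : ℝ) : ℝ := ∏ s ∈ P, sin ((θ - Θ s) / 2)

variable {P : Finset S} {Θ : S → ℝ} {g : ℝ → S}

/-- Parity enters here: each factor changes its sign under a full turn, and an even number of
factors leaves the product unchanged. -/
lemma sinProd_add_int_mul (hP : Even P.card) (θ : ℝ) (m : ℤ) :
    sinProd P Θ (θ + m * (2 * π)) = sinProd P Θ θ := by
  unfold sinProd
  have : ∀ s ∈ P, sin ((θ + m * (2 * π) - Θ s) / 2) = (-1) ^ m * sin ((θ - Θ s) / 2) := by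
    intro s _
    rw [← sin_add_int_mul_pi]
    congr 1; ring
  rw [Finset.prod_congr rfl this, Finset.prod_mul_distrib, Finset.prod_const]
  obtain ⟨r, hr⟩ := hP
  rw [hr, ← two_mul, pow_mul, ← zpow_natCast ((-1 : ℝ) ^ m) 2, ← zpow_mul, mul_comm m, zpow_mul]
  norm_num

lemma sin_half_eq_zero_iff {g : ℝ → S} (hg : ∀ θ θ', g θ = g θ' ↔ ∃ m : ℤ, θ = θ' + m * (2 * π))
    {θ θ' : ℝ} : sin ((θ - θ') / 2) = 0 ↔ g θ = g θ' := by
  rw [sin_eq_zero_iff, hg]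
  refine exists_congr fun m => ⟨fun h => by linarith, fun h => by linarith⟩

lemma sinProd_ne_zero (hg : ∀ θ θ', g θ = g θ' ↔ ∃ m : ℤ, θ = θ' + m * (2 * π))
    (hΘ : ∀ s ∈ P, g (Θ s) = s) {θ : ℝ} (hθ : g θ ∉ P) : sinProd P Θ θ ≠ 0 := by
  refine Finset.prod_ne_zero_iff.2 fun s hs e => hθ ?_
  rw [(sin_half_eq_zero_iff hg).1 e, hΘ s hs]
  exact hs

lemma continuous_sinProd : Continuous (sinProd P Θ) := by
  unfold sinProd
  fun_prop

/-- Among the factors only the one belonging to `g θ₀` vanishes at `θ₀`, and it is monotone there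
because half-angles within `1 / 2` of a zero stay in a branch where the sine is injective. -/
lemma exists_sign_sinProd [DecidableEq S]
    (hg : ∀ θ θ', g θ = g θ' ↔ ∃ m : ℤ, θ = θ' + m * (2 * π))
    (hΘ : ∀ s ∈ P, g (Θ s) = s) {θ₀ : ℝ} (hθ : g θ₀ ∈ P) :
    ∃ c ≠ 0, ∀ᶠ θ in 𝓝 θ₀, SignType.sign (sinProd P Θ θ) = c * SignType.sign (θ - θ₀) := by
  have hrest : sinProd (P.erase (g θ₀)) Θ θ₀ ≠ 0 :=
    sinProd_ne_zero hg (fun s hs => hΘ s (Finset.mem_of_mem_erase hs)) (Finset.notMem_erase _ _)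
  obtain ⟨c, hc, hcs⟩ := exists_sign_eq_mul_sign_sub (b := fun θ => sin ((θ - Θ (g θ₀)) / 2))
    (θ₀ := θ₀) (δ := 1) one_pos (by fun_prop) (by
      obtain ⟨m, hm⟩ := (hg θ₀ (Θ (g θ₀))).1 (hΘ _ hθ).symm
      have e : ∀ θ, sin ((θ - Θ (g θ₀)) / 2) = (-1) ^ m * sin ((θ - θ₀) / 2) := by
        intro θ
        rw [← sin_add_int_mul_pi]
        congr 1
        linarith
      intro a ha b hb hab
      simp only [e] at hab
      have h1 := mul_left_cancel₀ (zpow_ne_zero m (by norm_num : (-1 : ℝ) ≠ 0)) hab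
      have hmem : ∀ x ∈ Icc (θ₀ - 1) (θ₀ + 1), (x - θ₀) / 2 ∈ Icc (-(π / 2)) (π / 2) :=
        fun x hx => ⟨by linarith [hx.1, pi_gt_three], by linarith [hx.2, pi_gt_three]⟩
      have h2 := injOn_sin (hmem a ha) (hmem b hb) h1
      linarith) ((sin_half_eq_zero_iff hg).2 (hΘ _ hθ).symm)
  refine ⟨c * SignType.sign (sinProd (P.erase (g θ₀)) Θ θ₀),
    mul_ne_zero hc (by simpa using hrest), ?_⟩
  filter_upwards [hcs, continuous_sinProd.continuousAt.eventually (eventually_sign_eq hrest)]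
    with θ h1 h2
  rw [sinProd, ← Finset.mul_prod_erase P _ hθ, sign_mul, h1]
  change _ * SignType.sign (sinProd (P.erase (g θ₀)) Θ θ) = _
  rw [h2, mul_right_comm]

end Winding

/-! ### The choice of sides along the curve, and the theorem -/

section Curve

open Real

variable {S : Type*} [TopologicalSpace S] {φ : S → E3}

/-- The angular parametrization of a simple closed curve. -/
lemma exists_angular_parametrization {γ : Circle → S} (hγ : IsEmbedding γ) :
    ∃ g : ℝ → S, Continuous g ∧ range g = range γ ∧
      (∀ θ θ', g θ = g θ' ↔ ∃ m : ℤ, θ = θ' + m * (2 * π)) ∧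
      ∀ θ₀ (R : ℝ → Prop), (∀ᶠ θ in 𝓝 θ₀, R θ) →
        ∀ᶠ s in 𝓝 (g θ₀), s ∈ range γ → ∃ θ, g θ = s ∧ R θ := by
  refine ⟨γ ∘ Circle.exp, hγ.continuous.comp Circle.exp.continuous,
    Circle.exp_surjective.range_comp γ, fun θ θ' => ?_, fun θ₀ R hR => ?_⟩
  · simp only [Function.comp_apply, hγ.injective.eq_iff]
    exact Circle.exp_eq_exp
  · have h1 : Circle.exp '' {θ | R θ} ∈ 𝓝 (Circle.exp θ₀) := by
      rw [← isLocalHomeomorph_circleExp.map_nhds_eq]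
      exact image_mem_map hR
    rw [hγ.isInducing.nhds_eq_comap] at h1
    obtain ⟨N, hN, hsub⟩ := h1
    filter_upwards [hN]
    rintro _ hs ⟨z, rfl⟩
    obtain ⟨θ, hθ, e⟩ := hsub hs
    exact ⟨θ, congrArg γ e, hθ⟩

variable {k : ℕ} {hk : k ≤ 3} {h : OpenPartialHomeomorph E3 E3} {V : Fin k → Set S}
  {P : Finset S} {Θ : S → ℝ} {g : ℝ → S}

/-- Along a curve that crosses the singular set transversally, the sign of `sinProd` compensates
for the changes of sign of the coordinates that vanish on the other sheets. -/
lemma IsSheetedChart.exists_signProd_mul_sign_sinProd [CompactSpace S]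
    (H : IsSheetedChart φ hk h V) (hφ : Continuous φ) (hgc : Continuous g)
    (hg : ∀ θ θ', g θ = g θ' ↔ ∃ m : ℤ, θ = θ' + m * (2 * π))
    (hP : ∀ s, s ∈ P ↔ s ∈ range g ∩ singularSet φ) (hΘ : ∀ s ∈ P, g (Θ s) = s)
    {i : Fin k} {θ₀ : ℝ} (hi : g θ₀ ∈ V i) (h0 : h (φ (g θ₀)) = 0)
    (htriple : φ (g θ₀) ∉ triplePoints φ)
    (htrans : g θ₀ ∈ singularSet φ → IsTransversalAt (range g) (singularSet φ) (g θ₀)) :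
    ∃ c ≠ 0, ∀ᶠ θ in 𝓝 θ₀, g θ ∉ singularSet φ →
      signProd ((sheetIndices hk).erase (Fin.castLE hk i)) (h (φ (g θ))) *
        SignType.sign (sinProd P Θ θ) = c := by
  classical
  by_cases hs : g θ₀ ∈ singularSet φ
  · obtain ⟨i', hi', -⟩ := (H.mem_singularSet_iff hi).1 hs
    -- Without a triple point there is exactly one other sheet, so a single sign has to be
    -- compensated.
    have hk3 : k ≠ 3 := fun e => htriple (by
      have := H.encard_preimage (H.mem_source hi) h0
      rw [e] at this
      exact this)
    have hii : ∀ l, l ≠ i ↔ l = i' := by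
      intro l
      have := l.2
      have := i.2
      have := i'.2
      simp only [ne_eq, Fin.ext_iff] at hi' ⊢
      omega
    have hJ : (sheetIndices hk).erase (Fin.castLE hk i) = {Fin.castLE hk i'} := by
      ext j
      simp only [sheetIndices, Finset.mem_erase, Finset.mem_image, Finset.mem_univ, true_and,
        Finset.mem_singleton]
      constructor
      · rintro ⟨hj, l, rfl⟩
        rw [(hii l).1 fun e => hj (congrArg _ e)]
      · rintro rfl
        exact ⟨fun e => hi' (Fin.castLE_injective hk e), i', rfl⟩
    obtain ⟨e, hes, he0, heC, heD⟩ := htrans hs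
    obtain ⟨c₁, hc₁, h1⟩ := H.exists_sign_eq hφ hii hi h0 hes he0 heD
    obtain ⟨δ, hδ, hδe⟩ := Metric.nhds_basis_closedBall.eventually_iff.1
      (hgc.continuousAt.eventually (e.open_source.eventually_mem hes))
    have hIcc : ∀ θ ∈ Icc (θ₀ - min δ 1) (θ₀ + min δ 1), g θ ∈ e.source := by
      intro θ hθ
      refine hδe ?_
      rw [Real.closedBall_eq_Icc]
      exact ⟨by linarith [hθ.1, min_le_left δ 1], by linarith [hθ.2, min_le_left δ 1]⟩
    obtain ⟨c₂, hc₂, h2⟩ := exists_sign_eq_mul_sign_sub (b := fun θ => e (g θ) 1) (θ₀ := θ₀)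
      (δ := min δ 1) (by positivity) (by
        have h3 : Continuous fun z : E2 => z 1 := by fun_prop
        exact h3.comp_continuousOn (e.continuousOn.comp hgc.continuousOn hIcc)) (by
        intro a ha b hb hab
        have hab' : e (g a) = e (g b) := by
          ext j
          fin_cases j
          · exact ((heC _ (hIcc a ha)).1 (mem_range_self a)).trans
              ((heC _ (hIcc b hb)).1 (mem_range_self b)).symm
          · exact hab
        -- On the curve the coordinate `e · 0` vanishes, so `e · 1` determines the point. The angles
        -- differ by at most `2 < 2 * π`, so no full turn fits in.
        obtain ⟨m, hm⟩ := (hg a b).1 (e.injOn (hIcc a ha) (hIcc b hb) hab')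
        have hlt : |(m : ℝ)| < 1 := by
          have h1 := min_le_right δ 1
          have hp := pi_gt_three
          rw [abs_lt]
          constructor <;> nlinarith [ha.1, ha.2, hb.1, hb.2]
        have hm0 : m = 0 := Int.abs_lt_one_iff.1 (by exact_mod_cast hlt)
        simpa [hm0] using hm) (by simp [he0])
    obtain ⟨c₃, hc₃, h3⟩ := exists_sign_sinProd hg hΘ ((hP _).2 ⟨mem_range_self _, hs⟩)
    refine ⟨c₁ * c₂ * c₃, mul_ne_zero (mul_ne_zero hc₁ hc₂) hc₃, ?_⟩
    filter_upwards [hgc.continuousAt.eventually h1, h2, h3] with θ h1 h2 h3 hθ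
    rw [hJ, signProd, Finset.prod_singleton, h1, h2, h3]
    have hne : SignType.sign (θ - θ₀) ≠ 0 := by
      rw [ne_eq, _root_.sign_eq_zero_iff, sub_eq_zero]
      rintro rfl
      exact hθ hs
    -- The sign of `θ - θ₀` occurs twice, once from the other sheet and once from `sinProd`, and
    -- cancels.
    rw [← mul_assoc c₁, mul_mul_mul_comm, SignType.mul_self_eq_one hne, mul_one]
  · have hJ : (sheetIndices hk).erase (Fin.castLE hk i) = ∅ := by
      ext j
      simp only [sheetIndices, Finset.mem_erase, Finset.mem_image, Finset.mem_univ, true_and,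
        Finset.notMem_empty, iff_false]
      rintro ⟨hj, l, rfl⟩
      exact hs ((H.mem_singularSet_iff hi).2 ⟨l, fun e => hj (congrArg _ e), by simp [h0]⟩)
    have hne : sinProd P Θ θ₀ ≠ 0 := sinProd_ne_zero hg hΘ fun hc => hs ((hP _).1 hc).2
    refine ⟨SignType.sign (sinProd P Θ θ₀), by simpa using hne, ?_⟩
    filter_upwards [continuous_sinProd.continuousAt.eventually (eventually_sign_eq hne)]
      with θ h1 _
    rw [hJ, signProd, Finset.prod_empty, one_mul, h1]

/-- The sides of the surface over a curve, given by a colouring of the complement. -/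
def curveSides (φ : S → E3) (w : E3 → SignType) (P : Finset S) (Θ : S → ℝ) (s : S) : Set E3 :=
  {x | x ∉ range φ ∧ w x = SignType.sign (sinProd P Θ (Θ s))}

/-- Near the point, `w` is `c₀` times the sign of the coordinate of the own sheet times the signs of
the others. Along the curve the latter, times the sign of `sinProd`, give a constant `c`. So the
condition in `curveSides` says that the own coordinate has sign `c₀ * c`, on both sides of a
crossing. -/
lemma IsSheetedChart.exists_isCoorientedChart [CompactSpace S]
    (H : IsSheetedChart φ hk h V) (hφ : Continuous φ) (hgc : Continuous g)
    (hg : ∀ θ θ', g θ = g θ' ↔ ∃ m : ℤ, θ = θ' + m * (2 * π))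
    (hgn : ∀ θ₀ (R : ℝ → Prop), (∀ᶠ θ in 𝓝 θ₀, R θ) →
        ∀ᶠ s in 𝓝 (g θ₀), s ∈ range g → ∃ θ, g θ = s ∧ R θ)
    (hP : ∀ s, s ∈ P ↔ s ∈ range g ∩ singularSet φ) (hPe : Even P.card)
    (hΘ : ∀ s ∈ range g, g (Θ s) = s)
    {w : E3 → SignType} {U : Set E3} (hw : IsColoring (range φ) w U) (hU : range φ ⊆ U)
    {s₀ : S} (hs₀ : s₀ ∈ range g) (h0s : φ s₀ ∈ h.source) (h0 : h (φ s₀) = 0)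
    (htriple : φ s₀ ∉ triplePoints φ)
    (htrans : s₀ ∈ singularSet φ → IsTransversalAt (range g) (singularSet φ) s₀) :
    ∃ V' h' j, s₀ ∈ V' ∧ IsCoorientedChart φ (curveSides φ w P Θ) (range g \ P) V' h' j := by
  obtain ⟨i, hi⟩ := H.exists_sheet h0s
  obtain ⟨θ₀, rfl⟩ := hs₀
  have hΘP : ∀ s ∈ P, g (Θ s) = s := fun s hs => hΘ s ((hP s).1 hs).1
  obtain ⟨c, hc, hcs⟩ := H.exists_signProd_mul_sign_sinProd hφ hgc hg hP hΘP hi h0 htriple htrans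
  obtain ⟨c₀, hc₀, hw₀⟩ := hw.exists_eq_mul_signProd H.isPlanesChart h0s (hU (mem_range_self _))
  have hi3 : Fin.castLE hk i ∈ sheetIndices hk := Finset.mem_image_of_mem _ (Finset.mem_univ i)
  obtain ⟨V', hV'sub, hV'o, hV'm⟩ := eventually_nhds_iff.1
    ((hgn θ₀ _ hcs).and
      ((hφ.continuousAt.eventually (eventually_eventually_nhds.2 hw₀)).and
        ((H.isOpen i).eventually_mem hi)))
  have key : ∀ s ∈ V' ∩ (range g \ P), ∀ᶠ x in 𝓝 (φ s), x ∈ curveSides φ w P Θ s ↔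
      SignType.sign (h x (Fin.castLE hk i)) = c₀ * c := by
    rintro s ⟨hs, hsg, hsP⟩
    obtain ⟨h1, h2, hsi⟩ := hV'sub s hs
    obtain ⟨θ, rfl, hθ⟩ := h1 hsg
    have hns : g θ ∉ singularSet φ := fun hc => hsP ((hP _).2 ⟨hsg, hc⟩)
    -- The chosen angle `Θ` may jump by full turns along the curve; evenness makes this harmless.
    have hper : sinProd P Θ (Θ (g θ)) = sinProd P Θ θ := by
      obtain ⟨m, hm⟩ := (hg _ _).1 (hΘ _ hsg)
      rw [hm, sinProd_add_int_mul hPe]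
    have hother : ∀ j ∈ (sheetIndices hk).erase (Fin.castLE hk i), h (φ (g θ)) j ≠ 0 := by
      intro j hj e
      obtain ⟨hj, hjs⟩ := Finset.mem_erase.1 hj
      obtain ⟨l, -, rfl⟩ := Finset.mem_image.1 hjs
      exact hns ((H.mem_singularSet_iff hsi).2 ⟨l, fun e => hj (congrArg _ e), e⟩)
    have hsrc := H.mem_source hsi
    filter_upwards [h2, h.open_source.eventually_mem hsrc,
      (h.continuousAt hsrc).eventually (eventually_signProd_eq hother)] with x hx hxs hxJ
    have hθ := hθ hns
    rw [← hxJ] at hθ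
    have hprod : signProd (sheetIndices hk) (h x) = SignType.sign (h x (Fin.castLE hk i)) *
        signProd ((sheetIndices hk).erase (Fin.castLE hk i)) (h x) :=
      (Finset.mul_prod_erase _ _ hi3).symm
    have hr : signProd ((sheetIndices hk).erase (Fin.castLE hk i)) (h x) ≠ 0 := fun e =>
      hc (by rw [← hθ, e, zero_mul])
    have hxX : x ∈ range φ ↔ SignType.sign (h x (Fin.castLE hk i)) = 0 := by
      rw [H.isPlanesChart x hxs]
      constructor
      · rintro ⟨j, hj, e⟩
        by_cases hji : j = Fin.castLE hk i
        · rw [← hji, e, _root_.sign_zero]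
        · refine absurd ?_ hr
          exact Finset.prod_eq_zero (Finset.mem_erase.2 ⟨hji, hj⟩) (by rw [e, _root_.sign_zero])
      · intro e
        exact ⟨_, hi3, _root_.sign_eq_zero_iff.1 e⟩
    rw [curveSides, mem_ofPred_eq, hper, hxX]
    have hxw : SignType.sign (h x (Fin.castLE hk i)) ≠ 0 → w x = c₀ * (SignType.sign
        (h x (Fin.castLE hk i)) * signProd ((sheetIndices hk).erase (Fin.castLE hk i)) (h x)) :=
      fun e => by rw [hx (fun hc => e (hxX.1 hc)), hprod]
    generalize SignType.sign (h x (Fin.castLE hk i)) = a at hxw ⊢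
    generalize signProd ((sheetIndices hk).erase (Fin.castLE hk i)) (h x) = r at hxw hθ hr
    generalize SignType.sign (sinProd P Θ θ) = t at hθ ⊢
    subst hθ
    by_cases ha : a = 0
    · subst ha
      simp [hc₀, hc, eq_comm]
    · rw [hxw ha]
      clear hxw hprod hx hw₀ hcs hxX
      revert hc hc₀ ha
      clear * -
      revert a r t c₀
      decide
  have hcc : c₀ * c = 1 ∨ c₀ * c = -1 := by
    clear * - hc hc₀
    revert c c₀
    decide
  rcases hcc with e | e
  · refine ⟨V', h, Fin.castLE hk i, hV'm, hV'o, (H.injOn i).mono fun s hs => (hV'sub s hs).2.2,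
      fun s hs => H.mem_source (hV'sub s hs).2.2, fun s hs => H.coord_eq_zero (hV'sub s hs).2.2,
      fun s hs => ?_⟩
    filter_upwards [key s hs] with x hx
    rw [hx, e, sign_eq_one_iff]
  -- Here the chosen side is the negative one; negating the chart makes it positive.
  · refine ⟨V', h.transHomeomorph (Homeomorph.neg E3), Fin.castLE hk i, hV'm, hV'o,
      (H.injOn i).mono fun s hs => (hV'sub s hs).2.2,
      fun s hs => H.mem_source (hV'sub s hs).2.2, fun s hs => ?_, fun s hs => ?_⟩
    · simpa using H.coord_eq_zero (hV'sub s hs).2.2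
    · filter_upwards [key s hs] with x hx
      rw [hx, e, sign_eq_neg_one_iff]
      simp

/-- An even number of crossings would allow a coorientation over a neighbourhood of the curve, hence
over a Möbius strip. -/
theorem odd_ncard_of_isOrientationReversing (hS : IsClosedSurface S)
    (hφ : IsGeneralPositionImmersion φ) {C : Set S} (hC : IsSimpleClosedCurve C)
    (hrev : IsOrientationReversing C) (hfin : (C ∩ singularSet φ).Finite)
    (htrans : ∀ s ∈ C ∩ singularSet φ, IsTransversalAt C (singularSet φ) s)
    (htriple : Disjoint (φ '' C) (triplePoints φ)) : Odd (C ∩ singularSet φ).ncard := by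
  have := hS.compact
  have := hS.hausdorff
  obtain ⟨γ, hγ, rfl⟩ := hC
  obtain ⟨g, hgc, hgr, hg, hgn⟩ := exists_angular_parametrization hγ
  rw [← hgr] at hrev hfin htrans htriple hgn ⊢
  by_contra hodd
  rw [Nat.not_odd_iff_even, ncard_eq_toFinset_card _ hfin] at hodd
  have hΘ : ∀ s ∈ range g, ∃ θ, g θ = s := fun s hs => hs
  choose! Θ hΘ using hΘ
  have hchart : ∀ p ∈ range φ, ∃ (k : ℕ) (hk : k ≤ 3) (h : OpenPartialHomeomorph E3 E3)
      (V : Fin k → Set S), p ∈ h.source ∧ h p = 0 ∧ IsSheetedChart φ hk h V := by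
    intro p hp
    obtain ⟨k, hk, h, V, h1, h2, h3, h4, h5, h6⟩ := hφ.coordinate_planes p hp
    exact ⟨k, hk, h, V, h1, h2, h3, h4, h5, fun i => (h6 i).1, fun i => (h6 i).2⟩
  obtain ⟨w, U, hw, hU⟩ := exists_isColoring (isCompact_range hφ.continuous) fun p hp => by
    obtain ⟨k, hk, h, V, h1, -, H⟩ := hchart p hp
    exact ⟨h, _, h1, H.isPlanesChart⟩
  obtain ⟨σ, hσ⟩ := exists_isCoorientation_of_diff_finite (φ := φ) (C := range g)
    (σ := curveSides φ w hfin.toFinset Θ) hfin.toFinset.finite_toSet fun s hs => by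
      obtain ⟨k, hk, h, V, h1, h2, H⟩ := hchart (φ s) (mem_range_self s)
      exact H.exists_isCoorientedChart hφ.continuous hgc hg hgn (by simp) hodd hΘ hw hU hs h1 h2
        (fun hc => htriple.le_bot ⟨mem_image_of_mem φ hs, hc⟩) fun hc => htrans s ⟨hs, hc⟩
  obtain ⟨O, σ', hO, hCO, hσ'⟩ := hσ.exists_extension hφ.continuous
    (hgr ▸ isCompact_range hγ.continuous)
  obtain ⟨f, hf, hfO⟩ := hrev O hO hCO
  exact hσ'.false_of_mobiusStrip hφ.continuous hf.continuous hf.injective hfO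

end Curve

end ImmersedSurface

theorem lemma1 {S : Type*} [TopologicalSpace S] (hS : ImmersedSurface.IsClosedSurface S)
    (φ : S → EuclideanSpace ℝ (Fin 3)) (hφ : ImmersedSurface.IsGeneralPositionImmersion φ)
    (C : Set S) (hC : ImmersedSurface.IsSimpleClosedCurve C)
    (hrev : ImmersedSurface.IsOrientationReversing C) :
    (φ '' C ∩ ImmersedSurface.doubleSet φ).Nonempty ∧
    ((C ∩ ImmersedSurface.singularSet φ).Finite →
      (∀ s ∈ C ∩ ImmersedSurface.singularSet φ,
        ImmersedSurface.IsTransversalAt C (ImmersedSurface.singularSet φ) s) →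
      Disjoint (φ '' C) (ImmersedSurface.triplePoints φ) →
      Odd (C ∩ ImmersedSurface.singularSet φ).ncard) := by
  refine ⟨?_, ImmersedSurface.odd_ncard_of_isOrientationReversing hS hφ hC hrev⟩
  -- If the curve missed the double set there would be zero crossings; transversality would hold
  -- vacuously, triple points are double points, and zero would have to be odd.
  by_contra hne
  have hdisj := Set.not_nonempty_iff_eq_empty.1 hne
  have h0 : C ∩ ImmersedSurface.singularSet φ = ∅ := by
    refine Set.eq_empty_of_forall_notMem fun s hs => ?_
    exact hne ⟨φ s, Set.mem_image_of_mem φ hs.1, hs.2⟩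
  have h3 : ImmersedSurface.triplePoints φ ⊆ ImmersedSurface.doubleSet φ := by
    intro p hp
    have hp : (φ ⁻¹' {p}).encard = 3 := hp
    refine Set.one_lt_encard_iff_nontrivial.1 ?_
    rw [hp]
    norm_num
  have := ImmersedSurface.odd_ncard_of_isOrientationReversing hS hφ hC hrev (by simp [h0])
    (by simp [h0]) ((Set.disjoint_iff_inter_eq_empty.2 hdisj).mono_right h3)
  simp [h0] at this
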